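/- **Theorem.** Let $q\in\mathbb C$ be nonzero and not a root of unity, fix a square root $q^{1/2}$, and put $[n]_q=\frac{q^n-q^{-n}}{q-q^{-1}}$, $z_\pm=zq^{\pm c/2}$, $\delta(x)=\sum_{l\in\mathbb Z}x^l$, $\{A,B\}=AB+BA$. Let $U_q[osp(2|2)^{(2)}]$ be the $\mathbb Z_2$-graded associative unital $\mathbb C$-algebra generated by a central $c$ (through $q^{\pm c/2}$) and the modes of the currents $X^\pm(z)=\sum_{n\in\mathbb Z}X^\pm_nz^{-n-1}$ (odd) and $\psi^\pm(z)=\sum_{n\ge0}\psi^\pm_{\pm n}z^{\mp n}$ (even, invertible, $\psi^+_0\psi^-_0=\psi^-_0\psi^+_0=1$), with relations $$\psi^\pm(z)\psi^\pm(w)=\psi^\pm(w)\psi^\pm(z),\qquad \psi^+(z)\psi^-(w)=\frac{(z_+q+w_-)(z_-+w_+q)}{(z_++w_-q)(z_-q+w_+)}\psi^-(w)\psi^+(z),$$ $$\psi^\pm(z)^{-1}X^+(w)\psi^\pm(z)=\frac{z_\pm+wq}{z_\pm q+w}X^+(w),\qquad \psi^\pm(z)X^-(w)\psi^\pm(z)^{-1}=\frac{z_\mp+wq}{z_\mp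 q+w}X^-(w),$$ $$(z+wq^{\pm1})X^\pm(z)X^\pm(w)+(zq^{\pm1}+w)X^\pm(w)X^\pm(z)=0,$$ $$\{X^+(z),X^-(w)\}=\frac{1}{(q-q^{-1})zw}\Big[\delta\big(\tfrac wzq^{c}\big)\psi^+(w_+)-\delta\big(\tfrac wzq^{-c}\big)\psi^-(z_+)\Big],$$ where rational functions are expanded in $w/z$ in the relations containing $\psi^+(z)$ and in $z/w$ in those relating $\psi^-(z)$ and $X^\pm(w)$. Let $a_n,c_n$ ($n\in\mathbb Z$), $Q_a,Q_c$ satisfy, for $n\neq0$, $[a_n,a_m]=\delta_{n+m,0}(-1)^n\frac{[n]_q^2}{n}$ and $[c_n,c_m]=\delta_{n+m,0}\frac{[n]_q^2}{n}$, and $[a_0,Q_a]=[c_0,Q_c]=1$, all other commutators being zero. They act (the $Q$'s through $e^{kQ_a+lQ_c}$) on the Fock space $\mathcal F=\bigoplus_{k,l\in\mathbb Z}\mathbb C[a_{-n},c_{-n}:n\ge1]\,e^{kQ_a+lQ_c}|0\rangle$, where $a_n|0\rangle=c_n|0\rangle=0$ for $n\geq0$. Put $$a(z;\kappa)=Q_a+a_0\ln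 z-\sum_{n\ne0}\frac{a_n}{[n]_q}q^{\kappa|n|}z^{-n},\qquad c(z)=Q_c+c_0\ln z-\sum_{n\neq0}\frac{c_n}{[n]_q}z^{-n},$$ $$a_\pm(z)=\pm(q-q^{-1})\sum_{n>0}a_{\pm n}z^{\mp n}\pm a_0\ln q,$$ $$Y^+(z)=e^{c(q^{1/2}z)}+e^{-c(-q^{-1/2}z)},\qquad Y^-(z)=e^{c(-q^{1/2}z)}+e^{-c(q^{-1/2}z)},$$ and let $:\ :$ be normal ordering (negative modes and $Q$'s to the left of nonnegative modes). Then there is an algebra homomorphism $U_q[osp(2|2)^{(2)}]\to\mathrm{End}(\mathcal F)$ at level one ($c\mapsto1$, i.e. $q^{c/2}\mapsto q^{1/2}$), given by $$\psi^\pm(z)\mapsto e^{a_\pm(z)},\qquad X^\pm(z)\mapsto{:}e^{\pm a(z;\mp1/2)}Y^\pm(z){:}\,F^\pm,\qquad F^+=q^{1/2}+q^{-1/2},\quad F^-=-\frac1{q-q^{-1}}.$$ It respects the $\mathbb Z_2$-gradings, $\mathcal F$ being graded by the parity of $a_0$. The realization is nonclassical: $X^-(z)$ has no limit as $q\to1$;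 indeed, for every choice of the square roots $q^{1/2}$, some matrix element of a mode of $X^-(z)$ between vectors $e^{kQ_a+lQ_c}|0\rangle$ has no limit as $q\to1$ ($q$ not a root of unity). -/

import Mathlib

open scoped PowerSeries

noncomputable section

namespace TwistedOsp

/-! ## The algebra `U_q[osp(2|2)^{(2)}]` in Drinfeld's presentation -/

/-- Modes of the Drinfeld currents.  `gam`, `gamInv` stand for `q^{c/2}`, `q^{-c/2}`, where `c` is
the central element.  The currents are
`X^±(z) = ∑_{n ∈ ℤ} X^±_n z^{-n-1}`, `ψ^+(z) = ∑_{n ≥ 0} ψ^+_n z^{-n}`,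
`ψ^-(z) = ∑_{n ≥ 0} ψ^-_{-n} z^{n}`; `psiM n` is the mode `ψ^-_{-n}`.
`phiP n`, `phiM n` are the coefficients of `z^{-n}` in `ψ^+(z)⁻¹` and of `z^n` in `ψ^-(z)⁻¹`. -/
inductive Gen : Type
  | gam
  | gamInv
  | xP (n : ℤ)
  | xM (n : ℤ)
  | psiP (n : ℕ)
  | psiM (n : ℕ)
  | phiP (n : ℕ)
  | phiM (n : ℕ)

/-- The sign `(-1)^{[g]}` of the `ℤ₂`-degree of a generator: `X^±` are odd, all others even. -/
def Gen.sign : Gen → ℂ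
  | .xP _ => -1
  | .xM _ => -1
  | _ => 1

section Expansions

variable {R : Type*} [Ring R]

/-- The polynomial `a + b u`. -/
def lin (a b : R) : R⟦X⟧ := PowerSeries.mk fun k => if k = 0 then a else if k = 1 then b else 0

/-- The expansion in nonnegative powers of `u` of `1 / (a + b u)`, for commuting `a`, `b` and
`aInv` the inverse of `a`: `∑_k (-1)^k a^{-k-1} b^k u^k`. -/
def linInv (aInv b : R) : R⟦X⟧ := PowerSeries.mk fun k => (-1) ^ k * aInv ^ (k + 1) * b ^ k

end Expansions

/-- The free algebra on the generators. -/
abbrev FreeU : Type := FreeAlgebra ℂ Gen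

/-- A generator, as an element of the free algebra. -/
abbrev gen (g : Gen) : FreeU := FreeAlgebra.ι ℂ g

/-- A complex number, as an element of the free algebra. -/
abbrev sc (x : ℂ) : FreeU := algebraMap ℂ FreeU x

/-- `q^{c/2}` in the free algebra. -/
abbrev Γ : FreeU := gen .gam

/-- `q^{-c/2}` in the free algebra. -/
abbrev Γi : FreeU := gen .gamInv

/-- `q^{jc/2}` for an integer `j`. -/
def gamPow (j : ℤ) : FreeU := if 0 ≤ j then Γ ^ j.toNat else Γi ^ (-j).toNat

/-- The mode `ψ^+_k`, the coefficient of `z^{-k}` in `ψ^+(z)`; zero for `k < 0`. -/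
def psiPlusMode (k : ℤ) : FreeU := if 0 ≤ k then gen (.psiP k.toNat) else 0

/-- The mode `ψ^-_k`, the coefficient of `z^{-k}` in `ψ^-(z)`; zero for `k > 0`. -/
def psiMinusMode (k : ℤ) : FreeU := if k ≤ 0 then gen (.psiM (-k).toNat) else 0

/-- `(z₊q + w₋)(z₋ + w₊q) / ((z₊ + w₋q)(z₋q + w₊))`, where `z_± = z q^{±c/2}`, expanded in
`u = w/z`. -/
def gPsiPsi (q : ℂ) : FreeU⟦X⟧ :=
  lin (Γ * sc q) Γi * lin Γi (Γ * sc q) * linInv Γi (Γi * sc q) * linInv (Γ * sc q⁻¹) Γ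

/-- `(z₊ + wq) / (z₊q + w)` expanded in `w/z`. -/
def gXpPsiP (q : ℂ) : FreeU⟦X⟧ := lin Γ (sc q) * linInv (Γi * sc q⁻¹) 1

/-- `(z₋ + wq) / (z₋q + w)` expanded in `z/w`. -/
def gXpPsiM (q : ℂ) : FreeU⟦X⟧ := lin (sc q) Γi * linInv 1 (Γi * sc q)

/-- `(z₋ + wq) / (z₋q + w)` expanded in `w/z`. -/
def gXmPsiP (q : ℂ) : FreeU⟦X⟧ := lin Γi (sc q) * linInv (Γ * sc q⁻¹) 1

/-- `(z₊ + wq) / (z₊q + w)` expanded in `z/w`. -/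
def gXmPsiM (q : ℂ) : FreeU⟦X⟧ := lin (sc q) Γ * linInv 1 (Γ * sc q)

/-- The series `∑_n g_n u^n` whose coefficients are the generators `g n`. -/
def genSeries (g : ℕ → Gen) : FreeU⟦X⟧ := PowerSeries.mk fun n => gen (g n)

/-- The defining relations, coefficient by coefficient in the spectral parameters. -/
inductive DrinfeldRel (q : ℂ) : FreeU → FreeU → Prop
  /-- `c` is central, and `q^{c/2}`, `q^{-c/2}` are inverse to each other -/
  | gam_central (g : Gen) : DrinfeldRel q (Γ * gen g) (gen g * Γ)
  | gam_mul_inv : DrinfeldRel q (Γ * Γi) 1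
  | inv_mul_gam : DrinfeldRel q (Γi * Γ) 1
  /-- `ψ^±(z)` are invertible -/
  | psiP_mul_phiP (n : ℕ) :
      DrinfeldRel q (PowerSeries.coeff n (genSeries .psiP * genSeries .phiP))
        (PowerSeries.coeff n (1 : FreeU⟦X⟧))
  | phiP_mul_psiP (n : ℕ) :
      DrinfeldRel q (PowerSeries.coeff n (genSeries .phiP * genSeries .psiP))
        (PowerSeries.coeff n (1 : FreeU⟦X⟧))
  | psiM_mul_phiM (n : ℕ) :
      DrinfeldRel q (PowerSeries.coeff n (genSeries .psiM * genSeries .phiM))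
        (PowerSeries.coeff n (1 : FreeU⟦X⟧))
  | phiM_mul_psiM (n : ℕ) :
      DrinfeldRel q (PowerSeries.coeff n (genSeries .phiM * genSeries .psiM))
        (PowerSeries.coeff n (1 : FreeU⟦X⟧))
  /-- the constant terms of `ψ^+(z)` and `ψ^-(z)` are `K` and `K⁻¹` -/
  | K_mul_inv : DrinfeldRel q (gen (.psiP 0) * gen (.psiM 0)) 1
  | inv_mul_K : DrinfeldRel q (gen (.psiM 0) * gen (.psiP 0)) 1
  /-- `ψ^±(z) ψ^±(w) = ψ^±(w) ψ^±(z)` -/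
  | psiP_comm (n m : ℕ) : DrinfeldRel q (gen (.psiP n) * gen (.psiP m)) (gen (.psiP m) * gen (.psiP n))
  | psiM_comm (n m : ℕ) : DrinfeldRel q (gen (.psiM n) * gen (.psiM m)) (gen (.psiM m) * gen (.psiM n))
  /-- `ψ^+(z) ψ^-(w) = (z₊q + w₋)(z₋ + w₊q) / ((z₊ + w₋q)(z₋q + w₊)) ψ^-(w) ψ^+(z)`:
  coefficient of `z^{-n} w^m` -/
  | psiP_psiM (n m : ℕ) :
      DrinfeldRel q (gen (.psiP n) * gen (.psiM m))
        (∑ k ∈ Finset.range (min n m + 1),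
          PowerSeries.coeff k (gPsiPsi q) * (gen (.psiM (m - k)) * gen (.psiP (n - k))))
  /-- `ψ^+(z)⁻¹ X^+(w) ψ^+(z) = (z₊ + wq) / (z₊q + w) X^+(w)`: coefficient of `z^{-n} w^{-m-1}` -/
  | psiP_xP (n : ℕ) (m : ℤ) :
      DrinfeldRel q (∑ p ∈ Finset.HasAntidiagonal.antidiagonal n, gen (.phiP p.1) * gen (.xP m) * gen (.psiP p.2))
        (PowerSeries.coeff n (gXpPsiP q) * gen (.xP (m + n)))
  /-- `ψ^-(z)⁻¹ X^+(w) ψ^-(z) = (z₋ + wq) / (z₋q + w) X^+(w)`: coefficient of `z^n w^{-m-1}` -/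
  | psiM_xP (n : ℕ) (m : ℤ) :
      DrinfeldRel q (∑ p ∈ Finset.HasAntidiagonal.antidiagonal n, gen (.phiM p.1) * gen (.xP m) * gen (.psiM p.2))
        (PowerSeries.coeff n (gXpPsiM q) * gen (.xP (m - n)))
  /-- `ψ^+(z) X^-(w) ψ^+(z)⁻¹ = (z₋ + wq) / (z₋q + w) X^-(w)`: coefficient of `z^{-n} w^{-m-1}` -/
  | psiP_xM (n : ℕ) (m : ℤ) :
      DrinfeldRel q (∑ p ∈ Finset.HasAntidiagonal.antidiagonal n, gen (.psiP p.1) * gen (.xM m) * gen (.phiP p.2))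
        (PowerSeries.coeff n (gXmPsiP q) * gen (.xM (m + n)))
  /-- `ψ^-(z) X^-(w) ψ^-(z)⁻¹ = (z₊ + wq) / (z₊q + w) X^-(w)`: coefficient of `z^n w^{-m-1}` -/
  | psiM_xM (n : ℕ) (m : ℤ) :
      DrinfeldRel q (∑ p ∈ Finset.HasAntidiagonal.antidiagonal n, gen (.psiM p.1) * gen (.xM m) * gen (.phiM p.2))
        (PowerSeries.coeff n (gXmPsiM q) * gen (.xM (m - n)))
  /-- `(z + wq) X^+(z) X^+(w) + (zq + w) X^+(w) X^+(z) = 0`: coefficient of `z^{-n-1} w^{-m-1}` -/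
  | xP_xP (n m : ℤ) :
      DrinfeldRel q (gen (.xP (n + 1)) * gen (.xP m) + q • (gen (.xP n) * gen (.xP (m + 1)))
        + (q • (gen (.xP m) * gen (.xP (n + 1))) + gen (.xP (m + 1)) * gen (.xP n))) 0
  /-- `(z + wq⁻¹) X^-(z) X^-(w) + (zq⁻¹ + w) X^-(w) X^-(z) = 0`: coefficient of
  `z^{-n-1} w^{-m-1}` -/
  | xM_xM (n m : ℤ) :
      DrinfeldRel q (gen (.xM (n + 1)) * gen (.xM m) + q⁻¹ • (gen (.xM n) * gen (.xM (m + 1)))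
        + (q⁻¹ • (gen (.xM m) * gen (.xM (n + 1))) + gen (.xM (m + 1)) * gen (.xM n))) 0
  /-- `{X^+(z), X^-(w)} = [δ((w/z) q^c) ψ^+(w₊) - δ((w/z) q^{-c}) ψ^-(z₊)] / ((q - q⁻¹) z w)`:
  coefficient of `z^{-n-1} w^{-m-1}` -/
  | xP_xM (n m : ℤ) :
      DrinfeldRel q (gen (.xP n) * gen (.xM m) + gen (.xM m) * gen (.xP n))
        ((q - q⁻¹)⁻¹ • (gamPow (n - m) * psiPlusMode (n + m)
          - gamPow (m - n) * psiMinusMode (n + m)))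

/-- The algebra `U_q[osp(2|2)^{(2)}]`. -/
abbrev Uq (q : ℂ) : Type := RingQuot (DrinfeldRel q)

/-- A generator, as an element of `U_q[osp(2|2)^{(2)}]`. -/
def Uq.gen (q : ℂ) (g : Gen) : Uq q := RingQuot.mkAlgHom ℂ (DrinfeldRel q) (FreeAlgebra.ι ℂ g)

/-! ## The Fock space of the two bosons -/

/-- The two families of oscillators. -/
inductive Boson : Type
  | a
  | c

/-- The Fock space `⨁_{(k,l) ∈ ℤ²} ℂ[a_{-n}, c_{-n} : n ≥ 1] e^{k Q_a + l Q_c}|0⟩`. -/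
abbrev Fock : Type := (ℤ × ℤ) →₀ MvPolynomial (Boson × ℕ+) ℂ

/-- The operators on the Fock space. -/
abbrev Op : Type := Module.End ℂ Fock

/-- The vector `e^{k Q_a + l Q_c}|0⟩`, for `μ = (k, l)`. -/
def vac (μ : ℤ × ℤ) : Fock := Finsupp.single μ 1

/-- The operator `f(a₀, c₀)`: on the summand of charge `μ` it is multiplication by `f μ`. -/
def diag (f : ℤ × ℤ → ℂ) : Op := Finsupp.lsum ℂ fun μ => f μ • Finsupp.lsingle μ

/-- The operator `e^{k Q_a + l Q_c}`, for `μ = (k, l)`. -/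
def shift (μ : ℤ × ℤ) : Op := Finsupp.lmapDomain _ ℂ fun ν => μ + ν

/-- `[n]_q = (q^n - q^{-n}) / (q - q⁻¹)`. -/
def qInt (q : ℂ) (n : ℤ) : ℂ := (q ^ n - q ^ (-n)) / (q - q⁻¹)

/-- The oscillators `a_n`, `c_n`, with `[a_n, a_m] = δ_{n+m,0} (-1)^n [n]_q² / n`,
`[c_n, c_m] = δ_{n+m,0} [n]_q² / n`, `[a_n, c_m] = 0`. The negative modes are multiplication
operators, the positive ones derivations that kill the vectors `vac μ`. -/
def osc (q : ℂ) (b : Boson) (n : ℤ) : Op :=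
  if n = 0 then
    match b with
    | .a => diag fun μ => μ.1
    | .c => diag fun μ => μ.2
  else if 0 < n then
    ((match b with
      | .a => (-1 : ℂ) ^ n
      | .c => 1) * qInt q n ^ 2 / n) •
        Finsupp.mapRange.linearMap
          (MvPolynomial.pderiv (R := ℂ) (b, n.natAbs.toPNat')).toLinearMap
  else
    Finsupp.mapRange.linearMap
      (LinearMap.mulLeft ℂ (MvPolynomial.X (R := ℂ) (b, n.natAbs.toPNat')))

/-- The exponential `∑_k f^k / k!` of a power series without constant term. -/
def expSeries (f : Op⟦X⟧) : Op⟦X⟧ :=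
  PowerSeries.mk fun n =>
    ∑ k ∈ Finset.range (n + 1), ((k.factorial : ℂ)⁻¹) • PowerSeries.coeff n (f ^ k)

/-- The part with nonzero modes of the field
`b(ζz) = Q_b + b₀ ln (ζz) - ∑_{n ≠ 0} (b_n / [n]_q) p^{|n|} (ζz)^{-n}`, where `p = q^κ`:
the negative modes, as a power series in `z`. -/
def fieldNeg (q : ℂ) (b : Boson) (p ζ : ℂ) : Op⟦X⟧ :=
  PowerSeries.mk fun n =>
    if n = 0 then 0 else (-(p ^ n * ζ ^ n / qInt q (-(n : ℤ)))) • osc q b (-(n : ℤ))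

/-- The positive modes of the same field, as a power series in `z⁻¹`. -/
def fieldPos (q : ℂ) (b : Boson) (p ζ : ℂ) : Op⟦X⟧ :=
  PowerSeries.mk fun n =>
    if n = 0 then 0 else (-(p ^ n * (ζ ^ n)⁻¹ / qInt q (n : ℤ))) • osc q b (n : ℤ)

/-- The coefficient of `z^i` in the zero mode factor
`e^{ε Q_a + ε' Q_c} z^{ε a₀} (ζz)^{ε' c₀}`. -/
def zeroFactor (ζ : ℂ) (ε ε' : ℤ) (i : ℤ) : Op :=
  shift (ε, ε') * diag fun μ => if ε * μ.1 + ε' * μ.2 = i then ζ ^ (ε' * μ.2) else 0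

/-- The coefficient of `z^N` in the normally ordered exponential
`:e^{ε a(z;κ)} e^{ε' c(ζz)}:`, where `p = q^κ`, applied to `v`: to the left stand the negative
modes, then `e^{ε Q_a + ε' Q_c}`, then `z^{ε a₀} (ζz)^{ε' c₀}`, then the positive modes. Only
finitely many terms of the sum are nonzero. -/
def vertex (q p ζ : ℂ) (ε ε' : ℤ) (N : ℤ) (v : Fock) : Fock :=
  ∑ᶠ jk : ℕ × ℕ,
    PowerSeries.coeff jk.1 (expSeries (ε • fieldNeg q .a p 1 + ε' • fieldNeg q .c 1 ζ))
      (zeroFactor ζ ε ε' (N - jk.1 + jk.2)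
        (PowerSeries.coeff jk.2
          (expSeries (ε • fieldPos q .a p 1 + ε' • fieldPos q .c 1 ζ)) v))

/-- The mode `X^+_n`, the coefficient of `z^{-n-1}` in
`X^+(z) = :e^{a(z;-1/2)} (e^{c(q^{1/2}z)} + e^{-c(-q^{-1/2}z)}): (q^{1/2} + q^{-1/2})`.
Here and below `s` is the chosen square root `q^{1/2}`. -/
def bosonXp (q s : ℂ) (n : ℤ) (v : Fock) : Fock :=
  (s + s⁻¹) • (vertex q s⁻¹ s 1 1 (-n - 1) v + vertex q s⁻¹ (-s⁻¹) 1 (-1) (-n - 1) v)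

/-- The mode `X^-_n`, the coefficient of `z^{-n-1}` in
`X^-(z) = :e^{-a(z;1/2)} (e^{c(-q^{1/2}z)} + e^{-c(q^{-1/2}z)}): · (-1/(q - q⁻¹))`. -/
def bosonXm (q s : ℂ) (n : ℤ) (v : Fock) : Fock :=
  (-(q - q⁻¹)⁻¹) • (vertex q s (-s) (-1) 1 (-n - 1) v + vertex q s s⁻¹ (-1) (-1) (-n - 1) v)

/-- The coefficient of `z^{-n}` in `ψ^+(z) = exp((q - q⁻¹) ∑_{n > 0} a_n z^{-n} + a₀ ln q)`. -/
def bosonPsiP (q : ℂ) (n : ℕ) : Op :=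
  (diag fun μ => q ^ μ.1) *
    PowerSeries.coeff n (expSeries (PowerSeries.mk fun k =>
      if k = 0 then 0 else (q - q⁻¹) • osc q .a (k : ℤ)))

/-- The coefficient of `z^n` in `ψ^-(z) = exp(-(q - q⁻¹) ∑_{n > 0} a_{-n} z^n - a₀ ln q)`. -/
def bosonPsiM (q : ℂ) (n : ℕ) : Op :=
  (diag fun μ => q ^ (-μ.1)) *
    PowerSeries.coeff n (expSeries (PowerSeries.mk fun k =>
      if k = 0 then 0 else (-(q - q⁻¹)) • osc q .a (-(k : ℤ))))

/-- The `ℤ₂`-grading of the Fock space by the parity of the charge `a₀`. -/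
def parity : Op := diag fun μ => (-1) ^ μ.1

/-- The values of `q` for which the fields are defined: nonzero and not a root of unity. -/
def Admissible (q : ℂ) : Prop := q ≠ 0 ∧ ∀ n : ℕ, 0 < n → q ^ n ≠ 1

end TwistedOsp

end

/-!
The homomorphism is defined on generators, so everything reduces to checking the relations on the
Fock space, and this is a computation of operator product expansions, done coefficient by
coefficient.

*Exchange of exponentials.* If `[α_i, β_j] = δ_{ij} κ_i` with scalars `κ_i`, then `exp α(z) exp
β(w) = exp κ(zw) exp β(w) exp α(z)` (`IsExp.exchange`). Both sides satisfy the same differential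
equation for the Euler operator `z d/dz` and agree at `z = 0`, hence are equal (`eq_of_euler_eq`);
no analysis of the exponential series is needed. Almost all coefficients of an exponential of
annihilation operators kill a given vector (`locNil_modeExp`), so that normally ordered products
have well defined modes in all integer degrees, and the exchange relation turns into Wick's
theorem: the modes of `V₁(z) V₂(w)` and of `V₂(w) V₁(z)` are expansions, in `w/z` and in `z/w`, of
a rational contraction times the same normally ordered product `:V₁(z) V₂(w):`
(`mode_mode_eventually`, `mode_mode_swap_eventually`).

*Contractions.* Each of `X⁺(z)`, `X⁻(z)` is a sum of two vertex operators. The `a`-modes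
contribute the factor `z (1 + p₁p₂ u)` and the `c`-modes the factor `ζ₁ z (1 - (ζ₂/ζ₁) u)`, where
`u = w/z`, each to a power `±1` (`contraction_eq`); the powers of `ζ₁ z` and `z` come from the
zero modes. Therefore:

* in `X^±(z) X^±(w)` the contraction is `(z + q^{∓1} w)(z - w)` for equal summands, and for
  different ones it is a constant in one order and proportional to `(z + q^{∓1} w) / (z + q^{±1}
  w)` in the other; multiplication by `z + q^{±1} w` gives the quadratic relations
  (`mode_quadratic_self`, `mode_quadratic_pair`);
* in `X⁺(z) X⁻(w)` the contraction of the two pairs with equal `c`-charge is a constant that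
  changes sign with the order of the factors (`mode_anticomm`), and it is proportional to `z⁻² /
  ((1 + u)(1 - r u))`, `r = q^{±1}`, for the pairs with opposite charges. The difference of the
  two expansions of this function is a sum of delta functions at `u = -1` and `u = r⁻¹`
  (`sum_expansions_eq_delta`, `mode_anticommutator`). At `u = -1` the two pairs contribute the
  same operator with opposite signs. At `u = r⁻¹` the `c`-oscillators and half of the
  `a`-oscillators drop out of the normally ordered product, and what is left is `ψ^-` for one pair
  and `ψ^+` for the other (`xPlus_xMinus`);
* the relations with `ψ^±` come from the contraction of an `a`-exponential with a vertex operator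
  (`conj_annihilator`, `conj_creator`, `cartanMode_exchange`).

*Limit.* The matrix element of `X⁻_{-1}` between `|0⟩` and `e^{-Q_a + Q_c}|0⟩` is `-1/(q - q⁻¹)`,
which is unbounded near `q = 1`.
-/

open scoped PowerSeries

noncomputable section

namespace TwistedOsp

open Finset.HasAntidiagonal (antidiagonal mem_antidiagonal)

/-! ### Exponentials of formal power series and the Euler operator -/

section ExpCalculus

variable {R : Type*} [Ring R]

/-- The Euler operator `u d/du` on power series with not necessarily commuting coefficients. -/
def euler (f : R⟦X⟧) : R⟦X⟧ := PowerSeries.mk fun n => n • PowerSeries.coeff n f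

@[simp] lemma coeff_euler (f : R⟦X⟧) (n : ℕ) :
    PowerSeries.coeff n (euler f) = n • PowerSeries.coeff n f := PowerSeries.coeff_mk _ _

lemma euler_add (f g : R⟦X⟧) : euler (f + g) = euler f + euler g := by
  ext n; simp [smul_add]

lemma euler_sub (f g : R⟦X⟧) : euler (f - g) = euler f - euler g := by
  ext n; simp [smul_sub]

lemma euler_mul (f g : R⟦X⟧) : euler (f * g) = euler f * g + f * euler g := by
  ext n
  simp only [coeff_euler, map_add, PowerSeries.coeff_mul, Finset.smul_sum, ← Finset.sum_add_distrib]
  refine Finset.sum_congr rfl fun p hp => ?_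
  rw [← mem_antidiagonal.mp hp, smul_mul_assoc, mul_smul_comm, ← add_smul]

lemma euler_C (r : R) : euler (PowerSeries.C r) = 0 := by
  ext n
  rcases Nat.eq_zero_or_pos n with rfl | h <;> simp [PowerSeries.coeff_C, *]
  intro h'; omega

lemma euler_one : euler (1 : R⟦X⟧) = 0 := by
  simpa using euler_C (1 : R)

lemma commute_of_coeff {f g : R⟦X⟧}
    (h : ∀ i j, Commute (PowerSeries.coeff i f) (PowerSeries.coeff j g)) : Commute f g := by
  ext n
  rw [PowerSeries.coeff_mul, PowerSeries.coeff_mul, ← Finset.Nat.sum_antidiagonal_swap]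
  exact Finset.sum_congr rfl fun p _ => (h _ _).eq

lemma commute_coeff_mul {t : R} {f g : R⟦X⟧} (hf : ∀ i, Commute t (PowerSeries.coeff i f))
    (hg : ∀ i, Commute t (PowerSeries.coeff i g)) (n : ℕ) :
    Commute t (PowerSeries.coeff n (f * g)) := by
  rw [PowerSeries.coeff_mul]
  exact Commute.sum_right _ _ _ fun p _ => (hf _).mul_right (hg _)

lemma commute_coeff_one (t : R) (n : ℕ) : Commute t (PowerSeries.coeff n (1 : R⟦X⟧)) := by
  rw [PowerSeries.coeff_one]
  split_ifs
  exacts [Commute.one_right t, Commute.zero_right t]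

lemma commute_coeff_pow {t : R} {f : R⟦X⟧} (hf : ∀ i, Commute t (PowerSeries.coeff i f))
    (k n : ℕ) : Commute t (PowerSeries.coeff n (f ^ k)) := by
  induction k generalizing n with
  | zero => simpa using commute_coeff_one t n
  | succ k ih => rw [pow_succ]; exact commute_coeff_mul ih hf n

/-- `E` is the exponential of `f`, characterized by its differential equation `u E' = (u f') E` and
its constant term. For noncommuting coefficients this is meaningful as long as those of `f`
commute. -/
structure IsExp (f E : R⟦X⟧) : Prop where
  coeff_zero : PowerSeries.coeff 0 E = 1
  euler_eq : euler E = euler f * E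

variable [Algebra ℂ R]

/-- The equation `u E' = F E` with `F(0) = 0` determines `E` by its constant term. -/
lemma eq_of_euler_eq {F E E' : R⟦X⟧} (hF : PowerSeries.coeff 0 F = 0) (h : euler E = F * E)
    (h' : euler E' = F * E') (h0 : PowerSeries.coeff 0 E = PowerSeries.coeff 0 E') : E = E' := by
  ext n
  induction n using Nat.strong_induction_on with
  | _ n ih =>
    rcases Nat.eq_zero_or_pos n with rfl | hn
    · exact h0
    have key : n • PowerSeries.coeff n E = n • PowerSeries.coeff n E' := by
      rw [← coeff_euler, ← coeff_euler, h, h', PowerSeries.coeff_mul, PowerSeries.coeff_mul]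
      refine Finset.sum_congr rfl fun p hp => ?_
      have hp' := mem_antidiagonal.mp hp
      rcases Nat.eq_zero_or_pos p.1 with h1 | h1
      · rw [h1, hF, zero_mul, zero_mul]
      · rw [ih p.2 (by omega)]
    have hn' : (n : ℂ) ≠ 0 := by exact_mod_cast hn.ne'
    rw [← Nat.cast_smul_eq_nsmul ℂ, ← Nat.cast_smul_eq_nsmul ℂ] at key
    exact smul_right_injective R hn' key

lemma IsExp.unique {f E E' : R⟦X⟧} (h : IsExp f E) (h' : IsExp f E') : E = E' :=
  eq_of_euler_eq (by simp) h.euler_eq h'.euler_eq (h.coeff_zero.trans h'.coeff_zero.symm)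

omit [Algebra ℂ R] in
lemma IsExp.mul {f f' E E' : R⟦X⟧} (h : IsExp f E) (h' : IsExp f' E')
    (hc : Commute E (euler f')) : IsExp (f + f') (E * E') where
  coeff_zero := by simp [PowerSeries.coeff_mul, h.coeff_zero, h'.coeff_zero]
  euler_eq := by
    rw [euler_mul, euler_add, h.euler_eq, h'.euler_eq, ← mul_assoc E, hc.eq]
    noncomm_ring

/-- If `[α_i, β_j] = δ_{ij} κ_i` with scalars `κ_i`, then `α_i` acts on `B(w) = exp β(w)` by
`[α_i, B(w)] = κ_i w^i B(w)`. -/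
lemma IsExp.commutator {β B : R⟦X⟧} (hB : IsExp β B) {a : R} {i : ℕ} (hi : i ≠ 0) {κ : ℂ}
    (h : ∀ j, a * PowerSeries.coeff j β - PowerSeries.coeff j β * a
      = if j = i then algebraMap ℂ R κ else 0) :
    PowerSeries.C a * B - B * PowerSeries.C a = κ • ((PowerSeries.X : R⟦X⟧) ^ i * B) := by
  have hX : euler ((PowerSeries.X : R⟦X⟧) ^ i) = i • (PowerSeries.X : R⟦X⟧) ^ i := by
    ext n
    simp only [coeff_euler, PowerSeries.coeff_X_pow, map_nsmul]
    split_ifs with hn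
    · rw [hn]
    · rw [smul_zero, smul_zero]
  have hcomm : Commute ((PowerSeries.X : R⟦X⟧) ^ i) (euler β) :=
    (PowerSeries.commute_X_pow _ _).symm
  have hβ : PowerSeries.C a * euler β - euler β * PowerSeries.C a
      = κ • (i • (PowerSeries.X : R⟦X⟧) ^ i) := by
    ext n
    have := h n
    simp only [map_sub, PowerSeries.coeff_C_mul, PowerSeries.coeff_mul_C, coeff_euler,
      PowerSeries.coeff_smul, PowerSeries.coeff_X_pow, map_nsmul]
    rw [mul_smul_comm, smul_mul_assoc, ← smul_sub, this]
    split_ifs with h1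
    · subst h1
      rw [smul_comm, ← Algebra.algebraMap_eq_smul_one]
    · simp
  rw [← sub_eq_zero]
  refine eq_of_euler_eq (F := euler β) (by simp) ?_ ?_ ?_
  · have e1 : euler (κ • ((PowerSeries.X : R⟦X⟧) ^ i * B))
        = κ • euler ((PowerSeries.X : R⟦X⟧) ^ i * B) := by
      ext n
      rw [coeff_euler, PowerSeries.coeff_smul, PowerSeries.coeff_smul, coeff_euler, smul_comm]
    have e2 : PowerSeries.C a * euler β = euler β * PowerSeries.C a
        + κ • (i • (PowerSeries.X : R⟦X⟧) ^ i) := by rw [← hβ]; abel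
    rw [euler_sub, euler_sub, e1, euler_mul, euler_mul, euler_mul, euler_C, hX, hB.euler_eq,
      ← mul_assoc (PowerSeries.X ^ i), hcomm.eq, ← mul_assoc, e2]
    simp only [mul_sub, add_mul, smul_add, smul_mul_assoc, mul_smul_comm, zero_mul, mul_zero,
      mul_assoc]
    abel
  · rw [mul_zero]
    simpa using euler_C (0 : R)
  · rw [map_sub, map_sub, PowerSeries.coeff_C_mul, PowerSeries.coeff_mul_C, hB.coeff_zero]
    simp [hi]

/-- The two-variable series `g(zw)`: outer variable `z`, inner variable `w`. -/
def productSeries (R : Type*) [Ring R] [Algebra ℂ R] (g : ℂ⟦X⟧) : R⟦X⟧⟦X⟧ :=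
  PowerSeries.mk fun l => PowerSeries.coeff l g • (PowerSeries.X : R⟦X⟧) ^ l

lemma productSeries_mul (g h : ℂ⟦X⟧) :
    productSeries R (g * h) = productSeries R g * productSeries R h := by
  ext1 n
  simp only [productSeries, PowerSeries.coeff_mk, PowerSeries.coeff_mul, Finset.sum_smul]
  refine Finset.sum_congr rfl fun p hp => ?_
  rw [← mem_antidiagonal.mp hp, smul_mul_smul_comm, pow_add]

lemma euler_productSeries (g : ℂ⟦X⟧) :
    euler (productSeries R g) = productSeries R (euler g) := by
  ext1 n
  rw [coeff_euler, productSeries, productSeries, PowerSeries.coeff_mk, PowerSeries.coeff_mk,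
    coeff_euler, smul_assoc]

lemma productSeries_commute (g : ℂ⟦X⟧) (F : R⟦X⟧⟦X⟧) : Commute (productSeries R g) F := by
  refine commute_of_coeff fun i j => ?_
  rw [productSeries, PowerSeries.coeff_mk]
  exact Commute.smul_left (PowerSeries.commute_X_pow _ _).symm _

/-- The exchange relation `exp(α(z)) exp(β(w)) = exp(κ(zw)) exp(β(w)) exp(α(z))`, where
`[α_i, β_j] = δ_{ij} κ_i`. -/
lemma IsExp.exchange {α A β B : R⟦X⟧} {κ g : ℂ⟦X⟧} (hA : IsExp α A) (hB : IsExp β B)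
    (hg : IsExp κ g)
    (h : ∀ i j, PowerSeries.coeff i α * PowerSeries.coeff j β
      - PowerSeries.coeff j β * PowerSeries.coeff i α
        = if i = j then algebraMap ℂ R (PowerSeries.coeff i κ) else 0) :
    PowerSeries.map PowerSeries.C A * PowerSeries.C B
      = productSeries R g * (PowerSeries.C B * PowerSeries.map PowerSeries.C A) := by
  have hmap : ∀ F : R⟦X⟧, euler (PowerSeries.map (PowerSeries.C (R := R)) F)
      = PowerSeries.map PowerSeries.C (euler F) := fun F => by
    ext1 n; simp
  have hcomm : PowerSeries.map PowerSeries.C (euler α) * PowerSeries.C B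
      = PowerSeries.C B * PowerSeries.map PowerSeries.C (euler α)
        + productSeries R (euler κ) * PowerSeries.C B := by
    rw [← sub_eq_iff_eq_add']
    ext1 i
    simp only [map_sub, PowerSeries.coeff_mul_C, PowerSeries.coeff_C_mul, PowerSeries.coeff_map,
      productSeries, PowerSeries.coeff_mk, coeff_euler]
    rcases Nat.eq_zero_or_pos i with rfl | hi
    · simp
    · have := hB.commutator (a := PowerSeries.coeff i α) hi.ne' (κ := PowerSeries.coeff i κ)
        fun j => by rw [h i j]; simp only [eq_comm]
      rw [map_nsmul, smul_mul_assoc, mul_smul_comm, ← smul_sub, this, smul_mul_assoc, smul_assoc]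
  refine eq_of_euler_eq (F := PowerSeries.map PowerSeries.C (euler α)) (by simp) ?_ ?_ ?_
  · rw [euler_mul, euler_C, hmap, hA.euler_eq, map_mul, mul_zero, add_zero, mul_assoc]
  · rw [euler_mul, euler_mul, euler_C, hmap, hA.euler_eq, map_mul, euler_productSeries,
      hg.euler_eq, productSeries_mul, zero_mul, zero_add, ← mul_assoc (PowerSeries.C B),
      eq_sub_of_add_eq hcomm.symm, ← mul_assoc (PowerSeries.map _ _) (productSeries R g),
      ← (productSeries_commute g (PowerSeries.map PowerSeries.C (euler α))).eq,
      (productSeries_commute (euler κ) (productSeries R g)).eq]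
    noncomm_ring
  · simp [productSeries, PowerSeries.coeff_mul, hA.coeff_zero, hg.coeff_zero]

/-- The coefficients of a power series indexed by all integers, zero in negative degrees. -/
def zcoeff {R : Type*} [Ring R] (F : R⟦X⟧) (n : ℤ) : R :=
  if 0 ≤ n then PowerSeries.coeff n.toNat F else 0

omit [Algebra ℂ R] in
lemma zcoeff_natCast (F : R⟦X⟧) (n : ℕ) : zcoeff F n = PowerSeries.coeff n F := by
  simp [zcoeff]

omit [Algebra ℂ R] in
lemma zcoeff_of_neg (F : R⟦X⟧) {n : ℤ} (hn : n < 0) : zcoeff F n = 0 := by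
  simp [zcoeff, hn.not_ge]

omit [Algebra ℂ R] in
lemma zcoeff_one (n : ℤ) : zcoeff (1 : R⟦X⟧) n = if n = 0 then 1 else 0 := by
  rcases lt_or_ge n 0 with h | h
  · rw [zcoeff_of_neg _ h, if_neg h.ne]
  · lift n to ℕ using h
    simp [zcoeff_natCast, PowerSeries.coeff_one]

omit [Algebra ℂ R] in
/-- A product is a convolution over any finite set of integers containing `[0, n]`. -/
lemma zcoeff_mul (F G : R⟦X⟧) (n : ℤ) (s : Finset ℤ) (hs : ∀ y, 0 ≤ y → y ≤ n → y ∈ s) :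
    zcoeff (F * G) n = ∑ y ∈ s, zcoeff F (n - y) * zcoeff G y := by
  rcases lt_or_ge n 0 with h | h
  · rw [zcoeff_of_neg _ h, Finset.sum_eq_zero]
    intro y _
    rcases lt_or_ge y 0 with h' | h'
    · rw [zcoeff_of_neg G h', mul_zero]
    · rw [zcoeff_of_neg F (by omega), zero_mul]
  · lift n to ℕ using h
    rw [zcoeff_natCast, PowerSeries.coeff_mul]
    refine Finset.sum_of_injOn (fun p => (p.2 : ℤ)) ?_ ?_ ?_ ?_
    · intro p hp p' hp' hpp
      have h1 := mem_antidiagonal.mp hp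
      have h2 := mem_antidiagonal.mp hp'
      have h3 : p.2 = p'.2 := by simpa using hpp
      ext <;> omega
    · intro p hp
      have h1 := mem_antidiagonal.mp hp
      exact hs _ (by positivity) (by dsimp only; omega)
    · intro y _ hy
      rcases lt_or_ge y 0 with h' | h'
      · rw [zcoeff_of_neg G h', mul_zero]
      · rcases lt_or_ge (n : ℤ) y with h'' | h''
        · rw [zcoeff_of_neg F (by omega), zero_mul]
        · exact (hy ⟨(n - y.toNat, y.toNat), by simp; omega, by simp [h']⟩).elim
    · intro p hp
      have h1 := mem_antidiagonal.mp hp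
      rw [zcoeff_natCast, ← zcoeff_natCast F]
      congr 2
      omega

lemma IsExp.coeff_mul_zcoeff {α A β B : R⟦X⟧} {κ g : ℂ⟦X⟧} (hA : IsExp α A) (hB : IsExp β B)
    (hg : IsExp κ g)
    (h : ∀ i j, PowerSeries.coeff i α * PowerSeries.coeff j β
      - PowerSeries.coeff j β * PowerSeries.coeff i α
        = if i = j then algebraMap ℂ R (PowerSeries.coeff i κ) else 0) (i : ℕ) (n : ℤ) :
    PowerSeries.coeff i A * zcoeff B n
      = ∑ p ∈ antidiagonal i, PowerSeries.coeff p.1 g • (zcoeff B (n - p.1) *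
          PowerSeries.coeff p.2 A) := by
  rcases lt_or_ge n 0 with hn | hn
  · rw [zcoeff_of_neg _ hn, mul_zero, Finset.sum_eq_zero]
    intro p _
    rw [zcoeff_of_neg _ (by omega), zero_mul, smul_zero]
  · lift n to ℕ using hn
    have := congrArg (fun F => PowerSeries.coeff n (PowerSeries.coeff i F))
      (hA.exchange hB hg h)
    simp only [PowerSeries.coeff_mul_C, PowerSeries.coeff_map, PowerSeries.coeff_C_mul] at this
    rw [zcoeff_natCast, this, PowerSeries.coeff_mul, map_sum]
    refine Finset.sum_congr rfl fun p _ => ?_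
    simp only [productSeries, PowerSeries.coeff_mk, PowerSeries.coeff_C_mul, PowerSeries.coeff_map,
      smul_mul_assoc, PowerSeries.coeff_smul, PowerSeries.coeff_X_pow_mul',
      PowerSeries.coeff_mul_C]
    split_ifs with hp
    · rw [← zcoeff_natCast B, Nat.cast_sub hp]
    · rw [zcoeff_of_neg _ (by omega), zero_mul]

/-- A creation-type mode moved through an exponential of annihilation-type modes. -/
lemma IsExp.coeff_mul_of_commutator {α A : R⟦X⟧} (hA : IsExp α A) {b : R} {i : ℕ} (hi : i ≠ 0)
    {κ : ℂ} (h : ∀ j, PowerSeries.coeff j α * b - b * PowerSeries.coeff j α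
      = if j = i then algebraMap ℂ R κ else 0) (n : ℕ) :
    PowerSeries.coeff n A * b
      = b * PowerSeries.coeff n A + κ • zcoeff A (n - i) := by
  have := congrArg (PowerSeries.coeff n) (hA.commutator (a := b) hi (κ := -κ) fun j => by
    rw [← neg_sub, h j]; split_ifs <;> simp)
  simp only [map_sub, PowerSeries.coeff_mul_C, PowerSeries.coeff_C_mul, PowerSeries.coeff_smul,
    PowerSeries.coeff_X_pow_mul'] at this
  have e : zcoeff A (n - i) = if i ≤ n then PowerSeries.coeff (n - i) A else 0 := by
    split_ifs with h
    · rw [← zcoeff_natCast, Nat.cast_sub h]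
    · exact zcoeff_of_neg _ (by omega)
  rw [e, ← sub_eq_iff_eq_add', ← neg_sub, this, neg_smul, neg_neg]

end ExpCalculus

/-! ### Normally ordered products on a module -/

section NormalOrder

variable {M : Type*} [AddCommGroup M] [Module ℂ M]

/-- Every vector is killed by almost all coefficients of `A`. -/
def LocNil (A : (Module.End ℂ M)⟦X⟧) : Prop :=
  ∀ v : M, ∃ K : ℕ, ∀ k ≥ K, PowerSeries.coeff k A v = 0

lemma LocNil.eventually {A : (Module.End ℂ M)⟦X⟧} (hA : LocNil A) (v : M) :
    ∀ᶠ K : ℕ in Filter.atTop, ∀ k ≥ K, PowerSeries.coeff k A v = 0 := by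
  obtain ⟨K, hK⟩ := hA v
  filter_upwards [Filter.eventually_ge_atTop K] with L hL k hk using hK k (hL.trans hk)

lemma locNil_one : LocNil (1 : (Module.End ℂ M)⟦X⟧) := fun v =>
  ⟨1, fun k hk => by rw [PowerSeries.coeff_one, if_neg (by omega), LinearMap.zero_apply]⟩

omit [Module ℂ M] in
lemma finsum_eq_sum_range {f : ℕ → M} {K : ℕ} (h : ∀ k ≥ K, f k = 0) :
    ∑ᶠ k, f k = ∑ k ∈ Finset.range K, f k := by
  refine finsum_eq_sum_of_support_subset _ fun k hk => ?_
  by_contra hk'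
  exact hk (h k (by simpa using hk'))

omit [Module ℂ M] in
/-- Summation over the antidiagonals of a rectangle that carries all nonzero terms. -/
lemma sum_range_antidiagonal {f : ℕ × ℕ → M} {a b n : ℕ} (hn : a + b ≤ n)
    (h1 : ∀ p : ℕ × ℕ, a ≤ p.1 → f p = 0) (h2 : ∀ p : ℕ × ℕ, b ≤ p.2 → f p = 0) :
    ∑ k ∈ Finset.range n, ∑ p ∈ antidiagonal k, f p
      = ∑ l ∈ Finset.range a, ∑ k ∈ Finset.range b, f (l, k) := by
  rw [← Finset.sum_product', ← Finset.sum_fiberwise_of_maps_to (t := Finset.range n)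
    (g := fun p : ℕ × ℕ => p.1 + p.2)]
  · refine Finset.sum_congr rfl fun k _ => (Finset.sum_subset ?_ ?_).symm
    · intro p hp
      exact mem_antidiagonal.mpr (Finset.mem_filter.mp hp).2
    · intro p hp hp'
      have hp := mem_antidiagonal.mp hp
      by_contra h0
      refine hp' (Finset.mem_filter.mpr ⟨Finset.mem_product.mpr ⟨?_, ?_⟩, hp⟩)
      · exact Finset.mem_range.mpr (lt_of_not_ge fun h => h0 (h1 p h))
      · exact Finset.mem_range.mpr (lt_of_not_ge fun h => h0 (h2 p h))
  · intro p hp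
    simp only [Finset.mem_product, Finset.mem_range] at hp ⊢
    omega

/-- The coefficient of `z^n` in `B(z) A(z⁻¹)`. -/
def normalMode (B A : (Module.End ℂ M)⟦X⟧) (hA : LocNil A) (n : ℤ) : Module.End ℂ M where
  toFun v := ∑ᶠ k : ℕ, zcoeff B (n + k) (PowerSeries.coeff k A v)
  map_add' v w := by
    obtain ⟨K, h1, h2⟩ := ((hA.eventually v).and (hA.eventually w)).exists
    rw [finsum_eq_sum_range (K := K), finsum_eq_sum_range (K := K), finsum_eq_sum_range (K := K),
      ← Finset.sum_add_distrib]
    · simp only [map_add]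
    all_goals intro k hk; simp [h1 k hk, h2 k hk]
  map_smul' c v := by
    simp only [map_smul, RingHom.id_apply]
    exact (smul_finsum c _).symm

lemma normalMode_apply {B A : (Module.End ℂ M)⟦X⟧} (hA : LocNil A) (n : ℤ) {v : M} {K : ℕ}
    (h : ∀ k ≥ K, PowerSeries.coeff k A v = 0) :
    normalMode B A hA n v
      = ∑ k ∈ Finset.range K, zcoeff B (n + k) (PowerSeries.coeff k A v) :=
  finsum_eq_sum_range fun k hk => by rw [h k hk, map_zero]

lemma zcoeff_commute {t : Module.End ℂ M} {B : (Module.End ℂ M)⟦X⟧}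
    (h : ∀ i, Commute t (PowerSeries.coeff i B)) (n : ℤ) : Commute t (zcoeff B n) := by
  unfold zcoeff
  split_ifs
  exacts [h _, Commute.zero_right t]

lemma normalMode_commute {B A : (Module.End ℂ M)⟦X⟧} (hA : LocNil A) {t : Module.End ℂ M}
    (hB : ∀ i, Commute t (PowerSeries.coeff i B)) (hA' : ∀ i, Commute t (PowerSeries.coeff i A))
    (n : ℤ) : Commute t (normalMode B A hA n) := by
  refine LinearMap.ext fun v => ?_
  obtain ⟨K, h1⟩ := hA v
  have h2 : ∀ k ≥ K, PowerSeries.coeff k A (t v) = 0 := fun k hk => by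
    rw [← Module.End.mul_apply, ← (hA' k).eq, Module.End.mul_apply, h1 k hk, map_zero]
  rw [Module.End.mul_apply, Module.End.mul_apply, normalMode_apply hA n h1,
    normalMode_apply hA n h2, map_sum]
  refine Finset.sum_congr rfl fun k _ => ?_
  simp only [← Module.End.mul_apply]
  rw [← mul_assoc, (zcoeff_commute hB _).eq, mul_assoc, (hA' k).eq]

lemma normalMode_one_right (B : (Module.End ℂ M)⟦X⟧) (n : ℤ) :
    normalMode B 1 locNil_one n = zcoeff B n := by
  refine LinearMap.ext fun v => ?_
  rw [normalMode_apply (K := 1)]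
  · simp
  · intro k hk
    rw [PowerSeries.coeff_one, if_neg (by omega), LinearMap.zero_apply]

lemma normalMode_one_left (A : (Module.End ℂ M)⟦X⟧) (hA : LocNil A) (n : ℤ) :
    normalMode 1 A hA n = zcoeff A (-n) := by
  refine LinearMap.ext fun v => ?_
  obtain ⟨K, hK⟩ := hA v
  rw [normalMode_apply hA n hK]
  simp only [zcoeff_one]
  rcases lt_or_ge (-n) 0 with h | h
  · rw [zcoeff_of_neg _ h, Finset.sum_eq_zero, LinearMap.zero_apply]
    intro k _
    rw [if_neg (by omega), LinearMap.zero_apply]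
  · obtain ⟨m, hm⟩ := Int.eq_ofNat_of_zero_le h
    rw [hm, zcoeff_natCast, Finset.sum_eq_single m]
    · rw [if_pos (by omega), Module.End.one_apply]
    · intro k _ hk
      rw [if_neg (by omega), LinearMap.zero_apply]
    · intro hm'
      rw [hK m (by simpa using hm'), map_zero]

/-- The exchange relation `A_i B_n = ∑_l g_l B_{n-l} A_{i-l}` between the modes of an exponential
of annihilation modes and of an exponential of creation modes. -/
def Exchange (g : ℂ⟦X⟧) (A B : (Module.End ℂ M)⟦X⟧) : Prop :=
  ∀ (i : ℕ) (n : ℤ), PowerSeries.coeff i A * zcoeff B n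
    = ∑ p ∈ antidiagonal i, PowerSeries.coeff p.1 g • (zcoeff B (n - p.1) *
        PowerSeries.coeff p.2 A)

/-- Creation modes move to the left of a normally ordered product. -/
lemma normalMode_zcoeff {g : ℂ⟦X⟧} {B A B' : (Module.End ℂ M)⟦X⟧} (hA : LocNil A)
    (hg : Exchange g A B') (hB : ∀ i j, Commute (PowerSeries.coeff i B) (PowerSeries.coeff j B'))
    (N n : ℤ) (v : M) {L : ℕ} (hL : n < L) :
    normalMode B A hA N (zcoeff B' n v)
      = ∑ l ∈ Finset.range L, PowerSeries.coeff l g •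
          zcoeff B' (n - l) (normalMode B A hA (N + l) v) := by
  obtain ⟨K, hK⟩ := hA v
  have hex : ∀ k, PowerSeries.coeff k A (zcoeff B' n v)
      = ∑ p ∈ antidiagonal k, PowerSeries.coeff p.1 g • zcoeff B' (n - p.1)
          (PowerSeries.coeff p.2 A v) := fun k => by
    rw [← Module.End.mul_apply, hg k n]
    simp [LinearMap.sum_apply]
  rw [normalMode_apply hA N (K := L + K)]
  · have : ∀ k ∈ Finset.range (L + K), zcoeff B (N + k) (PowerSeries.coeff k A (zcoeff B' n v))
        = ∑ p ∈ antidiagonal k, PowerSeries.coeff p.1 g • zcoeff B' (n - p.1)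
          (zcoeff B (N + p.1 + p.2) (PowerSeries.coeff p.2 A v)) := fun k _ => by
      rw [hex, map_sum]
      refine Finset.sum_congr rfl fun p hp => ?_
      have hc : Commute (zcoeff B (N + k)) (zcoeff B' (n - p.1)) :=
        (zcoeff_commute (fun i => (zcoeff_commute (fun j => (hB j i).symm) _).symm) _)
      rw [map_smul, ← Module.End.mul_apply, hc.eq, Module.End.mul_apply,
        ← mem_antidiagonal.mp hp, Nat.cast_add, ← add_assoc]
    rw [Finset.sum_congr rfl this, sum_range_antidiagonal (a := L) (b := K) le_rfl]
    · refine Finset.sum_congr rfl fun l _ => ?_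
      rw [normalMode_apply hA _ hK, map_sum, Finset.smul_sum]
    · intro p hp
      rw [zcoeff_of_neg _ (by omega), LinearMap.zero_apply, smul_zero]
    · intro p hp
      rw [hK _ hp, map_zero, map_zero, smul_zero]
  · intro k hk
    rw [hex]
    refine Finset.sum_eq_zero fun p hp => ?_
    have := mem_antidiagonal.mp hp
    rcases le_or_gt L p.1 with h | h
    · rw [zcoeff_of_neg _ (by omega), LinearMap.zero_apply, smul_zero]
    · rw [hK _ (by omega), map_zero, smul_zero]

/-- Annihilation modes move to the right of a normally ordered product. -/
lemma coeff_mul_normalMode {g : ℂ⟦X⟧} {B A A' : (Module.End ℂ M)⟦X⟧} (hA : LocNil A)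
    (hg : Exchange g A' B) (hA' : ∀ i j, Commute (PowerSeries.coeff i A) (PowerSeries.coeff j A'))
    (N : ℤ) (k : ℕ) :
    PowerSeries.coeff k A' * normalMode B A hA N
      = ∑ p ∈ antidiagonal k, PowerSeries.coeff p.1 g •
          (normalMode B A hA (N - p.1) * PowerSeries.coeff p.2 A') := by
  refine LinearMap.ext fun v => ?_
  obtain ⟨K, hK⟩ := hA v
  have hK' : ∀ j, ∀ m ≥ K, PowerSeries.coeff m A (PowerSeries.coeff j A' v) = 0 := fun j m hm => by
    rw [← Module.End.mul_apply, (hA' m j).eq, Module.End.mul_apply, hK m hm, map_zero]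
  simp only [Module.End.mul_apply, LinearMap.sum_apply, LinearMap.smul_apply]
  rw [normalMode_apply hA N hK, map_sum]
  simp_rw [fun j n => normalMode_apply (B := B) hA n (hK' j), Finset.smul_sum]
  rw [Finset.sum_comm]
  refine Finset.sum_congr rfl fun m _ => ?_
  rw [← Module.End.mul_apply, hg k]
  simp only [LinearMap.sum_apply, LinearMap.smul_apply, Module.End.mul_apply]
  refine Finset.sum_congr rfl fun p _ => ?_
  rw [← Module.End.mul_apply (PowerSeries.coeff p.2 A'), ← (hA' m p.2).eq, Module.End.mul_apply,
    show N - (p.1 : ℤ) + m = N + m - p.1 by ring]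

/-- The coefficient of `z^i w^j` in `B₁(z) B₂(w) A₁(z⁻¹) A₂(w⁻¹) v`. -/
def normalPair (B₁ A₁ : (Module.End ℂ M)⟦X⟧) (h₁ : LocNil A₁) (B₂ A₂ : (Module.End ℂ M)⟦X⟧)
    (i j : ℤ) (v : M) : M :=
  ∑ᶠ k : ℕ, zcoeff B₂ (j + k) (normalMode B₁ A₁ h₁ i (PowerSeries.coeff k A₂ v))

section Pair

variable {B₁ A₁ B₂ A₂ : (Module.End ℂ M)⟦X⟧} (h₁ : LocNil A₁)

lemma normalPair_apply (i j : ℤ) {v : M} {K : ℕ}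
    (h : ∀ k ≥ K, PowerSeries.coeff k A₂ v = 0) :
    normalPair B₁ A₁ h₁ B₂ A₂ i j v = ∑ k ∈ Finset.range K,
      zcoeff B₂ (j + k) (normalMode B₁ A₁ h₁ i (PowerSeries.coeff k A₂ v)) :=
  finsum_eq_sum_range fun k hk => by rw [h k hk, map_zero, map_zero]

/-- Wick's theorem for `V₁(z) V₂(w)`. -/
lemma normalMode_normalMode (h₂ : LocNil A₂) {g : ℂ⟦X⟧} (hg : Exchange g A₁ B₂)
    (hB : ∀ i j, Commute (PowerSeries.coeff i B₁) (PowerSeries.coeff j B₂)) (N n : ℤ) (v : M) :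
    ∀ᶠ L : ℕ in Filter.atTop, normalMode B₁ A₁ h₁ N (normalMode B₂ A₂ h₂ n v)
      = ∑ l ∈ Finset.range L, PowerSeries.coeff l g •
          normalPair B₁ A₁ h₁ B₂ A₂ (N + l) (n - l) v := by
  obtain ⟨K, hK⟩ := h₂ v
  filter_upwards [Filter.eventually_gt_atTop (n.toNat + K)] with L hL
  rw [normalMode_apply h₂ n hK, map_sum]
  simp_rw [fun i j => normalPair_apply (B₁ := B₁) (B₂ := B₂) h₁ i j hK, Finset.smul_sum]
  rw [Finset.sum_comm]
  refine Finset.sum_congr rfl fun k hk => ?_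
  have hk := Finset.mem_range.mp hk
  rw [normalMode_zcoeff h₁ hg hB N (n + k) _ (L := L) (by omega)]
  refine Finset.sum_congr rfl fun l _ => ?_
  rw [show n + (k : ℤ) - l = n - l + k by ring]

lemma normalMode_eventually_eq_zero (v : M) :
    ∀ᶠ L : ℕ in Filter.atTop, ∀ i : ℤ, i + L ≤ 0 → normalMode B₁ A₁ h₁ i v = 0 := by
  obtain ⟨K, hK⟩ := h₁ v
  filter_upwards [Filter.eventually_ge_atTop K] with L hL i hi
  rw [normalMode_apply h₁ i hK]
  refine Finset.sum_eq_zero fun k hk => ?_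
  have hk := Finset.mem_range.mp hk
  rw [zcoeff_of_neg _ (by omega), LinearMap.zero_apply]

lemma normalMode_coeff_eventually_eq_zero (h₂ : LocNil A₂) (v : M) :
    ∀ᶠ L : ℕ in Filter.atTop, ∀ i : ℤ, i + L ≤ 0 → ∀ k : ℕ,
      normalMode B₁ A₁ h₁ i (PowerSeries.coeff k A₂ v) = 0 := by
  obtain ⟨K, hK⟩ := h₂ v
  have := (Filter.eventually_all_finset (Finset.range K)).mpr fun k _ =>
    normalMode_eventually_eq_zero (B₁ := B₁) h₁ (PowerSeries.coeff k A₂ v)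
  filter_upwards [this] with L hL i hi k
  rcases lt_or_ge k K with hk | hk
  · exact hL k (Finset.mem_range.mpr hk) i hi
  · rw [hK k hk, map_zero]

lemma normalPair_eventually_eq_zero (h₂ : LocNil A₂) (v : M) :
    ∀ᶠ L : ℕ in Filter.atTop, ∀ i j : ℤ, i + L ≤ 0 ∨ j + L ≤ 0 →
      normalPair B₁ A₁ h₁ B₂ A₂ i j v = 0 := by
  obtain ⟨K, hK⟩ := h₂ v
  filter_upwards [Filter.eventually_ge_atTop K,
    normalMode_coeff_eventually_eq_zero (B₁ := B₁) h₁ h₂ v] with L hL hL' i j hij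
  rw [normalPair_apply h₁ i j hK]
  refine Finset.sum_eq_zero fun k hk => ?_
  have hk := Finset.mem_range.mp hk
  rcases hij with hi | hj
  · rw [hL' i hi, map_zero]
  · rw [zcoeff_of_neg _ (by omega), LinearMap.zero_apply]

/-- Wick's theorem for `V₂(w) V₁(z)`. -/
lemma normalMode_normalMode_swap (h₂ : LocNil A₂) {g : ℂ⟦X⟧} (hg : Exchange g A₂ B₁)
    (hA : ∀ i j, Commute (PowerSeries.coeff i A₁) (PowerSeries.coeff j A₂)) (N n : ℤ) (v : M) :
    ∀ᶠ L : ℕ in Filter.atTop, normalMode B₂ A₂ h₂ n (normalMode B₁ A₁ h₁ N v)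
      = ∑ l ∈ Finset.range L, PowerSeries.coeff l g •
          normalPair B₁ A₁ h₁ B₂ A₂ (N - l) (n + l) v := by
  obtain ⟨K, hK⟩ := h₂ v
  obtain ⟨K', hK'⟩ := h₂ (normalMode B₁ A₁ h₁ N v)
  filter_upwards [(Filter.tendsto_sub_atTop_nat N.toNat).eventually
    (normalMode_coeff_eventually_eq_zero (B₁ := B₁) h₁ h₂ v),
    Filter.eventually_ge_atTop K', Filter.eventually_ge_atTop N.toNat] with L hL hL' hL''
  rw [normalMode_apply h₂ n (K := L + K) fun k hk => hK' k (by omega)]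
  have : ∀ k ∈ Finset.range (L + K),
      zcoeff B₂ (n + k) (PowerSeries.coeff k A₂ (normalMode B₁ A₁ h₁ N v))
        = ∑ p ∈ antidiagonal k, PowerSeries.coeff p.1 g • zcoeff B₂ (n + p.1 + p.2)
          (normalMode B₁ A₁ h₁ (N - p.1) (PowerSeries.coeff p.2 A₂ v)) := fun k _ => by
    rw [← Module.End.mul_apply (PowerSeries.coeff k A₂), coeff_mul_normalMode h₁ hg hA]
    simp only [LinearMap.sum_apply, LinearMap.smul_apply, Module.End.mul_apply, map_sum, map_smul]
    refine Finset.sum_congr rfl fun p hp => ?_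
    rw [← mem_antidiagonal.mp hp, Nat.cast_add, ← add_assoc]
  rw [Finset.sum_congr rfl this, sum_range_antidiagonal (a := L) (b := K) le_rfl]
  · refine Finset.sum_congr rfl fun l _ => ?_
    rw [normalPair_apply h₁ _ _ hK, Finset.smul_sum]
  · intro p hp
    rw [hL _ (by omega), map_zero, smul_zero]
  · intro p hp
    rw [hK _ hp, map_zero, map_zero, smul_zero]

omit h₁ in
lemma LocNil.mul (h₁ : LocNil A₁) (h₂ : LocNil A₂) : LocNil (A₁ * A₂) := by
  intro v
  obtain ⟨K, hK⟩ := h₂ v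
  obtain ⟨L, hL⟩ := ((Filter.eventually_all_finset (Finset.range K)).mpr fun k _ =>
    h₁.eventually (PowerSeries.coeff k A₂ v)).exists
  refine ⟨L + K, fun m hm => ?_⟩
  rw [PowerSeries.coeff_mul, LinearMap.sum_apply]
  refine Finset.sum_eq_zero fun p hp => ?_
  have := mem_antidiagonal.mp hp
  rw [Module.End.mul_apply]
  rcases lt_or_ge p.2 K with h | h
  · exact hL _ (Finset.mem_range.mpr h) _ (by omega)
  · rw [hK _ h, map_zero]

lemma zcoeff_of_coeff_eq_smul {x : ℂ} {B B' : (Module.End ℂ M)⟦X⟧}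
    (h : ∀ n, PowerSeries.coeff n B' = x ^ n • PowerSeries.coeff n B) (n : ℤ) :
    zcoeff B' n = x ^ n • zcoeff B n := by
  rcases lt_or_ge n 0 with hn | hn
  · rw [zcoeff_of_neg _ hn, zcoeff_of_neg _ hn, smul_zero]
  · lift n to ℕ using hn
    rw [zcoeff_natCast, zcoeff_natCast, h, zpow_natCast]

/-- Restriction of `B₁(z) B₂(w) A₁(z⁻¹) A₂(w⁻¹)` to `w = xz`; here `B₂'(z) = B₂(xz)` and
`A₂'(z⁻¹) = A₂((xz)⁻¹)`. -/
lemma finsum_normalPair (h₂ : LocNil A₂) {x : ℂ} (hx : x ≠ 0) {B₂' A₂' : (Module.End ℂ M)⟦X⟧}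
    (hB₂ : ∀ n, PowerSeries.coeff n B₂' = x ^ n • PowerSeries.coeff n B₂)
    (hA₂ : ∀ n, PowerSeries.coeff n A₂' = (x ^ n)⁻¹ • PowerSeries.coeff n A₂)
    (hB : ∀ i j, Commute (PowerSeries.coeff i B₁) (PowerSeries.coeff j B₂))
    (h₁₂ : LocNil (A₁ * A₂')) (T : ℤ) (v : M) :
    ∑ᶠ j : ℤ, x ^ j • normalPair B₁ A₁ h₁ B₂ A₂ (T - j) j v
      = normalMode (B₁ * B₂') (A₁ * A₂') h₁₂ T v := by
  obtain ⟨K₂, hK₀⟩ := h₂ v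
  obtain ⟨K, hK₁, hK, hKK⟩ := (((Filter.eventually_all_finset (Finset.range K₂)).mpr fun k _ =>
      h₁.eventually (PowerSeries.coeff k A₂ v)).and
      ((normalPair_eventually_eq_zero (B₁ := B₁) (B₂ := B₂) h₁ h₂ v).and
      (Filter.eventually_ge_atTop K₂))).exists
  have hK₂ : ∀ k ≥ K, PowerSeries.coeff k A₂ v = 0 := fun k hk => hK₀ k (hKK.trans hk)
  replace hK₁ : ∀ l, ∀ k ≥ K, PowerSeries.coeff k A₁ (PowerSeries.coeff l A₂ v) = 0 := by
    intro l k hk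
    rcases lt_or_ge l K₂ with hl | hl
    · exact hK₁ l (Finset.mem_range.mpr hl) k hk
    · rw [hK₀ l hl, map_zero]
  let J : Finset ℤ := Finset.Icc (-(K : ℤ)) (|T| + K)
  have hT := le_abs_self T
  have h12 : ∀ m, PowerSeries.coeff m (A₁ * A₂') v = ∑ p ∈ antidiagonal m,
      (x ^ p.2)⁻¹ • PowerSeries.coeff p.1 A₁ (PowerSeries.coeff p.2 A₂ v) := fun m => by
    rw [PowerSeries.coeff_mul, LinearMap.sum_apply]
    refine Finset.sum_congr rfl fun p _ => ?_
    rw [hA₂, Module.End.mul_apply, LinearMap.smul_apply, map_smul]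
  rw [normalMode_apply h₁₂ T (K := K + K)]
  · have hm : ∀ m ∈ Finset.range (K + K),
        zcoeff (B₁ * B₂') (T + m) (PowerSeries.coeff m (A₁ * A₂') v)
          = ∑ p ∈ antidiagonal m, (x ^ p.2)⁻¹ • zcoeff (B₁ * B₂') (T + p.1 + p.2)
            (PowerSeries.coeff p.1 A₁ (PowerSeries.coeff p.2 A₂ v)) := fun m _ => by
      rw [h12, map_sum]
      refine Finset.sum_congr rfl fun p hp => ?_
      rw [map_smul, ← mem_antidiagonal.mp hp, Nat.cast_add, ← add_assoc]
    rw [Finset.sum_congr rfl hm, sum_range_antidiagonal (a := K) (b := K) le_rfl,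
      finsum_eq_sum_of_support_subset (s := J)]
    · simp_rw [fun i j => normalPair_apply (B₁ := B₁) (B₂ := B₂) h₁ i j hK₂,
        fun i l => normalMode_apply (B := B₁) h₁ i (hK₁ l), map_sum, Finset.smul_sum]
      rw [Finset.sum_comm, Finset.sum_comm (s := Finset.range K) (t := Finset.range K)]
      refine Finset.sum_congr rfl fun l hl => ?_
      rw [Finset.sum_comm]
      refine Finset.sum_congr rfl fun k hk => ?_
      have hl := Finset.mem_range.mp hl
      have hk := Finset.mem_range.mp hk
      rw [zcoeff_mul B₁ B₂' (T + k + l) (J.map (addRightEmbedding (l : ℤ))) fun y h0 h1 =>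
        Finset.mem_map.mpr ⟨y - l, Finset.mem_Icc.mpr ⟨by omega, by omega⟩, by simp⟩,
        Finset.sum_map, LinearMap.sum_apply, Finset.smul_sum]
      refine Finset.sum_congr rfl fun j _ => ?_
      have hc : Commute (zcoeff B₁ (T - j + k)) (zcoeff B₂ (j + l)) :=
        (zcoeff_commute (fun i => (zcoeff_commute (fun j => (hB j i).symm) _).symm) _)
      rw [addRightEmbedding_apply, zcoeff_of_coeff_eq_smul hB₂, mul_smul_comm,
        LinearMap.smul_apply, smul_smul, show T + k + l - (j + l : ℤ) = T - j + k by ring, hc.eq,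
        Module.End.mul_apply, zpow_add₀ hx, zpow_natCast, mul_comm (x ^ j),
        inv_mul_cancel_left₀ (pow_ne_zero _ hx)]
    · intro j hj
      by_contra hj'
      refine hj ?_
      dsimp only
      rw [hK, smul_zero]
      simp only [J, Finset.coe_Icc, Set.mem_Icc, not_and_or, not_le] at hj'
      omega
    · intro p hp
      rw [hK₁ _ _ hp, map_zero, smul_zero]
    · intro p hp
      rw [hK₂ _ hp, map_zero, map_zero, smul_zero]
  · intro m hm
    rw [h12]
    refine Finset.sum_eq_zero fun p hp => ?_
    have := mem_antidiagonal.mp hp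
    rcases le_or_gt K p.1 with h | h
    · rw [hK₁ _ _ h, smul_zero]
    · rw [hK₂ p.2 (by omega), map_zero, smul_zero]

end Pair

end NormalOrder

/-! ### Exponentials of oscillators -/

section ModeExp

variable {R : Type*} [Ring R] [Algebra ℂ R]

/-- The exponential `∑_k f^k / k!` over an arbitrary `ℂ`-algebra; for the operators on the Fock
space it is `expSeries`. -/
def seriesExp (f : R⟦X⟧) : R⟦X⟧ :=
  PowerSeries.mk fun n =>
    ∑ k ∈ Finset.range (n + 1), ((k.factorial : ℂ)⁻¹) • PowerSeries.coeff n (f ^ k)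

/-- Series with commuting coefficients and without constant term have an exponential. -/
lemma isExp_seriesExp {f : R⟦X⟧} (h0 : PowerSeries.coeff 0 f = 0)
    (hf : ∀ i j, Commute (PowerSeries.coeff i f) (PowerSeries.coeff j f)) :
    IsExp f (seriesExp f) := by
  have hvan : ∀ {k n : ℕ}, n < k → PowerSeries.coeff n (f ^ k) = 0 := by
    intro k
    induction k with
    | zero => intro n hn; omega
    | succ k ih =>
      intro n hn
      rw [pow_succ', PowerSeries.coeff_mul]
      refine Finset.sum_eq_zero fun p hp => ?_
      have := mem_antidiagonal.mp hp
      rcases Nat.eq_zero_or_pos p.1 with h1 | h1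
      · rw [h1, h0, zero_mul]
      · rw [ih (by omega), mul_zero]
  have hcoeff : ∀ {n K : ℕ}, n < K → PowerSeries.coeff n (seriesExp f)
      = ∑ k ∈ Finset.range K, ((k.factorial : ℂ)⁻¹) • PowerSeries.coeff n (f ^ k) := by
    intro n K hK
    rw [seriesExp, PowerSeries.coeff_mk]
    refine Finset.sum_subset (by simpa using hK) fun k _ hk => ?_
    rw [hvan (by simpa using hk), smul_zero]
  have hpow : ∀ k, euler (f ^ (k + 1)) = (k + 1) • (euler f * f ^ k) := by
    intro k
    have hc : Commute f (euler f) := commute_of_coeff fun i j => by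
      rw [coeff_euler]; exact (hf i j).smul_right j
    induction k with
    | zero => simp
    | succ k ih =>
      rw [pow_succ' f (k + 1), euler_mul, ih, mul_smul_comm, ← mul_assoc, hc.eq, mul_assoc,
        ← pow_succ', succ_nsmul' _ (k + 1)]
  refine ⟨?_, ?_⟩
  · simp only [seriesExp, PowerSeries.coeff_mk]
    simp
  · ext1 n
    rw [coeff_euler, hcoeff (K := n + 2) (by omega), PowerSeries.coeff_mul, Finset.smul_sum,
      Finset.sum_range_succ']
    have h1 : ∀ p ∈ antidiagonal n, PowerSeries.coeff p.1 (euler f) *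
        PowerSeries.coeff p.2 (seriesExp f) = ∑ k ∈ Finset.range (n + 1),
          ((k.factorial : ℂ)⁻¹) • (PowerSeries.coeff p.1 (euler f) *
            PowerSeries.coeff p.2 (f ^ k)) := fun p hp => by
      have := mem_antidiagonal.mp hp
      rw [hcoeff (K := n + 1) (by omega), Finset.mul_sum]
      simp only [mul_smul_comm]
    rw [Finset.sum_congr rfl h1, Finset.sum_comm]
    have h2 : n • (((Nat.factorial 0 : ℂ)⁻¹) • PowerSeries.coeff n (f ^ 0)) = 0 := by
      rcases Nat.eq_zero_or_pos n with rfl | hn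
      · simp
      · simp [PowerSeries.coeff_one, hn.ne']
    rw [h2, add_zero]
    refine Finset.sum_congr rfl fun k _ => ?_
    rw [smul_comm, ← coeff_euler, hpow, map_nsmul, PowerSeries.coeff_mul, ← Finset.smul_sum,
      ← Nat.cast_smul_eq_nsmul ℂ, smul_smul, Nat.factorial_succ]
    congr 1
    have : ((k : ℂ) + 1) ≠ 0 := by exact_mod_cast k.succ_ne_zero
    push_cast
    field_simp

variable (o : Boson → ℕ → R) (x y x' y' : ℕ → ℂ)

/-- The series `∑_{n ≥ 1} (x_n o_{a,n} + y_n o_{c,n}) u^n` for two families of modes `o`. -/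
def modeSeries : R⟦X⟧ :=
  PowerSeries.mk fun n => if n = 0 then 0 else x n • o .a n + y n • o .c n

/-- The exponential of `modeSeries`. -/
def modeExp : R⟦X⟧ := seriesExp (modeSeries o x y)

/-- All modes of positive index in the family commute. -/
def ModesCommute : Prop := ∀ b b' n m, n ≠ 0 → m ≠ 0 → Commute (o b n) (o b' m)

variable {o}

lemma coeff_modeSeries_commute {t : R} (h : ∀ b n, n ≠ 0 → Commute t (o b n)) (n : ℕ) :
    Commute t (PowerSeries.coeff n (modeSeries o x y)) := by
  rw [modeSeries, PowerSeries.coeff_mk]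
  split_ifs with hn
  · exact Commute.zero_right _
  · exact ((h _ n hn).smul_right _).add_right ((h _ n hn).smul_right _)

lemma coeff_modeExp_commute {t : R} (h : ∀ b n, n ≠ 0 → Commute t (o b n)) (n : ℕ) :
    Commute t (PowerSeries.coeff n (modeExp o x y)) := by
  rw [modeExp, seriesExp, PowerSeries.coeff_mk]
  exact Commute.sum_right _ _ _ fun k _ =>
    (commute_coeff_pow (coeff_modeSeries_commute x y h) k n).smul_right _

lemma modeExp_commute (ho : ModesCommute o) (i j : ℕ) :
    Commute (PowerSeries.coeff i (modeExp o x y)) (PowerSeries.coeff j (modeExp o x' y')) :=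
  coeff_modeExp_commute x' y' (fun _ _ hm =>
    (coeff_modeExp_commute x y (fun _ _ hn => ho _ _ _ _ hm hn) i).symm) j

lemma isExp_modeExp (ho : ModesCommute o) : IsExp (modeSeries o x y) (modeExp o x y) :=
  isExp_seriesExp (by simp [modeSeries]) fun i j =>
    coeff_modeSeries_commute x y (fun _ _ hm =>
      (coeff_modeSeries_commute x y (fun _ _ hn => ho _ _ _ _ hm hn) i).symm) j

lemma modeExp_mul (ho : ModesCommute o) :
    modeExp o x y * modeExp o x' y' = modeExp o (x + x') (y + y') := by
  refine IsExp.unique (f := modeSeries o (x + x') (y + y')) ?_ (isExp_modeExp _ _ ho)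
  have : modeSeries o (x + x') (y + y') = modeSeries o x y + modeSeries o x' y' := by
    ext1 n
    simp only [modeSeries, PowerSeries.coeff_mk, map_add, Pi.add_apply]
    split_ifs
    · simp
    · rw [add_smul, add_smul]; abel
  rw [this]
  refine (isExp_modeExp x y ho).mul (isExp_modeExp x' y' ho) (commute_of_coeff fun i j => ?_)
  rw [coeff_euler]
  exact (coeff_modeSeries_commute x' y' (fun _ _ hm =>
    (coeff_modeExp_commute x y (fun _ _ hn => ho _ _ _ _ hm hn) i).symm) j).smul_right _

lemma modeExp_zero (ho : ModesCommute o) : modeExp o 0 0 = 1 := by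
  refine (isExp_modeExp 0 0 ho).unique ⟨by simp, ?_⟩
  have : modeSeries o 0 0 = 0 := by ext1 n; simp [modeSeries]
  rw [this, euler_one, mul_one]
  simpa using (euler_C (0 : R)).symm

/-- Rescaling of the formal variable in an exponential of oscillators. -/
lemma coeff_modeExp_rescale (ho : ModesCommute o) (t : ℂ) (n : ℕ) :
    PowerSeries.coeff n (modeExp o (fun n => t ^ n * x n) (fun n => t ^ n * y n))
      = t ^ n • PowerSeries.coeff n (modeExp o x y) := by
  have h := isExp_modeExp x y ho
  suffices h' : IsExp (modeSeries o (fun n => t ^ n * x n) (fun n => t ^ n * y n))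
      (PowerSeries.mk fun n => t ^ n • PowerSeries.coeff n (modeExp o x y)) by
    rw [(isExp_modeExp _ _ ho).unique h', PowerSeries.coeff_mk]
  refine ⟨?_, ?_⟩
  · rw [PowerSeries.coeff_mk, h.coeff_zero, pow_zero, one_smul]
  ext1 n
  rw [coeff_euler, PowerSeries.coeff_mk, smul_comm, ← coeff_euler (modeExp o x y), h.euler_eq,
    PowerSeries.coeff_mul, PowerSeries.coeff_mul, Finset.smul_sum]
  refine Finset.sum_congr rfl fun p hp => ?_
  rw [← mem_antidiagonal.mp hp, pow_add, ← smul_mul_smul_comm, PowerSeries.coeff_mk]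
  congr 1
  simp only [coeff_euler, modeSeries, PowerSeries.coeff_mk]
  split_ifs
  · simp
  · rw [smul_comm, smul_add, smul_smul, smul_smul]

/-- `∑_n κ_n u^n`, where `κ_n` is the commutator of the `n`-th coefficients of two series of
modes whose commutators are given by `N`. -/
def contraction (N : Boson → ℕ → ℂ) (x y x' y' : ℕ → ℂ) : ℂ⟦X⟧ :=
  PowerSeries.mk fun n => if n = 0 then 0 else
    x n * x' n * N .a n + y n * y' n * N .c n

/-- The modes `o` and `o'` are conjugate: `[o_{b,n}, o'_{b',m}] = δ_{bb'} δ_{nm} N_{b,n}`. -/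
def Conjugate (o o' : Boson → ℕ → R) (N : Boson → ℕ → ℂ) : Prop :=
  (∀ b n m, n ≠ 0 → m ≠ 0 → o b n * o' b m - o' b m * o b n
      = if n = m then algebraMap ℂ R (N b n) else 0) ∧
  (∀ n m, n ≠ 0 → m ≠ 0 → Commute (o .a n) (o' .c m) ∧ Commute (o .c n) (o' .a m))

variable {o' : Boson → ℕ → R} {N : Boson → ℕ → ℂ}

lemma modeSeries_commutator (h : Conjugate o o' N) (i j : ℕ) :
    PowerSeries.coeff i (modeSeries o x y) * PowerSeries.coeff j (modeSeries o' x' y')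
      - PowerSeries.coeff j (modeSeries o' x' y') * PowerSeries.coeff i (modeSeries o x y)
      = if i = j then algebraMap ℂ R (PowerSeries.coeff i (contraction N x y x' y')) else 0 := by
  simp only [modeSeries, contraction, PowerSeries.coeff_mk]
  rcases Nat.eq_zero_or_pos i with rfl | hi
  · simp
  rcases Nat.eq_zero_or_pos j with rfl | hj
  · simp [hi.ne']
  have ha := h.1 .a i j hi.ne' hj.ne'
  have hc := h.1 .c i j hi.ne' hj.ne'
  have hac := (h.2 i j hi.ne' hj.ne').1.eq
  have hca := (h.2 i j hi.ne' hj.ne').2.eq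
  have e : ∀ A C A' C' : R, ∀ s t s' t' : ℂ, A * C' = C' * A → C * A' = A' * C →
      (s • A + t • C) * (s' • A' + t' • C') - (s' • A' + t' • C') * (s • A + t • C)
      = (s * s') • (A * A' - A' * A) + (t * t') • (C * C' - C' * C) := by
    intro A C A' C' s t s' t' h1 h2
    simp only [add_mul, mul_add, smul_mul_smul_comm, smul_sub, mul_comm s', mul_comm t', h1, h2]
    abel
  simp only [hi.ne', hj.ne', if_false, e _ _ _ _ _ _ _ _ hac hca, ha, hc]
  by_cases hij : i = j
  · simp [hij, Algebra.algebraMap_eq_smul_one, smul_smul, add_smul]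
  · simp [hij]

lemma exists_modeSeries_commutator (h : Conjugate o o' N) (b : Boson) {m : ℕ} (hm : m ≠ 0) :
    ∃ κ : ℂ, ∀ j, PowerSeries.coeff j (modeSeries o x y) * o' b m
      - o' b m * PowerSeries.coeff j (modeSeries o x y)
      = if j = m then algebraMap ℂ R κ else 0 := by
  obtain ⟨x', y', e⟩ : ∃ x' y', o' b m = PowerSeries.coeff m (modeSeries o' x' y') := by
    cases b
    · exact ⟨1, 0, by simp [modeSeries, hm]⟩
    · exact ⟨0, 1, by simp [modeSeries, hm]⟩
  refine ⟨PowerSeries.coeff m (contraction N x y x' y'), fun j => ?_⟩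
  rw [e, modeSeries_commutator x y _ _ h]
  split_ifs with hj
  · rw [hj]
  · rfl

lemma Conjugate.exchange {M : Type*} [AddCommGroup M] [Module ℂ M]
    {o o' : Boson → ℕ → Module.End ℂ M} (h : Conjugate o o' N) (ho : ModesCommute o)
    (ho' : ModesCommute o') {x y x' y' : ℕ → ℂ} {g : ℂ⟦X⟧}
    (hg : IsExp (contraction N x y x' y') g) : Exchange g (modeExp o x y) (modeExp o' x' y') :=
  (isExp_modeExp x y ho).coeff_mul_zcoeff (isExp_modeExp x' y' ho') hg
    (modeSeries_commutator x y x' y' h)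

lemma coeff_modeExp_eq_zero {M : Type*} [AddCommGroup M] [Module ℂ M]
    {o : Boson → ℕ → Module.End ℂ M} {v : M} (h : ∀ b n, n ≠ 0 → o b n v = 0) {n : ℕ}
    (hn : n ≠ 0) : PowerSeries.coeff n (modeExp o x y) v = 0 := by
  have h0 : ∀ j, PowerSeries.coeff j (modeSeries o x y) v = 0 := by
    intro j
    rw [modeSeries, PowerSeries.coeff_mk]
    split_ifs with hj
    · rfl
    · simp [h _ _ hj]
  have hpow : ∀ k j : ℕ, k ≠ 0 → PowerSeries.coeff j (modeSeries o x y ^ k) v = 0 := by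
    intro k j hk
    obtain ⟨k, rfl⟩ := Nat.exists_eq_succ_of_ne_zero hk
    rw [pow_succ, PowerSeries.coeff_mul, LinearMap.sum_apply]
    exact Finset.sum_eq_zero fun p _ => by rw [Module.End.mul_apply, h0, map_zero]
  rw [modeExp, seriesExp, PowerSeries.coeff_mk, LinearMap.sum_apply]
  refine Finset.sum_eq_zero fun k _ => ?_
  rw [LinearMap.smul_apply]
  rcases eq_or_ne k 0 with rfl | hk
  · simp [PowerSeries.coeff_one, hn]
  · rw [hpow k n hk, smul_zero]

/-- Vectors on which an exponential of annihilation modes is locally finite are preserved by the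
creation modes. -/
lemma exists_coeff_modeExp_eq_zero {M : Type*} [AddCommGroup M] [Module ℂ M]
    {o o' : Boson → ℕ → Module.End ℂ M} (h : Conjugate o o' N) (ho : ModesCommute o) {v : M}
    (hv : ∃ K : ℕ, ∀ k ≥ K, PowerSeries.coeff k (modeExp o x y) v = 0) (b : Boson) {m : ℕ}
    (hm : m ≠ 0) : ∃ K : ℕ, ∀ k ≥ K, PowerSeries.coeff k (modeExp o x y) (o' b m v) = 0 := by
  obtain ⟨K, hK⟩ := hv
  obtain ⟨κ, hκ⟩ := exists_modeSeries_commutator x y h b hm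
  refine ⟨K + m, fun k hk => ?_⟩
  rw [← Module.End.mul_apply, (isExp_modeExp x y ho).coeff_mul_of_commutator hm hκ,
    ← Nat.cast_sub (by omega), zcoeff_natCast, LinearMap.add_apply, LinearMap.smul_apply,
    Module.End.mul_apply, hK _ (by omega), hK _ (by omega), map_zero, smul_zero, add_zero]

end ModeExp

/-! ### Oscillators on the Fock space -/

@[simp] lemma diag_single (f : ℤ × ℤ → ℂ) (μ : ℤ × ℤ) (p : MvPolynomial (Boson × ℕ+) ℂ) :
    diag f (Finsupp.single μ p) = f μ • Finsupp.single μ p := by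
  simp [diag]

@[simp] lemma shift_single (ν μ : ℤ × ℤ) (p : MvPolynomial (Boson × ℕ+) ℂ) :
    shift ν (Finsupp.single μ p) = Finsupp.single (ν + μ) p := by
  simp [shift]

/-- Operators on the Fock space are determined by their values on the charge sectors. -/
lemma op_ext {S T : Op} (h : ∀ μ p, S (Finsupp.single μ p) = T (Finsupp.single μ p)) : S = T :=
  Finsupp.lhom_ext h

lemma diag_mul_diag (f g : ℤ × ℤ → ℂ) : diag f * diag g = diag fun μ => f μ * g μ :=
  op_ext fun μ p => by simp [smul_smul]

lemma diag_one : diag (fun _ => 1) = 1 := op_ext fun μ p => by simp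

lemma diag_commute (f g : ℤ × ℤ → ℂ) : Commute (diag f) (diag g) := by
  rw [Commute, SemiconjBy, diag_mul_diag, diag_mul_diag]
  simp only [mul_comm]

/-- The norm `[b_n, b_{-n}]` of an oscillator, for `n > 0`. -/
def oscNorm (q : ℂ) (b : Boson) (n : ℕ) : ℂ :=
  (match b with
    | .a => (-1 : ℂ) ^ n
    | .c => 1) * qInt q n ^ 2 / n

lemma osc_pos_single (q : ℂ) (b : Boson) {n : ℕ} (hn : n ≠ 0) (μ : ℤ × ℤ)
    (p : MvPolynomial (Boson × ℕ+) ℂ) :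
    osc q b n (Finsupp.single μ p)
      = Finsupp.single μ (oscNorm q b n • MvPolynomial.pderiv (b, n.toPNat') p) := by
  cases b <;> simp [osc, oscNorm, hn, Nat.pos_of_ne_zero hn]

lemma osc_neg_single (q : ℂ) (b : Boson) {n : ℕ} (hn : n ≠ 0) (μ : ℤ × ℤ)
    (p : MvPolynomial (Boson × ℕ+) ℂ) :
    osc q b (-(n : ℤ)) (Finsupp.single μ p)
      = Finsupp.single μ (MvPolynomial.X (b, n.toPNat') * p) := by
  have h1 : ¬ (-(n : ℤ) = 0) := by omega
  have h2 : ¬ (0 < -(n : ℤ)) := by omega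
  unfold osc
  rw [if_neg h1, if_neg h2, Int.natAbs_neg, Int.natAbs_natCast]
  exact Finsupp.mapRange_single (hf := map_zero _)

lemma pderiv_comm {σ : Type*} (i j : σ) (p : MvPolynomial σ ℂ) :
    MvPolynomial.pderiv i (MvPolynomial.pderiv j p)
      = MvPolynomial.pderiv j (MvPolynomial.pderiv i p) := by
  classical
  have : ⁅MvPolynomial.pderiv (R := ℂ) i, MvPolynomial.pderiv (R := ℂ) j⁆ = 0 :=
    MvPolynomial.derivation_ext fun k => by
      rw [Derivation.commutator_apply, MvPolynomial.pderiv_X, MvPolynomial.pderiv_X,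
        Pi.single_apply, Pi.single_apply]
      split_ifs <;> simp
  have h := congrArg (fun D => D p) this
  rwa [Derivation.commutator_apply, Derivation.zero_apply, sub_eq_zero] at h

/-- The annihilation operators `b_n`, `n ≥ 1`. -/
def annihilator (q : ℂ) (b : Boson) (n : ℕ) : Op := osc q b n

/-- The creation operators `b_{-n}`, `n ≥ 1`. -/
def creator (q : ℂ) (b : Boson) (n : ℕ) : Op := osc q b (-(n : ℤ))

lemma modesCommute_annihilator (q : ℂ) : ModesCommute (annihilator q) := by
  refine fun b b' n m hn hm => op_ext fun μ p => ?_
  rw [Module.End.mul_apply, Module.End.mul_apply, annihilator, annihilator,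
    osc_pos_single _ _ hn, osc_pos_single _ _ hm, osc_pos_single _ _ hn, osc_pos_single _ _ hm,
    Derivation.map_smul, Derivation.map_smul, smul_comm, pderiv_comm]

lemma modesCommute_creator (q : ℂ) : ModesCommute (creator q) := by
  refine fun b b' n m hn hm => op_ext fun μ p => ?_
  rw [Module.End.mul_apply, Module.End.mul_apply, creator, creator,
    osc_neg_single _ _ hn, osc_neg_single _ _ hm, osc_neg_single _ _ hn, osc_neg_single _ _ hm,
    mul_left_comm]

/-- The commutation relations of annihilation with creation operators. -/
lemma conjugate_annihilator_creator (q : ℂ) :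
    Conjugate (annihilator q) (creator q) (oscNorm q) := by
  have h : ∀ b b' (n m : ℕ), n ≠ 0 → m ≠ 0 → ∀ μ p,
      (annihilator q b n * creator q b' m) (Finsupp.single μ p)
        = (creator q b' m * annihilator q b n) (Finsupp.single μ p)
          + Finsupp.single μ (oscNorm q b n • (p * MvPolynomial.pderiv (b, n.toPNat')
            (MvPolynomial.X (b', m.toPNat')))) := by
    intro b b' n m hn hm μ p
    rw [Module.End.mul_apply, Module.End.mul_apply, annihilator, creator,
      osc_pos_single _ _ hn, osc_neg_single _ _ hm, osc_pos_single _ _ hn,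
      osc_neg_single _ _ hm, ← Finsupp.single_add, Derivation.leibniz, smul_add, smul_eq_mul,
      smul_eq_mul, mul_smul_comm]
  refine ⟨fun b n m hn hm => op_ext fun μ p => ?_, fun n m hn hm =>
    ⟨op_ext fun μ p => ?_, op_ext fun μ p => ?_⟩⟩
  · rw [LinearMap.sub_apply, h b b n m hn hm, add_sub_cancel_left]
    split_ifs with hnm
    · rw [hnm, MvPolynomial.pderiv_X_self, mul_one, Module.algebraMap_end_apply,
        Finsupp.smul_single]
    · have : (b, m.toPNat') ≠ (b, n.toPNat') := by
        rw [Ne, Prod.mk.injEq, ← PNat.coe_inj, Nat.toPNat'_coe, Nat.toPNat'_coe,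
          if_pos (by omega), if_pos (by omega)]
        tauto
      rw [MvPolynomial.pderiv_X_of_ne this, mul_zero, smul_zero, Finsupp.single_zero,
        LinearMap.zero_apply]
  · rw [h .a .c n m hn hm, MvPolynomial.pderiv_X_of_ne (by simp), mul_zero, smul_zero,
      Finsupp.single_zero, add_zero]
  · rw [h .c .a n m hn hm, MvPolynomial.pderiv_X_of_ne (by simp), mul_zero, smul_zero,
      Finsupp.single_zero, add_zero]

lemma diag_commute_annihilator (q : ℂ) (f : ℤ × ℤ → ℂ) (b : Boson) (n : ℕ) (hn : n ≠ 0) :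
    Commute (diag f) (annihilator q b n) := by
  refine op_ext fun μ p => ?_
  rw [Module.End.mul_apply, Module.End.mul_apply, diag_single, map_smul, annihilator,
    osc_pos_single _ _ hn, diag_single]

lemma diag_commute_creator (q : ℂ) (f : ℤ × ℤ → ℂ) (b : Boson) (n : ℕ) (hn : n ≠ 0) :
    Commute (diag f) (creator q b n) := by
  refine op_ext fun μ p => ?_
  rw [Module.End.mul_apply, Module.End.mul_apply, diag_single, map_smul, creator,
    osc_neg_single _ _ hn, diag_single]

lemma shift_commute_annihilator (q : ℂ) (ν : ℤ × ℤ) (b : Boson) (n : ℕ) (hn : n ≠ 0) :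
    Commute (shift ν) (annihilator q b n) := by
  refine op_ext fun μ p => ?_
  rw [Module.End.mul_apply, Module.End.mul_apply, shift_single, annihilator,
    osc_pos_single _ _ hn, osc_pos_single _ _ hn, shift_single]

lemma shift_commute_creator (q : ℂ) (ν : ℤ × ℤ) (b : Boson) (n : ℕ) (hn : n ≠ 0) :
    Commute (shift ν) (creator q b n) := by
  refine op_ext fun μ p => ?_
  rw [Module.End.mul_apply, Module.End.mul_apply, shift_single, creator,
    osc_neg_single _ _ hn, osc_neg_single _ _ hn, shift_single]

lemma annihilator_vac (q : ℂ) (μ : ℤ × ℤ) (b : Boson) (n : ℕ) (hn : n ≠ 0) :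
    annihilator q b n (vac μ) = 0 := by
  rw [annihilator, vac, osc_pos_single _ _ hn, MvPolynomial.pderiv_one, smul_zero,
    Finsupp.single_zero]

/-- The exponentials of annihilation operators act locally finitely, since this holds on the
vectors `vac μ` and is preserved by creation operators. -/
lemma locNil_modeExp (q : ℂ) (x y : ℕ → ℂ) : LocNil (modeExp (annihilator q) x y) := by
  have hadd : ∀ v w : Fock,
      (∃ K : ℕ, ∀ k ≥ K, PowerSeries.coeff k (modeExp (annihilator q) x y) v = 0) →
      (∃ K : ℕ, ∀ k ≥ K, PowerSeries.coeff k (modeExp (annihilator q) x y) w = 0) →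
      ∃ K : ℕ, ∀ k ≥ K, PowerSeries.coeff k (modeExp (annihilator q) x y) (v + w) = 0 := by
    rintro v w ⟨K, hK⟩ ⟨L, hL⟩
    exact ⟨max K L, fun k hk => by
      rw [map_add, hK k (le_trans (le_max_left _ _) hk), hL k (le_trans (le_max_right _ _) hk),
        add_zero]⟩
  intro v
  induction v using Finsupp.induction_linear with
  | zero => exact ⟨0, fun k _ => map_zero _⟩
  | add v w hv hw => exact hadd v w hv hw
  | single μ p =>
    induction p using MvPolynomial.induction_on with
    | C c =>
      refine ⟨1, fun k hk => ?_⟩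
      have : Finsupp.single μ (MvPolynomial.C c) = c • vac μ := by
        rw [vac, Finsupp.smul_single, MvPolynomial.C_eq_smul_one]
      rw [this, map_smul, coeff_modeExp_eq_zero x y (annihilator_vac q μ) (by omega), smul_zero]
    | add p p' hp hp' => rw [Finsupp.single_add]; exact hadd _ _ hp hp'
    | mul_X p bn hp =>
      obtain ⟨b, m⟩ := bn
      have hX : Finsupp.single μ (p * MvPolynomial.X (b, m))
          = creator q b m (Finsupp.single μ p) := by
        rw [creator, osc_neg_single q b m.ne_zero, mul_comm, PNat.coe_toPNat']
      rw [hX]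
      exact exists_coeff_modeExp_eq_zero x y (conjugate_annihilator_creator q)
        (modesCommute_annihilator q) hp b m.ne_zero

/-! ### Contraction functions -/

lemma lin_mul_linInv (a : ℂ) : lin 1 a * linInv 1 a = 1 := by
  ext n
  have h : lin 1 a = 1 + PowerSeries.C a * PowerSeries.X := by
    ext k
    rcases k with _ | _ | k <;> simp [lin, PowerSeries.coeff_one]
  rw [h, add_mul, one_mul, map_add, mul_assoc, PowerSeries.coeff_C_mul]
  rcases n with _ | n
  · simp [linInv]
  · simp [linInv, PowerSeries.coeff_succ_X_mul, PowerSeries.coeff_one]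
    ring

lemma lin_eq_smul {a : ℂ} (ha : a ≠ 0) (b : ℂ) : lin a b = a • lin 1 (a⁻¹ * b) := by
  ext k
  rcases k with _ | _ | k <;> simp [lin, ha]

lemma linInv_eq_smul (a b : ℂ) : linInv a b = a • linInv 1 (a * b) := by
  ext k
  simp [linInv]
  ring

/-- The series `log (1 + a u)`. -/
def logSeries (a : ℂ) : ℂ⟦X⟧ := PowerSeries.mk fun n => -(-a) ^ n / n

lemma isExp_lin (a : ℂ) : IsExp (logSeries a) (lin 1 a) := by
  have h1 : euler (lin 1 a) = PowerSeries.C a * PowerSeries.X := by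
    ext k
    rcases k with _ | _ | k <;> simp [lin, PowerSeries.coeff_X]
  have h2 : euler (logSeries a) = PowerSeries.C a * (PowerSeries.X * linInv 1 a) := by
    ext k
    rcases k with _ | k
    · simp
    · have : ((k : ℂ) + 1) ≠ 0 := by exact_mod_cast k.succ_ne_zero
      simp [logSeries, linInv, PowerSeries.coeff_succ_X_mul]
      field_simp
      ring
  refine ⟨by simp [lin], ?_⟩
  rw [h1, h2, mul_assoc, mul_assoc, mul_comm (linInv 1 a), lin_mul_linInv, mul_one]

lemma IsExp.neg {f E E' : ℂ⟦X⟧} (h : IsExp f E) (hE : E * E' = 1) : IsExp (-f) E' := by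
  refine ⟨?_, ?_⟩
  · have := congrArg (PowerSeries.coeff 0) hE
    simpa [PowerSeries.coeff_mul, h.coeff_zero] using this
  · have h1 : euler f * E * E' + E * euler E' = 0 := by
      rw [← h.euler_eq, ← euler_mul, hE, euler_one]
    have h2 : euler (-f) = - euler f := by ext n; simp
    rw [h2]
    linear_combination E' * h1 - (euler E' + euler f * E') * hE

lemma isExp_linInv (a : ℂ) : IsExp (-logSeries a) (linInv 1 a) :=
  (isExp_lin a).neg (lin_mul_linInv a)

lemma IsExp.mul_scalar {f f' E E' : ℂ⟦X⟧} (h : IsExp f E) (h' : IsExp f' E') :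
    IsExp (f + f') (E * E') := h.mul h' (Commute.all _ _)

/-- The coefficients `e t^n / [n]_q` of the fields. -/
def fieldCoeff (q e t : ℂ) (n : ℕ) : ℂ := e * t ^ n / qInt q n

namespace Admissible

variable {q : ℂ} (hq : Admissible q)

include hq

lemma sub_inv_ne_zero : q - q⁻¹ ≠ 0 := by
  intro h
  refine hq.2 2 two_pos ?_
  have := mul_inv_cancel₀ hq.1
  linear_combination q * h + this

lemma zpow_sub_ne_zero {n : ℕ} (hn : n ≠ 0) : q ^ n - (q ^ n)⁻¹ ≠ 0 := by
  intro h
  refine hq.2 (2 * n) (by omega) ?_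
  have := mul_inv_cancel₀ (pow_ne_zero n hq.1)
  rw [two_mul, pow_add]
  linear_combination q ^ n * h + this

lemma one_add_ne_zero : 1 + q ≠ 0 := by
  intro h
  refine hq.2 2 two_pos ?_
  linear_combination (q - 1) * h

lemma qInt_ne_zero {n : ℕ} (hn : n ≠ 0) : qInt q n ≠ 0 := by
  simpa [qInt] using ⟨hq.zpow_sub_ne_zero hn, hq.sub_inv_ne_zero⟩

/-- The contraction of two pairs of fields: an `a`-field and a `c`-field each. The sign `(-1)^n` in
`[a_n, a_{-n}]` turns the argument of the first logarithm around. -/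
lemma contraction_fieldCoeff (e t e' t' f u f' u' : ℂ) :
    contraction (oscNorm q) (fieldCoeff q e t) (fieldCoeff q e' t') (fieldCoeff q f u)
      (fieldCoeff q f' u') = -((e * f) • logSeries (t * u)) - (e' * f') • logSeries (-(t' * u')) := by
  ext n
  rcases eq_or_ne n 0 with rfl | hn
  · simp [contraction, logSeries]
  · have h := hq.qInt_ne_zero hn
    have hn' : (n : ℂ) ≠ 0 := by exact_mod_cast hn
    simp only [contraction, logSeries, fieldCoeff, oscNorm, PowerSeries.coeff_mk, if_neg hn,
      map_sub, map_neg, PowerSeries.coeff_smul, smul_eq_mul, neg_neg, mul_pow, neg_pow (t * u)]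
    field_simp
    ring

/-- The contraction of a Cartan field with an `a`-field. -/
lemma contraction_const_fieldCoeff (c f u : ℂ) (y' : ℕ → ℂ) :
    contraction (oscNorm q) (fun _ => c * (q - q⁻¹)) 0 (fieldCoeff q f u) y'
      = (c * f) • (logSeries (q⁻¹ * u) - logSeries (q * u)) := by
  ext n
  rcases eq_or_ne n 0 with rfl | hn
  · simp [contraction, logSeries]
  · have h := hq.qInt_ne_zero hn
    have hn' : (n : ℂ) ≠ 0 := by exact_mod_cast hn
    have h' : (q - q⁻¹) * qInt q n = q ^ n - (q ^ n)⁻¹ := by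
      rw [qInt, mul_div_cancel₀ _ hq.sub_inv_ne_zero]; simp
    have e1 : c * (q - q⁻¹) * (f * u ^ n / qInt q n) * ((-1) ^ n * qInt q n ^ 2 / n)
        = c * f * (-u) ^ n / n * ((q - q⁻¹) * qInt q n) := by
      rw [neg_pow u]; field_simp
    simp only [contraction, logSeries, fieldCoeff, oscNorm, PowerSeries.coeff_mk, if_neg hn,
      map_sub, PowerSeries.coeff_smul, smul_eq_mul, Pi.zero_apply, zero_mul, add_zero, e1, h',
      ← mul_neg, mul_pow, inv_pow]
    ring

/-- The contraction of the two Cartan fields. -/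
lemma contraction_const_const :
    contraction (oscNorm q) (fun _ => q - q⁻¹) 0 (fun _ => -(q - q⁻¹)) 0
      = logSeries (q * q) + logSeries (q⁻¹ * q⁻¹) - logSeries 1 - logSeries 1 := by
  ext n
  rcases eq_or_ne n 0 with rfl | hn
  · simp [contraction, logSeries]
  · have hn' : (n : ℂ) ≠ 0 := by exact_mod_cast hn
    have hqn := mul_inv_cancel₀ (pow_ne_zero n hq.1)
    have h' : (q - q⁻¹) * qInt q n = q ^ n - (q ^ n)⁻¹ := by
      rw [qInt, mul_div_cancel₀ _ hq.sub_inv_ne_zero]; simp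
    have e1 : (q - q⁻¹) * -(q - q⁻¹) * ((-1) ^ n * qInt q n ^ 2 / n)
        = -(-1) ^ n / n * ((q - q⁻¹) * qInt q n) ^ 2 := by ring
    have hs : ∀ t : ℂ, PowerSeries.coeff n (logSeries t) = -((-1) ^ n * t ^ n) / n := fun t => by
      rw [logSeries, PowerSeries.coeff_mk, neg_pow t]
    simp only [contraction, oscNorm, PowerSeries.coeff_mk, if_neg hn, hs,
      map_sub, map_add, Pi.zero_apply, zero_mul, add_zero, e1, h', mul_pow, inv_pow, one_pow]
    linear_combination 2 * (-1) ^ n / (n : ℂ) * hqn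

end Admissible

lemma contraction_comm (N : Boson → ℕ → ℂ) (x y x' y' : ℕ → ℂ) :
    contraction N x y x' y' = contraction N x' y' x y := by
  simp only [contraction, mul_comm (x _), mul_comm (y _)]

/-! ### Vertex operators -/

/-- The data of a vertex operator `:e^{ε a(z;κ)} e^{ε' c(ζz)}:`, where `p = q^κ`. -/
structure VertexData where
  p : ℂ
  ζ : ℂ
  ε : ℤ
  ε' : ℤ

namespace VertexData

variable (q : ℂ) (V V₁ V₂ : VertexData)

/-- The charge carried by the vertex operator. -/
def charge : ℤ × ℤ := (V.ε, V.ε')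

/-- The pairing of the charge with a charge sector. -/
def dot (μ : ℤ × ℤ) : ℤ := V.ε * μ.1 + V.ε' * μ.2

/-- The exponential of the negative modes. -/
def creation : Op⟦X⟧ :=
  modeExp (creator q) (fieldCoeff q V.ε V.p) (fieldCoeff q V.ε' V.ζ)

/-- The exponential of the positive modes. -/
def annihilation : Op⟦X⟧ :=
  modeExp (annihilator q) (fieldCoeff q (-V.ε) V.p) (fieldCoeff q (-V.ε') V.ζ⁻¹)

lemma locNil_annihilation : LocNil (V.annihilation q) := locNil_modeExp q _ _

/-- The modes of the vertex operator without its zero mode factor. -/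
def oscMode (n : ℤ) : Op :=
  normalMode (V.creation q) (V.annihilation q) (V.locNil_annihilation q) n

/-- The coefficient of `z^N` in the vertex operator. On the sector of charge `μ` the zero modes
contribute `z^{⟨charge, μ⟩} ζ^{ε' μ₂}`, which shifts the degree of the oscillator part. -/
def mode (N : ℤ) : Op :=
  Finsupp.lsum ℂ fun μ => V.ζ ^ (V.ε' * μ.2) •
    ((V.oscMode q (N - V.dot μ) * shift V.charge) ∘ₗ Finsupp.lsingle μ)

lemma mode_single (N : ℤ) (μ : ℤ × ℤ) (p : MvPolynomial (Boson × ℕ+) ℂ) :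
    V.mode q N (Finsupp.single μ p) = V.ζ ^ (V.ε' * μ.2) •
      V.oscMode q (N - V.dot μ) (Finsupp.single (V.charge + μ) p) := by
  rw [mode, Finsupp.lsum_single, LinearMap.smul_apply, LinearMap.comp_apply,
    Finsupp.lsingle_apply, Module.End.mul_apply, shift_single]

lemma expSeries_fieldNeg :
    expSeries (V.ε • fieldNeg q .a V.p 1 + V.ε' • fieldNeg q .c 1 V.ζ) = V.creation q := by
  have : V.ε • fieldNeg q .a V.p 1 + V.ε' • fieldNeg q .c 1 V.ζ
      = modeSeries (creator q) (fieldCoeff q V.ε V.p) (fieldCoeff q V.ε' V.ζ) := by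
    ext1 n
    rw [map_add, map_zsmul, map_zsmul, fieldNeg, fieldNeg, modeSeries, PowerSeries.coeff_mk,
      PowerSeries.coeff_mk, PowerSeries.coeff_mk]
    split_ifs with hn
    · rw [smul_zero, smul_zero, add_zero]
    · rw [← Int.cast_smul_eq_zsmul ℂ, ← Int.cast_smul_eq_zsmul ℂ, smul_smul, smul_smul]
      have : qInt q (-(n : ℤ)) = - qInt q n := by simp [qInt]; ring
      congr 2 <;> simp [fieldCoeff, this] <;> ring
  rw [this]; rfl

lemma expSeries_fieldPos :
    expSeries (V.ε • fieldPos q .a V.p 1 + V.ε' • fieldPos q .c 1 V.ζ) = V.annihilation q := by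
  have : V.ε • fieldPos q .a V.p 1 + V.ε' • fieldPos q .c 1 V.ζ
      = modeSeries (annihilator q) (fieldCoeff q (-V.ε) V.p) (fieldCoeff q (-V.ε') V.ζ⁻¹) := by
    ext1 n
    rw [map_add, map_zsmul, map_zsmul, fieldPos, fieldPos, modeSeries, PowerSeries.coeff_mk,
      PowerSeries.coeff_mk, PowerSeries.coeff_mk]
    split_ifs with hn
    · rw [smul_zero, smul_zero, add_zero]
    · rw [← Int.cast_smul_eq_zsmul ℂ, ← Int.cast_smul_eq_zsmul ℂ, smul_smul, smul_smul]
      congr 2 <;> simp [fieldCoeff] <;> ring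
  rw [this]; rfl

lemma zeroFactor_single (i : ℤ) (μ : ℤ × ℤ) (p : MvPolynomial (Boson × ℕ+) ℂ) :
    zeroFactor V.ζ V.ε V.ε' i (Finsupp.single μ p)
      = if V.dot μ = i then V.ζ ^ (V.ε' * μ.2) • Finsupp.single (V.charge + μ) p else 0 := by
  rw [zeroFactor, Module.End.mul_apply, diag_single, map_smul, shift_single]
  by_cases h : V.dot μ = i
  · have h' : V.ε * μ.1 + V.ε' * μ.2 = i := h
    rw [if_pos h, if_pos h']; rfl
  · have h' : ¬ (V.ε * μ.1 + V.ε' * μ.2 = i) := h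
    rw [if_neg h, if_neg h', zero_smul]

lemma zeroFactor_commute {t : Op} (h : ∀ f, Commute (diag f) t) (h' : ∀ ν, Commute (shift ν) t)
    (i : ℤ) : Commute (zeroFactor V.ζ V.ε V.ε' i) t :=
  (h' _).mul_left (h _)

/-- The terms of the sum that defines `vertex`, indexed by the degrees in the creation and
annihilation operators. -/
def term (N : ℤ) (v : Fock) (jk : ℕ × ℕ) : Fock :=
  PowerSeries.coeff jk.1 (V.creation q) (zeroFactor V.ζ V.ε V.ε' (N - jk.1 + jk.2)
    (PowerSeries.coeff jk.2 (V.annihilation q) v))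

lemma vertex_eq_finsum_term (N : ℤ) (v : Fock) :
    vertex q V.p V.ζ V.ε V.ε' N v = ∑ᶠ jk, V.term q N v jk := by
  simp only [vertex, expSeries_fieldNeg, expSeries_fieldPos]
  rfl

lemma diag_commute_annihilation (f : ℤ × ℤ → ℂ) (n : ℕ) :
    Commute (diag f) (PowerSeries.coeff n (V.annihilation q)) :=
  coeff_modeExp_commute _ _ (diag_commute_annihilator q f) n

lemma diag_commute_creation (f : ℤ × ℤ → ℂ) (n : ℕ) :
    Commute (diag f) (PowerSeries.coeff n (V.creation q)) :=
  coeff_modeExp_commute _ _ (diag_commute_creator q f) n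

lemma shift_commute_annihilation (ν : ℤ × ℤ) (n : ℕ) :
    Commute (shift ν) (PowerSeries.coeff n (V.annihilation q)) :=
  coeff_modeExp_commute _ _ (shift_commute_annihilator q ν) n

lemma shift_commute_creation (ν : ℤ × ℤ) (n : ℕ) :
    Commute (shift ν) (PowerSeries.coeff n (V.creation q)) :=
  coeff_modeExp_commute _ _ (shift_commute_creator q ν) n

lemma diag_commute_oscMode (f : ℤ × ℤ → ℂ) (n : ℤ) : Commute (diag f) (V.oscMode q n) :=
  normalMode_commute _ (V.diag_commute_creation q f) (V.diag_commute_annihilation q f) n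

lemma shift_commute_oscMode (ν : ℤ × ℤ) (n : ℤ) : Commute (shift ν) (V.oscMode q n) :=
  normalMode_commute _ (V.shift_commute_creation q ν) (V.shift_commute_annihilation q ν) n

lemma term_single (N : ℤ) (μ : ℤ × ℤ) (p : MvPolynomial (Boson × ℕ+) ℂ) (jk : ℕ × ℕ) :
    V.term q N (Finsupp.single μ p) jk = if V.dot μ = N - jk.1 + jk.2 then
      V.ζ ^ (V.ε' * μ.2) • PowerSeries.coeff jk.1 (V.creation q)
        (PowerSeries.coeff jk.2 (V.annihilation q) (Finsupp.single (V.charge + μ) p)) else 0 := by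
  have hc := V.zeroFactor_commute (fun f => V.diag_commute_annihilation q f jk.2)
    (fun ν => V.shift_commute_annihilation q ν jk.2) (N - jk.1 + jk.2)
  rw [term, ← Module.End.mul_apply (zeroFactor _ _ _ _), hc.eq, Module.End.mul_apply,
    zeroFactor_single]
  split_ifs
  · rw [map_smul, map_smul]
  · rw [map_zero, map_zero]

lemma finsum_term_single (N : ℤ) (μ : ℤ × ℤ) (p : MvPolynomial (Boson × ℕ+) ℂ) :
    (Function.support (V.term q N (Finsupp.single μ p))).Finite ∧
      ∑ᶠ jk, V.term q N (Finsupp.single μ p) jk = V.mode q N (Finsupp.single μ p) := by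
  obtain ⟨K, hK⟩ := V.locNil_annihilation q (Finsupp.single (V.charge + μ) p)
  let e : ℕ ↪ ℕ × ℕ := ⟨fun k => ((N - V.dot μ + k).toNat, k), fun k k' h => (Prod.ext_iff.mp h).2⟩
  have hsub : Function.support (V.term q N (Finsupp.single μ p))
      ⊆ ((Finset.range K).map e : Finset (ℕ × ℕ)) := by
    intro jk hjk
    rw [Function.mem_support, term_single] at hjk
    have h1 : V.dot μ = N - jk.1 + jk.2 := by
      by_contra h; exact hjk (if_neg h)
    have h2 : jk.2 < K := by
      by_contra h
      refine hjk ?_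
      rw [hK _ (not_lt.mp h), map_zero, smul_zero, ite_self]
    refine Finset.mem_coe.mpr (Finset.mem_map.mpr ⟨jk.2, Finset.mem_range.mpr h2, ?_⟩)
    refine Prod.ext ?_ rfl
    change (N - V.dot μ + jk.2).toNat = jk.1
    omega
  refine ⟨(Finset.finite_toSet _).subset hsub, ?_⟩
  rw [finsum_eq_sum_of_support_subset _ hsub, Finset.sum_map, mode_single, oscMode,
    normalMode_apply _ _ hK, Finset.smul_sum]
  refine Finset.sum_congr rfl fun k _ => ?_
  rw [term_single, show e k = ((N - V.dot μ + k).toNat, k) from rfl]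
  dsimp only
  rcases lt_or_ge (N - V.dot μ + k) 0 with h | h
  · rw [if_neg (by omega), zcoeff_of_neg _ h, LinearMap.zero_apply, smul_zero]
  · rw [if_pos (by omega), zcoeff, if_pos h]

/-- `vertex` is linear in the vector, and is given by `mode`. -/
lemma vertex_eq_mode (N : ℤ) (v : Fock) : vertex q V.p V.ζ V.ε V.ε' N v = V.mode q N v := by
  rw [vertex_eq_finsum_term]
  suffices h : (Function.support (V.term q N v)).Finite ∧
      ∑ᶠ jk, V.term q N v jk = V.mode q N v from h.2
  induction v using Finsupp.induction_linear with
  | zero =>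
    have : V.term q N 0 = 0 := by
      funext jk; rw [term, map_zero, map_zero, map_zero]; rfl
    rw [this, map_zero]
    exact ⟨by simp, by simp⟩
  | add v w hv hw =>
    have : V.term q N (v + w) = V.term q N v + V.term q N w := by
      funext jk
      rw [term, map_add, map_add, map_add]; rfl
    rw [this, map_add, ← hv.2, ← hw.2, ← finsum_add_distrib hv.1 hw.1]
    exact ⟨(hv.1.union hw.1).subset (Function.support_add _ _), rfl⟩
  | single μ p => exact V.finsum_term_single q N μ p

lemma single_of_commute {t : Op} (h : ∀ f, Commute (diag f) t) (μ : ℤ × ℤ)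
    (p : MvPolynomial (Boson × ℕ+) ℂ) :
    ∃ p', t (Finsupp.single μ p) = Finsupp.single μ p' := by
  classical
  let f : ℤ × ℤ → ℂ := fun ν => if ν = μ then 1 else 0
  have h1 : t (Finsupp.single μ p) = diag f (t (Finsupp.single μ p)) := by
    rw [← Module.End.mul_apply, (h f).eq, Module.End.mul_apply, diag_single]
    simp [f]
  have h2 : ∀ v : Fock, ∃ p', diag f v = Finsupp.single μ p' := by
    intro v
    induction v using Finsupp.induction_linear with
    | zero => exact ⟨0, by simp⟩
    | add v w hv hw =>
      obtain ⟨a, ha⟩ := hv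
      obtain ⟨b, hb⟩ := hw
      exact ⟨a + b, by rw [map_add, ha, hb, Finsupp.single_add]⟩
    | single ν p =>
      rw [diag_single]
      by_cases hν : ν = μ
      · exact ⟨p, by simp [f, hν]⟩
      · exact ⟨0, by simp [f, hν]⟩
  rw [h1]
  exact h2 _

/-- The product of two vertex operators in terms of their oscillator parts. -/
lemma mode_mode_single (hζ : V₁.ζ ≠ 0) (N M : ℤ) (μ : ℤ × ℤ) (p : MvPolynomial (Boson × ℕ+) ℂ) :
    V₁.mode q N (V₂.mode q M (Finsupp.single μ p))
      = V₁.ζ ^ (V₁.ε' * V₂.ε') • (V₁.ζ ^ (V₁.ε' * μ.2) * V₂.ζ ^ (V₂.ε' * μ.2)) •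
        V₁.oscMode q (N - V₁.dot μ - V₁.dot V₂.charge) (V₂.oscMode q (M - V₂.dot μ)
          (Finsupp.single (V₁.charge + V₂.charge + μ) p)) := by
  obtain ⟨p', hp'⟩ := single_of_commute (fun f => V₂.diag_commute_oscMode q f (M - V₂.dot μ))
    (V₂.charge + μ) p
  have h1 : Finsupp.single (V₁.charge + (V₂.charge + μ)) p'
      = V₂.oscMode q (M - V₂.dot μ) (Finsupp.single (V₁.charge + V₂.charge + μ) p) := by
    rw [← shift_single V₁.charge, ← hp', ← Module.End.mul_apply,
      (V₂.shift_commute_oscMode q _ _).eq, Module.End.mul_apply, shift_single, add_assoc]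
  have h2 : V₁.ζ ^ (V₁.ε' * (V₂.charge + μ).2)
      = V₁.ζ ^ (V₁.ε' * V₂.ε') * V₁.ζ ^ (V₁.ε' * μ.2) := by
    rw [← zpow_add₀ hζ, ← mul_add]; rfl
  have h3 : N - V₁.dot (V₂.charge + μ) = N - V₁.dot μ - V₁.dot V₂.charge := by
    simp only [dot, Prod.fst_add, Prod.snd_add]
    ring
  rw [mode_single, map_smul, hp', mode_single, h1, h2, h3, smul_smul, smul_smul]
  congr 1
  ring

/-- The coefficient of `z^i w^j` in the normally ordered product `:V₁(z) V₂(w):`, on a vector of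
charge `μ`, up to the powers of `z` and `w` that come from the charges of `V₁` and `V₂`. -/
def normalProduct (μ : ℤ × ℤ) (p : MvPolynomial (Boson × ℕ+) ℂ) (i j : ℤ) : Fock :=
  (V₁.ζ ^ (V₁.ε' * μ.2) * V₂.ζ ^ (V₂.ε' * μ.2)) •
    normalPair (V₁.creation q) (V₁.annihilation q) (V₁.locNil_annihilation q)
      (V₂.creation q) (V₂.annihilation q) (i - V₁.dot μ) (j - V₂.dot μ)
      (Finsupp.single (V₁.charge + V₂.charge + μ) p)

variable {q V₁ V₂}

/-- The logarithm of the contraction of two vertex operators with `u = w / z`. -/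
lemma contraction_eq (hq : Admissible q) :
    contraction (oscNorm q) (fieldCoeff q (-V₁.ε) V₁.p) (fieldCoeff q (-V₁.ε') V₁.ζ⁻¹)
      (fieldCoeff q V₂.ε V₂.p) (fieldCoeff q V₂.ε' V₂.ζ)
      = ((V₁.ε * V₂.ε : ℤ) : ℂ) • logSeries (V₁.p * V₂.p)
        + ((V₁.ε' * V₂.ε' : ℤ) : ℂ) • logSeries (-(V₁.ζ⁻¹ * V₂.ζ)) := by
  rw [hq.contraction_fieldCoeff]
  push_cast
  rw [neg_mul, neg_mul, neg_smul, neg_smul, neg_neg, sub_neg_eq_add]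

/-- The operator product expansion of `V₁(z) V₂(w)`, with contraction `g(w/z)`. -/
lemma mode_mode_eventually (hq : Admissible q) (hζ : V₁.ζ ≠ 0) {g : ℂ⟦X⟧}
    (hg : IsExp (((V₁.ε * V₂.ε : ℤ) : ℂ) • logSeries (V₁.p * V₂.p)
        + ((V₁.ε' * V₂.ε' : ℤ) : ℂ) • logSeries (-(V₁.ζ⁻¹ * V₂.ζ))) g)
    (N M : ℤ) (μ : ℤ × ℤ) (p : MvPolynomial (Boson × ℕ+) ℂ) :
    ∀ᶠ L : ℕ in Filter.atTop, V₁.mode q N (V₂.mode q M (Finsupp.single μ p))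
      = V₁.ζ ^ (V₁.ε' * V₂.ε') • ∑ l ∈ Finset.range L, PowerSeries.coeff l g •
        normalProduct q V₁ V₂ μ p (N - V₁.dot V₂.charge + l) (M - l) := by
  rw [← contraction_eq hq] at hg
  have := normalMode_normalMode (V₁.locNil_annihilation q) (V₂.locNil_annihilation q)
    ((conjugate_annihilator_creator q).exchange (modesCommute_annihilator q)
      (modesCommute_creator q) hg) (B₁ := V₁.creation q)
    (fun i j => modeExp_commute _ _ _ _ (modesCommute_creator q) i j)
    (N - V₁.dot μ - V₁.dot V₂.charge) (M - V₂.dot μ)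
    (Finsupp.single (V₁.charge + V₂.charge + μ) p)
  filter_upwards [this] with L hL
  rw [mode_mode_single q V₁ V₂ hζ]
  refine congrArg _ ?_
  refine (congrArg _ hL).trans ?_
  rw [Finset.smul_sum]
  refine Finset.sum_congr rfl fun l _ => ?_
  rw [smul_comm, normalProduct]
  congr 3 <;> ring

/-- The operator product expansion of `V₂(w) V₁(z)`, with contraction `g(z/w)`. -/
lemma mode_mode_swap_eventually (hq : Admissible q) (hζ : V₂.ζ ≠ 0) {g : ℂ⟦X⟧}
    (hg : IsExp (((V₁.ε * V₂.ε : ℤ) : ℂ) • logSeries (V₁.p * V₂.p)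
        + ((V₁.ε' * V₂.ε' : ℤ) : ℂ) • logSeries (-(V₂.ζ⁻¹ * V₁.ζ))) g)
    (N M : ℤ) (μ : ℤ × ℤ) (p : MvPolynomial (Boson × ℕ+) ℂ) :
    ∀ᶠ L : ℕ in Filter.atTop, V₂.mode q M (V₁.mode q N (Finsupp.single μ p))
      = V₂.ζ ^ (V₁.ε' * V₂.ε') • ∑ l ∈ Finset.range L, PowerSeries.coeff l g •
        normalProduct q V₁ V₂ μ p (N - l) (M - V₁.dot V₂.charge + l) := by
  rw [mul_comm V₁.ε, mul_comm V₁.ε', mul_comm V₁.p, ← contraction_eq hq] at hg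
  have := normalMode_normalMode_swap (V₁.locNil_annihilation q) (V₂.locNil_annihilation q)
    ((conjugate_annihilator_creator q).exchange (modesCommute_annihilator q)
      (modesCommute_creator q) hg) (B₂ := V₂.creation q)
    (fun i j => modeExp_commute _ _ _ _ (modesCommute_annihilator q) i j)
    (N - V₁.dot μ) (M - V₂.dot μ - V₂.dot V₁.charge)
    (Finsupp.single (V₁.charge + V₂.charge + μ) p)
  filter_upwards [this] with L hL
  rw [mode_mode_single q V₂ V₁ hζ, mul_comm V₂.ε', add_comm V₂.charge V₁.charge]
  refine congrArg _ ?_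
  refine (congrArg _ hL).trans ?_
  rw [Finset.smul_sum]
  refine Finset.sum_congr rfl fun l _ => ?_
  have h : V₂.dot V₁.charge = V₁.dot V₂.charge := by simp only [dot, charge]; ring
  rw [smul_comm, normalProduct, mul_comm (V₂.ζ ^ _), h]
  congr 3 <;> ring

end VertexData

/-! ### Exchange relations of vertex operators -/

lemma sum_range_one_smul {M : Type*} [AddCommGroup M] [Module ℂ M] (f : ℕ → M) {L : ℕ}
    (hL : 1 ≤ L) : ∑ l ∈ Finset.range L, PowerSeries.coeff l (1 : ℂ⟦X⟧) • f l = f 0 := by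
  rw [Finset.sum_eq_single_of_mem 0 (Finset.mem_range.mpr hL)]
  · simp
  · intro l _ hl
    simp [PowerSeries.coeff_one, hl]

lemma sum_range_quadratic_smul {M : Type*} [AddCommGroup M] [Module ℂ M] (a b : ℂ) (f : ℕ → M)
    {L : ℕ} (hL : 3 ≤ L) :
    ∑ l ∈ Finset.range L, PowerSeries.coeff l (lin 1 a * lin 1 b) • f l
      = f 0 + (a + b) • f 1 + (a * b) • f 2 := by
  have h : ∀ c : ℂ, lin 1 c = 1 + PowerSeries.C c * PowerSeries.X := by
    intro c
    ext k
    rcases k with _ | _ | k <;> simp [lin, PowerSeries.coeff_one]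
  obtain ⟨c, hc⟩ : ∃ c, c = a + b := ⟨_, rfl⟩
  obtain ⟨d, hd⟩ : ∃ d, d = a * b := ⟨_, rfl⟩
  have h' : lin 1 a * lin 1 b = 1 + PowerSeries.C c * PowerSeries.X
      + PowerSeries.C d * PowerSeries.X ^ 2 := by
    rw [h, h, hc, hd, map_add, map_mul]; ring
  have hcoeff : ∀ l, PowerSeries.coeff l (lin 1 a * lin 1 b)
      = (if l = 0 then 1 else 0) + c * (if l = 1 then 1 else 0) + d * (if l = 2 then 1 else 0) := by
    intro l
    rw [h', map_add, map_add, PowerSeries.coeff_C_mul, PowerSeries.coeff_C_mul,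
      PowerSeries.coeff_one, PowerSeries.coeff_X, PowerSeries.coeff_X_pow]
  rw [← hc, ← hd, ← Finset.sum_subset (Finset.range_mono hL)]
  · simp [Finset.sum_range_succ, hcoeff]
  · intro l _ hl
    have hl : 3 ≤ l := by simpa using hl
    rw [hcoeff, if_neg (by omega), if_neg (by omega), if_neg (by omega)]
    simp

lemma finsum_int_eventually {M : Type*} [AddCommGroup M] {f : ℤ → M} {D : ℕ}
    (h : ∀ l : ℤ, (D : ℤ) ≤ |l| → f l = 0) :
    ∀ᶠ L : ℕ in Filter.atTop, ∑ᶠ l, f l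
      = ∑ l ∈ Finset.range L, f l + ∑ l ∈ Finset.range L, f (-1 - l) := by
  filter_upwards [Filter.eventually_ge_atTop D] with L hL
  let e₁ : ℕ ↪ ℤ := ⟨fun l => l, fun a b h => by simpa using h⟩
  let e₂ : ℕ ↪ ℤ := ⟨fun l => -1 - l, fun a b h => by simpa using h⟩
  have hd : Disjoint ((Finset.range L).map e₁) ((Finset.range L).map e₂) := by
    rw [Finset.disjoint_left]
    intro l h1 h2
    obtain ⟨a, _, rfl⟩ := Finset.mem_map.mp h1
    obtain ⟨b, _, hb⟩ := Finset.mem_map.mp h2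
    have hb : -1 - (b : ℤ) = a := hb
    omega
  rw [finsum_eq_sum_of_support_subset (s := ((Finset.range L).map e₁).disjUnion _ hd),
    Finset.sum_disjUnion, Finset.sum_map, Finset.sum_map]
  · rfl
  · intro l hl
    have hl' : |l| < D := not_le.mp fun h' => hl (h l h')
    rw [abs_lt] at hl'
    simp only [Finset.coe_disjUnion, Set.mem_union, Finset.mem_coe, Finset.mem_map,
      Finset.mem_range]
    rcases lt_or_ge l 0 with h0 | h0
    · refine Or.inr ⟨(-1 - l).toNat, by omega, ?_⟩
      change -1 - ((-1 - l).toNat : ℤ) = l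
      omega
    · refine Or.inl ⟨l.toNat, by omega, ?_⟩
      change (l.toNat : ℤ) = l
      omega

namespace VertexData

variable {q : ℂ} {V V₁ V₂ : VertexData}

/-- The relation `(z + κw) V(z) V(w) + (κz + w) V(w) V(z) = 0` for a vertex operator with
contraction `(1 + κ⁻¹ u)(1 - u)`. -/
lemma mode_quadratic_self (hq : Admissible q) (hζ : V.ζ ≠ 0) (hε : V.ε * V.ε = 1)
    (hε' : V.ε' * V.ε' = 1) {κ : ℂ} (hκ : κ ≠ 0) (hp : V.p * V.p = κ⁻¹) (N M : ℤ) :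
    V.mode q (N - 1) * V.mode q M + κ • (V.mode q N * V.mode q (M - 1))
      + (κ • (V.mode q M * V.mode q (N - 1)) + V.mode q (M - 1) * V.mode q N) = 0 := by
  refine op_ext fun μ p => ?_
  have hd : V.dot V.charge = 2 := by simp only [dot, charge]; omega
  have hg : IsExp (((V.ε * V.ε : ℤ) : ℂ) • logSeries (V.p * V.p)
      + ((V.ε' * V.ε' : ℤ) : ℂ) • logSeries (-(V.ζ⁻¹ * V.ζ))) (lin 1 κ⁻¹ * lin 1 (-1)) := by
    rw [hε, hε', hp, inv_mul_cancel₀ hζ, Int.cast_one, one_smul, one_smul]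
    exact (isExp_lin _).mul_scalar (isExp_lin _)
  obtain ⟨L, h1, h2, h3, h4, hL⟩ := ((mode_mode_eventually hq hζ hg (N - 1) M μ p).and
    ((mode_mode_eventually hq hζ hg N (M - 1) μ p).and
    ((mode_mode_swap_eventually hq hζ hg (N - 1) M μ p).and
    ((mode_mode_swap_eventually hq hζ hg N (M - 1) μ p).and
      (Filter.eventually_ge_atTop 3))))).exists
  simp only [LinearMap.add_apply, LinearMap.smul_apply, Module.End.mul_apply, h1, h2, h3, h4,
    hd, sum_range_quadratic_smul _ _ _ hL, LinearMap.zero_apply]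
  set F := normalProduct q V V μ p with hF
  simp only [Nat.cast_zero, Nat.cast_one, Nat.cast_ofNat, add_zero, sub_zero]
  ring_nf
  match_scalars <;> field_simp <;> ring

/-- The relation `(z + κw) V₁(z) V₂(w) + (κz + w) V₂(w) V₁(z) = 0` for two vertex operators
whose contraction is a constant in this order, and `(1 + κ⁻¹ u) / (1 + κ u)` in the opposite
one. -/
lemma mode_quadratic_pair (hq : Admissible q) (hζ₁ : V₁.ζ ≠ 0) (hζ₂ : V₂.ζ ≠ 0)
    (hε : V₁.ε * V₂.ε = 1) (hε' : V₁.ε' * V₂.ε' = -1) {κ : ℂ} (hκ : κ ≠ 0)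
    (hp : V₁.p * V₂.p = κ⁻¹) (hζ : V₁.ζ = -(κ * V₂.ζ)) (N M : ℤ) :
    V₁.mode q (N - 1) * V₂.mode q M + κ • (V₁.mode q N * V₂.mode q (M - 1))
      + (κ • (V₂.mode q M * V₁.mode q (N - 1)) + V₂.mode q (M - 1) * V₁.mode q N) = 0 := by
  refine op_ext fun μ p => ?_
  have hd : V₁.dot V₂.charge = 0 := by simp only [dot, charge]; omega
  have hr₁ : V₁.ζ⁻¹ * V₂.ζ = -κ⁻¹ := by rw [hζ]; field_simp
  have hr₂ : V₂.ζ⁻¹ * V₁.ζ = -κ := by rw [hζ]; field_simp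
  have hg : IsExp (((V₁.ε * V₂.ε : ℤ) : ℂ) • logSeries (V₁.p * V₂.p)
      + ((V₁.ε' * V₂.ε' : ℤ) : ℂ) • logSeries (-(V₁.ζ⁻¹ * V₂.ζ))) 1 := by
    rw [hε, hε', hp, hr₁, neg_neg, ← lin_mul_linInv κ⁻¹]
    convert (isExp_lin _).mul_scalar (isExp_linInv κ⁻¹) using 1
    simp
  have hg' : IsExp (((V₁.ε * V₂.ε : ℤ) : ℂ) • logSeries (V₁.p * V₂.p)
      + ((V₁.ε' * V₂.ε' : ℤ) : ℂ) • logSeries (-(V₂.ζ⁻¹ * V₁.ζ)))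
      (lin 1 κ⁻¹ * linInv 1 κ) := by
    rw [hε, hε', hp, hr₂, neg_neg]
    convert (isExp_lin κ⁻¹).mul_scalar (isExp_linInv κ) using 1
    simp
  obtain ⟨L, h1, h2, h3, h4, hL⟩ := ((mode_mode_eventually hq hζ₁ hg (N - 1) M μ p).and
    ((mode_mode_eventually hq hζ₁ hg N (M - 1) μ p).and
    ((mode_mode_swap_eventually hq hζ₂ hg' (N - 1) M μ p).and
    (((Filter.tendsto_add_atTop_nat 1).eventually
      (mode_mode_swap_eventually hq hζ₂ hg' N (M - 1) μ p)).and
      (Filter.eventually_ge_atTop 1))))).exists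
  -- the coefficients of `(1 + κ⁻¹ u) / (1 + κ u)`
  set g := lin 1 κ⁻¹ * linInv 1 κ with hgdef
  have hg0 : PowerSeries.coeff 0 g = 1 := hg'.coeff_zero
  have hrec : ∀ l, PowerSeries.coeff (l + 1) g + κ * PowerSeries.coeff l g
      = if l = 0 then κ⁻¹ else 0 := by
    intro l
    have h : lin 1 κ = 1 + PowerSeries.C κ * PowerSeries.X := by
      ext k
      rcases k with _ | _ | k <;> simp [lin, PowerSeries.coeff_one]
    have hmul : lin 1 κ * g = lin 1 κ⁻¹ := by
      rw [hgdef, mul_left_comm, lin_mul_linInv, mul_one]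
    have := congrArg (PowerSeries.coeff (l + 1)) hmul
    rw [h, add_mul, one_mul, mul_assoc, map_add, PowerSeries.coeff_C_mul,
      PowerSeries.coeff_succ_X_mul] at this
    rw [this]
    simp [lin]
  set F := normalProduct q V₁ V₂ μ p with hF
  simp only [LinearMap.add_apply, LinearMap.smul_apply, Module.End.mul_apply, h1, h2, h3, h4,
    hd, sum_range_one_smul _ hL, LinearMap.zero_apply, sub_zero]
  rw [Finset.sum_range_succ', hg0, one_smul]
  have e1 : ∀ l : ℕ, F (N - ((l + 1 : ℕ) : ℤ)) (M - 1 + ((l + 1 : ℕ) : ℤ))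
      = F (N - 1 - l) (M + l) := fun l => by
    congr 1 <;> push_cast <;> ring
  simp only [e1, Nat.cast_zero, add_zero, sub_zero]
  have e2 : κ • ∑ l ∈ Finset.range L, PowerSeries.coeff l g • F (N - 1 - l) (M + l)
      + ∑ l ∈ Finset.range L, PowerSeries.coeff (l + 1) g • F (N - 1 - l) (M + l)
      = κ⁻¹ • F (N - 1) M := by
    rw [Finset.smul_sum, ← Finset.sum_add_distrib,
      Finset.sum_eq_single_of_mem 0 (Finset.mem_range.mpr hL)]
    · rw [smul_smul, ← add_smul, add_comm, hrec]
      simp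
    · intro l _ hl
      rw [smul_smul, ← add_smul, add_comm, hrec, if_neg hl, zero_smul]
  rw [hε', zpow_neg_one, zpow_neg_one, smul_comm κ V₂.ζ⁻¹, ← smul_add, ← add_assoc, e2, hζ]
  simp only [smul_add, smul_smul]
  match_scalars <;> field_simp <;> ring

/-- Two vertex operators with opposite `a`-charge and equal `c`-charge, on which the poles and
zeros of the contraction cancel, anticommute. -/
lemma mode_anticomm (hq : Admissible q) (hζ₁ : V₁.ζ ≠ 0)
    (hε : V₁.ε * V₂.ε = -1) (hε' : V₁.ε' * V₂.ε' = 1)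
    (hp : V₁.p * V₂.p = 1) (hζ : V₂.ζ = -V₁.ζ) (N M : ℤ) :
    V₁.mode q N * V₂.mode q M + V₂.mode q M * V₁.mode q N = 0 := by
  refine op_ext fun μ p => ?_
  have hd : V₁.dot V₂.charge = 0 := by simp only [dot, charge]; omega
  have hζ₂ : V₂.ζ ≠ 0 := hζ ▸ neg_ne_zero.mpr hζ₁
  have hr₁ : V₁.ζ⁻¹ * V₂.ζ = -1 := by rw [hζ]; field_simp
  have hr₂ : V₂.ζ⁻¹ * V₁.ζ = -1 := by rw [hζ]; field_simp
  have h0 : IsExp (((-1 : ℤ) : ℂ) • logSeries 1 + ((1 : ℤ) : ℂ) • logSeries 1) 1 := by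
    rw [← lin_mul_linInv 1]
    convert (isExp_lin _).mul_scalar (isExp_linInv 1) using 1
    simp
  have hg : IsExp (((V₁.ε * V₂.ε : ℤ) : ℂ) • logSeries (V₁.p * V₂.p)
      + ((V₁.ε' * V₂.ε' : ℤ) : ℂ) • logSeries (-(V₁.ζ⁻¹ * V₂.ζ))) 1 := by
    rwa [hε, hε', hp, hr₁, neg_neg]
  have hg' : IsExp (((V₁.ε * V₂.ε : ℤ) : ℂ) • logSeries (V₁.p * V₂.p)
      + ((V₁.ε' * V₂.ε' : ℤ) : ℂ) • logSeries (-(V₂.ζ⁻¹ * V₁.ζ))) 1 := by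
    rwa [hε, hε', hp, hr₂, neg_neg]
  obtain ⟨L, h1, h2, hL⟩ := ((mode_mode_eventually hq hζ₁ hg N M μ p).and
    ((mode_mode_swap_eventually hq hζ₂ hg' N M μ p).and (Filter.eventually_ge_atTop 1))).exists
  simp only [LinearMap.add_apply, Module.End.mul_apply, h1, h2, hd, sum_range_one_smul _ hL,
    LinearMap.zero_apply, sub_zero, Nat.cast_zero, add_zero, hζ, hε', zpow_one, neg_smul,
    add_neg_cancel]

/-- Partial fractions of `1 / ((1 + u)(1 - r u))`. -/
lemma coeff_linInv_mul_linInv {r : ℂ} (hr : 1 + r ≠ 0) (l : ℕ) :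
    PowerSeries.coeff l (linInv 1 1 * linInv 1 (-r)) = ((-1) ^ l + r ^ (l + 1)) / (1 + r) := by
  have h : ∀ c : ℂ, lin 1 c = 1 + PowerSeries.C c * PowerSeries.X := by
    intro c
    ext k
    rcases k with _ | _ | k <;> simp [lin, PowerSeries.coeff_one]
  have h1 := lin_mul_linInv (1 : ℂ)
  have h2 := lin_mul_linInv (-r)
  have h3 : PowerSeries.C (1 + r) * (linInv 1 1 * linInv 1 (-r))
      = linInv 1 1 + PowerSeries.C r * linInv 1 (-r) := by
    rw [h, map_neg] at h2
    rw [h, map_one] at h1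
    rw [map_add, map_one]
    linear_combination (linInv 1 1) * h2 + PowerSeries.C r * linInv 1 (-r) * h1
  have h4 := congrArg (PowerSeries.coeff l) h3
  rw [PowerSeries.coeff_C_mul, map_add, PowerSeries.coeff_C_mul] at h4
  rw [eq_div_iff hr, mul_comm, h4]
  simp [linInv, ← mul_pow]
  ring

/-- The restriction of `:V₁(z) V₂(w):` to `z = xw`, for opposite charges. -/
lemma finsum_normalProduct (hε : V₂.ε = -V₁.ε)
    (hε' : V₂.ε' = -V₁.ε') {x : ℂ} (hx : x ≠ 0) (T M : ℤ) (μ : ℤ × ℤ)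
    (p : MvPolynomial (Boson × ℕ+) ℂ) :
    ∑ᶠ l : ℤ, x ^ l • normalProduct q V₁ V₂ μ p (T - M + l) (M - l)
      = (x ^ (M + V₁.dot μ) * (V₁.ζ⁻¹ * V₂.ζ) ^ (-(V₁.ε' * μ.2))) •
        normalMode (modeExp (creator q) (fieldCoeff q V₁.ε V₁.p + fieldCoeff q (-V₁.ε) (x⁻¹ * V₂.p))
          (fieldCoeff q V₁.ε' V₁.ζ + fieldCoeff q (-V₁.ε') (x⁻¹ * V₂.ζ)))
        (modeExp (annihilator q) (fieldCoeff q (-V₁.ε) V₁.p + fieldCoeff q V₁.ε (x * V₂.p))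
          (fieldCoeff q (-V₁.ε') V₁.ζ⁻¹ + fieldCoeff q V₁.ε' (x * V₂.ζ⁻¹)))
        (locNil_modeExp q _ _) T (Finsupp.single μ p) := by
  have hd : V₂.dot μ = -V₁.dot μ := by simp only [dot, hε, hε']; ring
  have hc : V₁.charge + V₂.charge + μ = μ := by
    simp [charge, hε, hε']
  have hC : V₁.ζ ^ (V₁.ε' * μ.2) * V₂.ζ ^ (V₂.ε' * μ.2)
      = (V₁.ζ⁻¹ * V₂.ζ) ^ (-(V₁.ε' * μ.2)) := by
    rw [mul_zpow, inv_zpow', neg_neg, hε', neg_mul]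
  have hscale : ∀ (y e t : ℂ), fieldCoeff q e (y * t) = fun n => y ^ n * fieldCoeff q e t n := by
    intro y e t
    funext n
    rw [fieldCoeff, fieldCoeff, mul_pow]
    ring
  set B₂' := modeExp (creator q) (fieldCoeff q (-V₁.ε) (x⁻¹ * V₂.p))
    (fieldCoeff q (-V₁.ε') (x⁻¹ * V₂.ζ)) with hB₂'
  set A₂' := modeExp (annihilator q) (fieldCoeff q V₁.ε (x * V₂.p))
    (fieldCoeff q V₁.ε' (x * V₂.ζ⁻¹)) with hA₂'
  have hB : ∀ n, PowerSeries.coeff n B₂' = x⁻¹ ^ n • PowerSeries.coeff n (V₂.creation q) := by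
    intro n
    rw [hB₂', hscale, hscale, coeff_modeExp_rescale _ _ (modesCommute_creator q), creation, hε, hε',
      Int.cast_neg, Int.cast_neg]
  have hA : ∀ n, PowerSeries.coeff n A₂'
      = (x⁻¹ ^ n)⁻¹ • PowerSeries.coeff n (V₂.annihilation q) := by
    intro n
    rw [hA₂', hscale, hscale, coeff_modeExp_rescale _ _ (modesCommute_annihilator q), annihilation,
      hε, hε', Int.cast_neg, Int.cast_neg, neg_neg, neg_neg, inv_pow, inv_inv]
  have key := finsum_normalPair (V₁.locNil_annihilation q) (V₂.locNil_annihilation q)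
    (inv_ne_zero hx) hB hA (B₁ := V₁.creation q)
    (fun i j => modeExp_commute _ _ _ _ (modesCommute_creator q) i j)
    ((V₁.locNil_annihilation q).mul (locNil_modeExp q _ _)) T (Finsupp.single μ p)
  have hBB : V₁.creation q * B₂' = _ := modeExp_mul _ _ _ _ (modesCommute_creator q)
  have hAA : V₁.annihilation q * A₂' = _ := modeExp_mul _ _ _ _ (modesCommute_annihilator q)
  simp only [hBB, hAA] at key
  refine Eq.trans ?_ (congrArg _ key)
  rw [smul_finsum, ← finsum_comp_equiv (Equiv.subLeft (M + V₁.dot μ))]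
  refine finsum_congr fun j => ?_
  rw [normalProduct, hc, hC, hd, Equiv.subLeft_apply, smul_smul, smul_smul, zpow_sub₀ hx, inv_zpow]
  congr 1
  · ring
  · congr 1 <;> ring

variable (q V₁ V₂) in
lemma normalProduct_eventually_eq_zero (μ : ℤ × ℤ) (p : MvPolynomial (Boson × ℕ+) ℂ) :
    ∃ D : ℕ, ∀ i j : ℤ, i + D ≤ 0 ∨ j + D ≤ 0 → normalProduct q V₁ V₂ μ p i j = 0 := by
  obtain ⟨D, hD⟩ := (normalPair_eventually_eq_zero (B₁ := V₁.creation q) (B₂ := V₂.creation q)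
    (V₁.locNil_annihilation q) (V₂.locNil_annihilation q)
    (Finsupp.single (V₁.charge + V₂.charge + μ) p)).exists
  refine ⟨D + (|V₁.dot μ| + |V₂.dot μ|).toNat, fun i j hij => ?_⟩
  have h1 := neg_abs_le (V₁.dot μ)
  have h2 := neg_abs_le (V₂.dot μ)
  have h3 := abs_nonneg (V₁.dot μ)
  have h4 := abs_nonneg (V₂.dot μ)
  rw [normalProduct, hD, smul_zero]
  omega

end VertexData

/-- The difference of the expansions of `1 / ((1 + u)(1 - r u))` at `u = 0` and at `u = ∞` is a sum
of two delta functions, at `u = -1` and at `u = r⁻¹`; here it is applied to a Laurent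
polynomial `F`. -/
lemma sum_expansions_eq_delta {M : Type*} [AddCommGroup M] [Module ℂ M] {F : ℤ → M} {D : ℕ}
    (hF : ∀ l : ℤ, (D : ℤ) ≤ |l| → F l = 0) {r : ℂ} (hr0 : r ≠ 0) (hr1 : 1 + r ≠ 0) (t : ℂ) :
    ∀ᶠ L : ℕ in Filter.atTop,
      t • ∑ l ∈ Finset.range (L + 1), PowerSeries.coeff l (linInv 1 1 * linInv 1 (-r)) • F l
        + (t * r⁻¹) • ∑ l ∈ Finset.range L,
          PowerSeries.coeff l (linInv 1 1 * linInv 1 (-r⁻¹)) • F (-2 - l)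
      = (t / (1 + r)) • (∑ᶠ l : ℤ, (-1 : ℂ) ^ l • F l + r • ∑ᶠ l : ℤ, r ^ l • F l) := by
  have hr2 : 1 + r⁻¹ = (1 + r) * r⁻¹ := by field_simp; ring
  have hr1' : 1 + r⁻¹ ≠ 0 := hr2 ▸ mul_ne_zero hr1 (inv_ne_zero hr0)
  have hfin : ∀ x : ℂ, (Function.support fun l : ℤ => x ^ l • F l).Finite := by
    intro x
    refine (Set.finite_Icc (-(D : ℤ)) D).subset fun l hl => ?_
    by_contra h
    refine hl ?_
    dsimp only
    rw [hF l, smul_zero]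
    rw [Set.mem_Icc, not_and_or, not_le, not_le] at h
    rcases abs_cases l with h' | h' <;> omega
  have hsum : ∑ᶠ l : ℤ, (-1 : ℂ) ^ l • F l + r • ∑ᶠ l : ℤ, r ^ l • F l
      = ∑ᶠ l : ℤ, ((-1 : ℂ) ^ l + r ^ (l + 1)) • F l := by
    have h1 : r • ∑ᶠ l : ℤ, r ^ l • F l = ∑ᶠ l : ℤ, r ^ (l + 1) • F l := by
      rw [smul_finsum]
      refine finsum_congr fun l => ?_
      rw [smul_smul, zpow_add_one₀ hr0, mul_comm r]
    have h2 : (Function.support fun l : ℤ => r ^ (l + 1) • F l).Finite := by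
      refine (hfin r).subset fun l hl (h : r ^ l • F l = 0) => hl ?_
      dsimp only
      rw [zpow_add_one₀ hr0, mul_comm, mul_smul, h, smul_zero]
    rw [h1, ← finsum_add_distrib (hfin _) h2]
    exact finsum_congr fun l => (add_smul _ _ _).symm
  have hL := (Filter.tendsto_add_atTop_nat 1).eventually (finsum_int_eventually
      (f := fun l : ℤ => ((-1 : ℂ) ^ l + r ^ (l + 1)) • F l) (D := D) fun l hl => by
        rw [hF l hl, smul_zero])
  filter_upwards [hL] with L hL
  rw [hsum, hL, Finset.sum_range_succ' (fun l : ℕ => ((-1 : ℂ) ^ (-1 - (l : ℤ)) + _) • _)]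
  -- the coefficient of `u⁻¹` of the difference vanishes
  have hm1 : (-1 : ℂ) ^ (-1 - ((0 : ℕ) : ℤ)) + r ^ (-1 - ((0 : ℕ) : ℤ) + 1) = 0 := by norm_num
  rw [hm1, zero_smul, add_zero, smul_add, Finset.smul_sum, Finset.smul_sum, Finset.smul_sum,
    Finset.smul_sum]
  congr 1
  · refine Finset.sum_congr rfl fun l _ => ?_
    rw [smul_smul, smul_smul, VertexData.coeff_linInv_mul_linInv hr1]
    congr 1
    norm_cast
    ring
  · refine Finset.sum_congr rfl fun l _ => ?_
    rw [smul_smul, smul_smul, VertexData.coeff_linInv_mul_linInv hr1']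
    have e1 : (-1 : ℂ) ^ (-1 - ((l + 1 : ℕ) : ℤ)) = (-1) ^ l := by
      rw [show (-1 - ((l + 1 : ℕ) : ℤ)) = -((l + 2 : ℕ) : ℤ) by push_cast; ring, zpow_neg,
        zpow_natCast, pow_add, neg_one_sq, mul_one, ← inv_pow]
      norm_num
    have e2 : r ^ (-1 - ((l + 1 : ℕ) : ℤ) + 1) = r⁻¹ ^ (l + 1) := by
      rw [show (-1 - ((l + 1 : ℕ) : ℤ) + 1) = -((l + 1 : ℕ) : ℤ) by ring, zpow_neg,
        zpow_natCast, inv_pow]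
    have e3 : (-2 - (l : ℤ)) = -1 - ((l + 1 : ℕ) : ℤ) := by push_cast; ring
    rw [e1, e2, e3, hr2]
    congr 1
    field_simp

namespace VertexData

variable {q : ℂ} {V V₁ V₂ : VertexData}

/-- The anticommutator of two vertex operators of opposite charges is a sum of two delta
functions, at `w = -z` and at `z = rw`. -/
lemma mode_anticommutator (hq : Admissible q) (hζ₁ : V₁.ζ ≠ 0) (hζ₂ : V₂.ζ ≠ 0)
    (hε : V₁.ε * V₂.ε = -1) (hε' : V₁.ε' * V₂.ε' = -1) (hp : V₁.p * V₂.p = 1) {r : ℂ}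
    (hr : V₁.ζ⁻¹ * V₂.ζ = r) (hr1 : 1 + r ≠ 0) (N M : ℤ) (μ : ℤ × ℤ)
    (p : MvPolynomial (Boson × ℕ+) ℂ) :
    (V₁.mode q N * V₂.mode q M + V₂.mode q M * V₁.mode q N) (Finsupp.single μ p)
      = (V₁.ζ⁻¹ / (1 + r)) •
        (∑ᶠ l : ℤ, (-1 : ℂ) ^ l • normalProduct q V₁ V₂ μ p (N + M + 2 - M + l) (M - l)
          + r • ∑ᶠ l : ℤ, r ^ l • normalProduct q V₁ V₂ μ p (N + M + 2 - M + l) (M - l)) := by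
  have hr0 : r ≠ 0 := hr ▸ mul_ne_zero (inv_ne_zero hζ₁) hζ₂
  have hr' : V₂.ζ⁻¹ * V₁.ζ = r⁻¹ := by rw [← hr]; field_simp
  have hd : V₁.dot V₂.charge = -2 := by simp only [dot, charge]; omega
  have h0 : ∀ r : ℂ, IsExp (((-1 : ℤ) : ℂ) • logSeries 1 + ((-1 : ℤ) : ℂ) • logSeries (-r))
      (linInv 1 1 * linInv 1 (-r)) := by
    intro r
    convert (isExp_linInv 1).mul_scalar (isExp_linInv (-r)) using 1
    simp
  have hg : IsExp (((V₁.ε * V₂.ε : ℤ) : ℂ) • logSeries (V₁.p * V₂.p)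
      + ((V₁.ε' * V₂.ε' : ℤ) : ℂ) • logSeries (-(V₁.ζ⁻¹ * V₂.ζ)))
      (linInv 1 1 * linInv 1 (-r)) := by
    rw [hε, hε', hp, hr]; exact h0 r
  have hg' : IsExp (((V₁.ε * V₂.ε : ℤ) : ℂ) • logSeries (V₁.p * V₂.p)
      + ((V₁.ε' * V₂.ε' : ℤ) : ℂ) • logSeries (-(V₂.ζ⁻¹ * V₁.ζ)))
      (linInv 1 1 * linInv 1 (-r⁻¹)) := by
    rw [hε, hε', hp, hr']; exact h0 r⁻¹
  obtain ⟨D, hD⟩ := normalProduct_eventually_eq_zero q V₁ V₂ μ p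
  have hF : ∀ l : ℤ, ((D + (|N| + |M| + 2).toNat : ℕ) : ℤ) ≤ |l| →
      normalProduct q V₁ V₂ μ p (N + M + 2 - M + l) (M - l) = 0 := by
    intro l hl
    refine hD _ _ ?_
    have h1 := neg_abs_le N
    have h2 := neg_abs_le M
    have h3 := le_abs_self N
    have h4 := le_abs_self M
    rcases abs_cases l with h | h <;> omega
  obtain ⟨L, h1, h2, h3⟩ := (((Filter.tendsto_add_atTop_nat 1).eventually
    (mode_mode_eventually hq hζ₁ hg N M μ p)).and
    ((mode_mode_swap_eventually hq hζ₂ hg' N M μ p).and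
    (sum_expansions_eq_delta hF hr0 hr1 V₁.ζ⁻¹))).exists
  have e3 : V₂.ζ⁻¹ = V₁.ζ⁻¹ * r⁻¹ := by rw [← hr]; field_simp
  rw [← h3, LinearMap.add_apply, Module.End.mul_apply, Module.End.mul_apply, h1, h2, hd, hε',
    zpow_neg_one, zpow_neg_one, e3]
  refine congrArg₂ _ (congrArg _ (Finset.sum_congr rfl fun l _ => ?_))
    (congrArg _ (Finset.sum_congr rfl fun l _ => ?_))
  · rw [show N - -2 + (l : ℤ) = N + M + 2 - M + l by ring]
  · rw [show N - (l : ℤ) = N + M + 2 - M + (-2 - l) by ring,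
      show M - -2 + (l : ℤ) = M - (-2 - l) by ring]

end VertexData

/-! ### The Cartan currents -/

lemma modeExp_congr {R : Type*} [Ring R] [Algebra ℂ R] (o : Boson → ℕ → R) {x y x' y' : ℕ → ℂ}
    (hx : ∀ n, n ≠ 0 → x n = x' n) (hy : ∀ n, n ≠ 0 → y n = y' n) :
    modeExp o x y = modeExp o x' y' := by
  have : modeSeries o x y = modeSeries o x' y' := by
    ext1 n
    simp only [modeSeries, PowerSeries.coeff_mk]
    split_ifs with hn
    · rfl
    · rw [hx n hn, hy n hn]
  rw [modeExp, modeExp, this]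

/-- The exponential of `c (q - q⁻¹) ∑_{n ≥ 1} a_{±n} u^n`. -/
def cartanExp (o : Boson → ℕ → Op) (q : ℂ) (c : ℤ) : Op⟦X⟧ :=
  modeExp o (fun _ => c * (q - q⁻¹)) 0

/-- The modes of `exp(c ((q - q⁻¹) ∑_{n ≥ 1} a_{±n} z^{∓n} + a₀ ln q))`. -/
def cartanMode (o : Boson → ℕ → Op) (q : ℂ) (c : ℤ) (n : ℕ) : Op :=
  (diag fun μ => (q ^ c) ^ μ.1) * PowerSeries.coeff n (cartanExp o q c)

lemma bosonPsiP_eq (q : ℂ) (n : ℕ) : bosonPsiP q n = cartanMode (annihilator q) q 1 n := by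
  have : (PowerSeries.mk fun k => if k = 0 then 0 else (q - q⁻¹) • osc q .a (k : ℤ))
      = modeSeries (annihilator q) (fun _ => ((1 : ℤ) : ℂ) * (q - q⁻¹)) 0 := by
    ext1 n
    simp only [modeSeries, PowerSeries.coeff_mk]
    split_ifs with hn
    · rfl
    · rw [Pi.zero_apply, zero_smul, add_zero, Int.cast_one, one_mul]; rfl
  rw [bosonPsiP, this, cartanMode, zpow_one]; rfl

lemma bosonPsiM_eq (q : ℂ) (n : ℕ) : bosonPsiM q n = cartanMode (creator q) q (-1) n := by
  have : (PowerSeries.mk fun k => if k = 0 then 0 else (-(q - q⁻¹)) • osc q .a (-(k : ℤ)))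
      = modeSeries (creator q) (fun _ => ((-1 : ℤ) : ℂ) * (q - q⁻¹)) 0 := by
    ext1 n
    simp only [modeSeries, PowerSeries.coeff_mk]
    split_ifs with hn
    · rfl
    · rw [Pi.zero_apply, zero_smul, add_zero, Int.cast_neg, Int.cast_one, neg_one_mul]; rfl
  have hd : (fun μ : ℤ × ℤ => q ^ (-μ.1)) = fun μ => (q ^ (-1 : ℤ)) ^ μ.1 := by
    funext μ; rw [zpow_neg_one, inv_zpow']
  rw [bosonPsiM, this, cartanMode, hd]; rfl

section Cartan

variable {o : Boson → ℕ → Op} {q : ℂ}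

lemma diag_commute_cartanExp (hd : ∀ f b n, n ≠ 0 → Commute (diag f) (o b n)) (c : ℤ)
    (f : ℤ × ℤ → ℂ) (n : ℕ) : Commute (diag f) (PowerSeries.coeff n (cartanExp o q c)) :=
  coeff_modeExp_commute _ _ (hd f) n

lemma cartanMode_commute (ho : ModesCommute o)
    (hd : ∀ f b n, n ≠ 0 → Commute (diag f) (o b n)) (c c' : ℤ) (n m : ℕ) :
    Commute (cartanMode o q c n) (cartanMode o q c' m) :=
  ((diag_commute _ _).mul_right (diag_commute_cartanExp hd _ _ _)).mul_left
    ((diag_commute_cartanExp hd _ _ _).symm.mul_right (modeExp_commute _ _ _ _ ho _ _))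

lemma diag_commute_cartanMode (hd : ∀ f b n, n ≠ 0 → Commute (diag f) (o b n)) (c : ℤ)
    (f : ℤ × ℤ → ℂ) (n : ℕ) : Commute (diag f) (cartanMode o q c n) :=
  (diag_commute _ _).mul_right (diag_commute_cartanExp hd _ _ _)

lemma sum_cartanMode_mul (hq0 : q ≠ 0) (ho : ModesCommute o)
    (hd : ∀ f b n, n ≠ 0 → Commute (diag f) (o b n)) {c c' : ℤ} (hc : c' = -c) (n : ℕ) :
    ∑ p ∈ antidiagonal n, cartanMode o q c p.1 * cartanMode o q c' p.2
      = PowerSeries.coeff n (1 : Op⟦X⟧) := by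
  subst hc
  have h1 : cartanExp o q c * cartanExp o q (-c) = 1 := by
    rw [cartanExp, cartanExp, modeExp_mul _ _ _ _ ho, ← modeExp_zero ho]
    refine modeExp_congr _ (fun n _ => ?_) (fun n _ => by simp)
    simp
  rw [← h1, PowerSeries.coeff_mul]
  refine Finset.sum_congr rfl fun p _ => ?_
  have h2 : (diag fun μ => (q ^ c) ^ μ.1) * (diag fun μ => (q ^ (-c)) ^ μ.1) = 1 := by
    rw [diag_mul_diag, ← diag_one]
    congr 1
    funext μ
    rw [← mul_zpow, ← zpow_add₀ hq0, add_neg_cancel, zpow_zero, one_zpow]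
  rw [cartanMode, cartanMode, mul_assoc, ← mul_assoc (PowerSeries.coeff _ _) (diag _),
    ← (diag_commute_cartanExp hd _ _ _).eq, mul_assoc, ← mul_assoc (diag _), h2, one_mul]

end Cartan

lemma isExp_cartan_cartan {q : ℂ} (hq : Admissible q) :
    IsExp (contraction (oscNorm q) (fun _ => ((1 : ℤ) : ℂ) * (q - q⁻¹)) 0
      (fun _ => ((-1 : ℤ) : ℂ) * (q - q⁻¹)) 0)
      (lin 1 (q * q) * lin 1 (q⁻¹ * q⁻¹) * linInv 1 1 * linInv 1 1) := by
  have := hq.contraction_const_const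
  simp only [Int.cast_one, Int.cast_neg, one_mul, neg_mul]
  rw [this, sub_eq_add_neg, sub_eq_add_neg]
  exact (((isExp_lin _).mul_scalar (isExp_lin _)).mul_scalar (isExp_linInv 1)).mul_scalar
    (isExp_linInv 1)

/-- The exchange relation of the two Cartan currents. -/
lemma cartanMode_exchange {q : ℂ} (hq : Admissible q) (n m : ℕ) :
    cartanMode (annihilator q) q 1 n * cartanMode (creator q) q (-1) m
      = ∑ k ∈ Finset.range (min n m + 1),
          PowerSeries.coeff k (lin 1 (q * q) * lin 1 (q⁻¹ * q⁻¹) * linInv 1 1 * linInv 1 1) •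
          (cartanMode (creator q) q (-1) (m - k) * cartanMode (annihilator q) q 1 (n - k)) := by
  have h := (conjugate_annihilator_creator q).exchange (modesCommute_annihilator q)
    (modesCommute_creator q) (isExp_cartan_cartan hq) n m
  rw [zcoeff_natCast, Finset.Nat.sum_antidiagonal_eq_sum_range_succ_mk] at h
  have hD : ∀ i j, ∀ S T : Op, (∀ f, Commute (diag f) S) → diag i * S * (diag j * T)
      = diag i * diag j * (S * T) := by
    intro i j S T hS
    rw [mul_assoc, ← mul_assoc S, ← (hS j).eq, mul_assoc, mul_assoc]
  rw [cartanMode, cartanMode, hD _ _ _ _ fun f =>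
    diag_commute_cartanExp (diag_commute_annihilator q) _ f _]
  refine (congrArg _ h).trans ?_
  rw [Finset.mul_sum]
  symm
  refine Finset.sum_subset_zero_on_sdiff (Finset.range_mono (by omega)) ?_ ?_
  · intro k hk
    have hk := Finset.mem_sdiff.mp hk
    simp only [Finset.mem_range] at hk
    rw [zcoeff_of_neg _ (by omega), zero_mul, smul_zero, mul_zero]
  · intro k hk
    have hk := Finset.mem_range.mp hk
    rw [cartanMode, cartanMode, hD _ _ _ _ fun f =>
      diag_commute_cartanExp (diag_commute_creator q) _ f _, mul_smul_comm,
      (diag_commute _ _).eq, ← Nat.cast_sub (by omega), zcoeff_natCast]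
    rfl

namespace VertexData

variable {q : ℂ} (V : VertexData)

lemma mode_apply_of_commute {t : Op} (ht : ∀ f, Commute (diag f) t)
    (ht' : ∀ ν, Commute (shift ν) t) (N : ℤ) (μ : ℤ × ℤ) (p : MvPolynomial (Boson × ℕ+) ℂ) :
    V.mode q N (t (Finsupp.single μ p)) = V.ζ ^ (V.ε' * μ.2) •
      V.oscMode q (N - V.dot μ) (t (Finsupp.single (V.charge + μ) p)) := by
  obtain ⟨p', hp'⟩ := single_of_commute ht μ p
  rw [hp', mode_single, ← shift_single, ← shift_single, ← hp', ← Module.End.mul_apply (shift _),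
    (ht' _).eq, Module.End.mul_apply]

lemma apply_mode_of_commute (t : Op) (N : ℤ) (μ : ℤ × ℤ) (p : MvPolynomial (Boson × ℕ+) ℂ) :
    t (V.mode q N (Finsupp.single μ p)) = V.ζ ^ (V.ε' * μ.2) •
      (t * V.oscMode q (N - V.dot μ)) (Finsupp.single (V.charge + μ) p) := by
  rw [mode_single, map_smul, Module.End.mul_apply]

/-- Vertex operators change the `a`-charge by `ε`. -/
lemma diag_mul_mode {x : ℂ} (hx : x ≠ 0) (N : ℤ) :
    (diag fun μ => x ^ μ.1) * V.mode q N = x ^ V.ε • (V.mode q N * diag fun μ => x ^ μ.1) := by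
  refine op_ext fun μ p => ?_
  rw [Module.End.mul_apply, apply_mode_of_commute, (V.diag_commute_oscMode q _ _).eq,
    Module.End.mul_apply, diag_single, LinearMap.smul_apply, Module.End.mul_apply, diag_single,
    map_smul, map_smul, mode_single, smul_smul, smul_smul, smul_smul]
  have : x ^ (V.charge + μ).1 = x ^ V.ε * x ^ μ.1 := by rw [← zpow_add₀ hx]; rfl
  rw [this]
  congr 1
  ring

lemma coeff_mul_mode {A : Op⟦X⟧} {g : ℂ⟦X⟧} (hg : Exchange g A (V.creation q))
    (hA : ∀ i j, Commute (PowerSeries.coeff i (V.annihilation q)) (PowerSeries.coeff j A))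
    (hd : ∀ f n, Commute (diag f) (PowerSeries.coeff n A))
    (hs : ∀ ν n, Commute (shift ν) (PowerSeries.coeff n A)) (N : ℤ) (k : ℕ) :
    PowerSeries.coeff k A * V.mode q N = ∑ p ∈ antidiagonal k, PowerSeries.coeff p.1 g •
      (V.mode q (N - p.1) * PowerSeries.coeff p.2 A) := by
  refine op_ext fun μ p => ?_
  rw [Module.End.mul_apply, apply_mode_of_commute, oscMode, coeff_mul_normalMode _ hg hA,
    LinearMap.sum_apply, LinearMap.sum_apply, Finset.smul_sum]
  refine Finset.sum_congr rfl fun i _ => ?_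
  rw [LinearMap.smul_apply, LinearMap.smul_apply, Module.End.mul_apply, Module.End.mul_apply,
    V.mode_apply_of_commute (fun f => hd f _) (fun ν => hs ν _), oscMode, smul_comm,
    show N - (i.1 : ℤ) - V.dot μ = N - V.dot μ - i.1 by ring]

lemma mode_mul_coeff {B : Op⟦X⟧} {g : ℂ⟦X⟧} (hg : Exchange g (V.annihilation q) B)
    (hB : ∀ i j, Commute (PowerSeries.coeff i (V.creation q)) (PowerSeries.coeff j B))
    (hd : ∀ f n, Commute (diag f) (PowerSeries.coeff n B))
    (hs : ∀ ν n, Commute (shift ν) (PowerSeries.coeff n B)) (N : ℤ) (k : ℕ) :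
    V.mode q N * PowerSeries.coeff k B = ∑ p ∈ antidiagonal k, PowerSeries.coeff p.1 g •
      (PowerSeries.coeff p.2 B * V.mode q (N + p.1)) := by
  refine op_ext fun μ p => ?_
  have h := normalMode_zcoeff (V.locNil_annihilation q) hg hB (N - V.dot μ) k
    (Finsupp.single (V.charge + μ) p) (L := k + 1) (by omega)
  rw [zcoeff_natCast] at h
  rw [Module.End.mul_apply, V.mode_apply_of_commute (fun f => hd f _) (fun ν => hs ν _), oscMode, h,
    LinearMap.sum_apply, Finset.Nat.sum_antidiagonal_eq_sum_range_succ_mk, Finset.smul_sum]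
  refine Finset.sum_congr rfl fun l hl => ?_
  have hl := Finset.mem_range.mp hl
  rw [LinearMap.smul_apply, Module.End.mul_apply, mode_single, map_smul, smul_comm,
    ← Nat.cast_sub (by omega), zcoeff_natCast, oscMode,
    show N + (l : ℤ) - V.dot μ = N - V.dot μ + l by ring]

/-- Conjugation of `X_N` by a current, from the exchange relation of `X` with the current. -/
lemma sum_conj_of_mul {R : Type*} [Ring R] [Algebra ℂ R] {T S : ℕ → R} {X : ℤ → R} {g : ℕ → ℂ}
    (N d : ℤ)
    (h : ∀ k, T k * X N = ∑ p ∈ antidiagonal k, g p.1 • (X (N + d * p.1) * T p.2))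
    (hTS : ∀ n, ∑ p ∈ antidiagonal n, T p.1 * S p.2 = PowerSeries.coeff n (1 : R⟦X⟧)) (n : ℕ) :
    ∑ p ∈ antidiagonal n, T p.1 * X N * S p.2 = g n • X (N + d * n) := by
  have h1 : PowerSeries.mk T * PowerSeries.C (X N)
      = PowerSeries.mk (fun k : ℕ => g k • X (N + d * k)) * PowerSeries.mk T := by
    ext1 k
    rw [PowerSeries.coeff_mul_C, PowerSeries.coeff_mk, h, PowerSeries.coeff_mul]
    simp only [PowerSeries.coeff_mk, smul_mul_assoc]
  have h2 : PowerSeries.mk T * PowerSeries.mk S = 1 := by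
    ext1 k
    rw [← hTS, PowerSeries.coeff_mul]
    simp only [PowerSeries.coeff_mk]
  have h3 := congrArg (PowerSeries.coeff n) (congrArg (· * PowerSeries.mk S) h1)
  simp only [mul_assoc _ (PowerSeries.mk T), h2, mul_one] at h3
  rw [PowerSeries.coeff_mul, PowerSeries.coeff_mk] at h3
  simpa only [PowerSeries.coeff_mul_C, PowerSeries.coeff_mk] using h3

/-- The mirror image of `sum_conj_of_mul`. -/
lemma sum_conj_of_mul' {R : Type*} [Ring R] [Algebra ℂ R] {T S : ℕ → R} {X : ℤ → R} {g : ℕ → ℂ}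
    (N d : ℤ)
    (h : ∀ k, X N * T k = ∑ p ∈ antidiagonal k, g p.1 • (T p.2 * X (N + d * p.1)))
    (hST : ∀ n, ∑ p ∈ antidiagonal n, S p.1 * T p.2 = PowerSeries.coeff n (1 : R⟦X⟧)) (n : ℕ) :
    ∑ p ∈ antidiagonal n, S p.1 * X N * T p.2 = g n • X (N + d * n) := by
  have h1 : PowerSeries.C (X N) * PowerSeries.mk T
      = PowerSeries.mk T * PowerSeries.mk (fun k : ℕ => g k • X (N + d * k)) := by
    ext1 k
    rw [PowerSeries.coeff_C_mul, PowerSeries.coeff_mk, h, PowerSeries.coeff_mul,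
      ← Finset.Nat.sum_antidiagonal_swap]
    simp only [PowerSeries.coeff_mk, mul_smul_comm, Prod.fst_swap, Prod.snd_swap]
  have h2 : PowerSeries.mk S * PowerSeries.mk T = 1 := by
    ext1 k
    rw [← hST, PowerSeries.coeff_mul]
    simp only [PowerSeries.coeff_mk]
  have h3 := congrArg (PowerSeries.coeff n) (congrArg (PowerSeries.mk S * ·) h1)
  simp only [← mul_assoc (PowerSeries.mk S) (PowerSeries.mk T), h2, one_mul] at h3
  rw [← mul_assoc, PowerSeries.coeff_mul, PowerSeries.coeff_mk] at h3
  simpa only [PowerSeries.coeff_mul_C, PowerSeries.coeff_mk] using h3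

/-- Conjugation of a vertex operator by an annihilating Cartan current. -/
lemma conj_annihilator (hq : Admissible q) (c : ℤ) {g : ℂ⟦X⟧}
    (hg : IsExp (((c : ℂ) * (V.ε : ℂ)) • (logSeries (q⁻¹ * V.p) - logSeries (q * V.p))) g)
    (N : ℤ) (n : ℕ) :
    ∑ p ∈ antidiagonal n, cartanMode (annihilator q) q c p.1 * V.mode q N *
        cartanMode (annihilator q) q (-c) p.2
      = ((q ^ c) ^ V.ε * PowerSeries.coeff n g) • V.mode q (N - n) := by
  have hE : Exchange g (cartanExp (annihilator q) q c) (V.creation q) := by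
    refine (conjugate_annihilator_creator q).exchange (modesCommute_annihilator q)
      (modesCommute_creator q) ?_
    rw [hq.contraction_const_fieldCoeff]
    exact hg
  have hx : q ^ c ≠ 0 := zpow_ne_zero _ hq.1
  have := sum_conj_of_mul (T := cartanMode (annihilator q) q c)
    (S := cartanMode (annihilator q) q (-c)) (X := V.mode q)
    (g := fun n => (q ^ c) ^ V.ε * PowerSeries.coeff n g) N (-1) (fun k => ?_)
    (sum_cartanMode_mul hq.1 (modesCommute_annihilator q) (diag_commute_annihilator q) rfl) n
  · rw [this]
    congr 2
    ring
  · rw [cartanMode, mul_assoc, V.coeff_mul_mode hE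
      (fun i j => modeExp_commute _ _ _ _ (modesCommute_annihilator q) i j)
      (fun f n => diag_commute_cartanExp (diag_commute_annihilator q) c f n)
      (fun ν n => coeff_modeExp_commute _ _ (shift_commute_annihilator q ν) n), Finset.mul_sum]
    refine Finset.sum_congr rfl fun p _ => ?_
    rw [mul_smul_comm, ← mul_assoc, V.diag_mul_mode hx, smul_mul_assoc, smul_smul,
      mul_comm (PowerSeries.coeff _ g), cartanMode, mul_assoc,
      show N + -1 * (p.1 : ℤ) = N - p.1 by ring]

/-- Conjugation of a vertex operator by a creating Cartan current. -/
lemma conj_creator (hq : Admissible q) (c : ℤ) {g : ℂ⟦X⟧}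
    (hg : IsExp (((c : ℂ) * (V.ε : ℂ)) • (logSeries (q⁻¹ * V.p) - logSeries (q * V.p))) g)
    (N : ℤ) (n : ℕ) :
    ∑ p ∈ antidiagonal n, cartanMode (creator q) q c p.1 * V.mode q N *
        cartanMode (creator q) q (-c) p.2
      = ((q ^ c) ^ V.ε * PowerSeries.coeff n g) • V.mode q (N + n) := by
  have hE : Exchange g (V.annihilation q) (cartanExp (creator q) q (-c)) := by
    refine (conjugate_annihilator_creator q).exchange (modesCommute_annihilator q)
      (modesCommute_creator q) ?_
    rw [contraction_comm, hq.contraction_const_fieldCoeff, Int.cast_neg, neg_mul_neg]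
    exact hg
  have hx : q ^ (-c) ≠ 0 := zpow_ne_zero _ hq.1
  have hx' : (q ^ c) ^ V.ε * (q ^ (-c)) ^ V.ε = 1 := by
    rw [← mul_zpow, ← zpow_add₀ hq.1, add_neg_cancel, zpow_zero, one_zpow]
  have := sum_conj_of_mul' (T := cartanMode (creator q) q (-c))
    (S := cartanMode (creator q) q c) (X := V.mode q)
    (g := fun n => (q ^ c) ^ V.ε * PowerSeries.coeff n g) N 1 (fun k => ?_)
    (sum_cartanMode_mul hq.1 (modesCommute_creator q) (diag_commute_creator q) rfl) n
  · rw [this]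
    congr 2
    ring
  · have hD : V.mode q N * (diag fun μ => (q ^ (-c)) ^ μ.1)
        = (q ^ c) ^ V.ε • ((diag fun μ => (q ^ (-c)) ^ μ.1) * V.mode q N) := by
      rw [V.diag_mul_mode hx, smul_smul, hx', one_smul]
    rw [cartanMode, ← mul_assoc, hD, smul_mul_assoc, mul_assoc, V.mode_mul_coeff hE
      (fun i j => modeExp_commute _ _ _ _ (modesCommute_creator q) i j)
      (fun f n => diag_commute_cartanExp (diag_commute_creator q) (-c) f n)
      (fun ν n => coeff_modeExp_commute _ _ (shift_commute_creator q ν) n), Finset.mul_sum,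
      Finset.smul_sum]
    refine Finset.sum_congr rfl fun p _ => ?_
    rw [mul_smul_comm, ← mul_assoc, smul_smul, cartanMode, one_mul]

end VertexData

/-- Conjugation factor of a vertex operator whose charge is aligned with the current. -/
lemma isExp_conj_pos (q p : ℂ) : IsExp ((1 : ℂ) • (logSeries (q⁻¹ * p) - logSeries (q * p)))
    (lin 1 (q⁻¹ * p) * linInv 1 (q * p)) := by
  rw [one_smul, sub_eq_add_neg]
  exact (isExp_lin _).mul_scalar (isExp_linInv _)

/-- Conjugation factor of a vertex operator whose charge is opposite to that of the current. -/
lemma isExp_conj_neg (q p : ℂ) : IsExp ((-1 : ℂ) • (logSeries (q⁻¹ * p) - logSeries (q * p)))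
    (lin 1 (q * p) * linInv 1 (q⁻¹ * p)) := by
  rw [neg_one_smul, neg_sub, sub_eq_add_neg]
  exact (isExp_lin _).mul_scalar (isExp_linInv _)

/-! ### The odd currents -/

/-- The summand `:e^{a(z;-1/2)} e^{c(q^{1/2}z)}:` of `X⁺(z)`. -/
def vertexPP (s : ℂ) : VertexData := ⟨s⁻¹, s, 1, 1⟩

/-- The summand `:e^{a(z;-1/2)} e^{-c(-q^{-1/2}z)}:` of `X⁺(z)`. -/
def vertexPM (s : ℂ) : VertexData := ⟨s⁻¹, -s⁻¹, 1, -1⟩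

/-- The summand `:e^{-a(z;1/2)} e^{c(-q^{1/2}z)}:` of `X⁻(z)`. -/
def vertexMP (s : ℂ) : VertexData := ⟨s, -s, -1, 1⟩

/-- The summand `:e^{-a(z;1/2)} e^{-c(q^{-1/2}z)}:` of `X⁻(z)`. -/
def vertexMM (s : ℂ) : VertexData := ⟨s, s⁻¹, -1, -1⟩

/-- The mode `X⁺_n`, as an operator. -/
def xPlus (q s : ℂ) (n : ℤ) : Op :=
  (s + s⁻¹) • ((vertexPP s).mode q (-n - 1) + (vertexPM s).mode q (-n - 1))

/-- The mode `X⁻_n`, as an operator. -/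
def xMinus (q s : ℂ) (n : ℤ) : Op :=
  (-(q - q⁻¹)⁻¹) • ((vertexMP s).mode q (-n - 1) + (vertexMM s).mode q (-n - 1))

lemma xPlus_apply (q s : ℂ) (n : ℤ) (v : Fock) : xPlus q s n v = bosonXp q s n v := by
  have h1 := (vertexPP s).vertex_eq_mode q (-n - 1) v
  have h2 := (vertexPM s).vertex_eq_mode q (-n - 1) v
  rw [xPlus, LinearMap.smul_apply, LinearMap.add_apply, ← h1, ← h2]
  simp only [vertexPP, vertexPM]
  rfl

lemma xMinus_apply (q s : ℂ) (n : ℤ) (v : Fock) : xMinus q s n v = bosonXm q s n v := by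
  have h1 := (vertexMP s).vertex_eq_mode q (-n - 1) v
  have h2 := (vertexMM s).vertex_eq_mode q (-n - 1) v
  rw [xMinus, LinearMap.smul_apply, LinearMap.add_apply, ← h1, ← h2]
  rfl

section Relations

variable {q s : ℂ}

/-- The quadratic relation of a sum of two vertex operators, from the relations of its summands. -/
lemma quadratic_of_pair {A B : ℤ → Op} {κ : ℂ} (t : ℂ) {N M : ℤ}
    (hA : A (N - 1) * A M + κ • (A N * A (M - 1)) + (κ • (A M * A (N - 1)) + A (M - 1) * A N) = 0)
    (hB : B (N - 1) * B M + κ • (B N * B (M - 1)) + (κ • (B M * B (N - 1)) + B (M - 1) * B N) = 0)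
    (h : ∀ N M, A (N - 1) * B M + κ • (A N * B (M - 1))
      + (κ • (B M * A (N - 1)) + B (M - 1) * A N) = 0) :
    (t • (A (N - 1) + B (N - 1))) * (t • (A M + B M))
      + κ • ((t • (A N + B N)) * (t • (A (M - 1) + B (M - 1))))
      + (κ • ((t • (A M + B M)) * (t • (A (N - 1) + B (N - 1))))
        + (t • (A (M - 1) + B (M - 1))) * (t • (A N + B N))) = 0 := by
  have h1 := h N M
  have h2 := h M N
  have : (t * t) • ((A (N - 1) * A M + κ • (A N * A (M - 1))
        + (κ • (A M * A (N - 1)) + A (M - 1) * A N))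
      + (B (N - 1) * B M + κ • (B N * B (M - 1)) + (κ • (B M * B (N - 1)) + B (M - 1) * B N))
      + (A (N - 1) * B M + κ • (A N * B (M - 1)) + (κ • (B M * A (N - 1)) + B (M - 1) * A N))
      + (A (M - 1) * B N + κ • (A M * B (N - 1)) + (κ • (B N * A (M - 1)) + B (N - 1) * A M)))
      = 0 := by
    rw [hA, hB, h1, h2, add_zero, add_zero, add_zero, smul_zero]
  rw [← this]
  simp only [smul_mul_smul_comm, mul_add, add_mul, smul_add, smul_comm κ (t * t)]
  abel

lemma xPlus_quadratic (hq : Admissible q) (hs : s ^ 2 = q) (n m : ℤ) :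
    xPlus q s (n + 1) * xPlus q s m + q • (xPlus q s n * xPlus q s (m + 1))
      + (q • (xPlus q s m * xPlus q s (n + 1)) + xPlus q s (m + 1) * xPlus q s n) = 0 := by
  have hs0 : s ≠ 0 := by rintro rfl; exact hq.1 (by rw [← hs]; norm_num)
  have hp : s⁻¹ * s⁻¹ = q⁻¹ := by rw [← hs, sq, mul_inv]
  simp only [xPlus, show ∀ n : ℤ, -(n + 1) - 1 = (-n - 1) - 1 by intro n; ring]
  refine quadratic_of_pair (A := (vertexPP s).mode q) (B := (vertexPM s).mode q) _ ?_ ?_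
    fun N M => ?_
  · exact VertexData.mode_quadratic_self hq hs0 (by norm_num [vertexPP]) (by norm_num [vertexPP])
      hq.1 hp _ _
  · exact VertexData.mode_quadratic_self hq (neg_ne_zero.mpr (inv_ne_zero hs0))
      (by norm_num [vertexPM]) (by norm_num [vertexPM]) hq.1 hp _ _
  · refine VertexData.mode_quadratic_pair hq hs0 (neg_ne_zero.mpr (inv_ne_zero hs0))
      (by norm_num [vertexPM, vertexPP]) (by norm_num [vertexPM, vertexPP]) hq.1 hp ?_ _ _
    simp only [vertexPP, vertexPM, ← hs]
    field_simp

lemma xMinus_quadratic (hq : Admissible q) (hs : s ^ 2 = q) (n m : ℤ) :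
    xMinus q s (n + 1) * xMinus q s m + q⁻¹ • (xMinus q s n * xMinus q s (m + 1))
      + (q⁻¹ • (xMinus q s m * xMinus q s (n + 1)) + xMinus q s (m + 1) * xMinus q s n) = 0 := by
  have hs0 : s ≠ 0 := by rintro rfl; exact hq.1 (by rw [← hs]; norm_num)
  have hp : s * s = q⁻¹⁻¹ := by rw [← hs, sq, inv_inv]
  simp only [xMinus, add_comm ((vertexMP s).mode q _),
    show ∀ n : ℤ, -(n + 1) - 1 = (-n - 1) - 1 by intro n; ring]
  refine quadratic_of_pair (A := (vertexMM s).mode q) (B := (vertexMP s).mode q) _ ?_ ?_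
    fun N M => ?_
  · exact VertexData.mode_quadratic_self hq (inv_ne_zero hs0) (by norm_num [vertexMM])
      (by norm_num [vertexMM]) (inv_ne_zero hq.1) hp _ _
  · exact VertexData.mode_quadratic_self hq (neg_ne_zero.mpr hs0)
      (by norm_num [vertexMP]) (by norm_num [vertexMP]) (inv_ne_zero hq.1) hp _ _
  · refine VertexData.mode_quadratic_pair hq (inv_ne_zero hs0) (neg_ne_zero.mpr hs0)
      (by norm_num [vertexMM, vertexMP]) (by norm_num [vertexMM, vertexMP]) (inv_ne_zero hq.1)
      hp ?_ _ _
    simp only [vertexMP, vertexMM, ← hs]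
    field_simp

lemma normalMode_congr {M : Type*} [AddCommGroup M] [Module ℂ M]
    {B A B' A' : (Module.End ℂ M)⟦X⟧} (hB : B = B') (hA : A = A') (h : LocNil A)
    (h' : LocNil A') (n : ℤ) : normalMode B A h n = normalMode B' A' h' n := by
  subst hB hA; rfl

lemma fieldCoeff_add_neg (q e t : ℂ) : fieldCoeff q e t + fieldCoeff q (-e) t = 0 := by
  funext n
  simp only [Pi.add_apply, fieldCoeff, Pi.zero_apply]
  ring

lemma fieldCoeff_neg_add (q e t : ℂ) : fieldCoeff q (-e) t + fieldCoeff q e t = 0 := by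
  rw [add_comm, fieldCoeff_add_neg]

/-- The difference of two `a`-fields at points in the ratio `q²` is a Cartan field. -/
lemma fieldCoeff_sub_eq (hq : Admissible q) (hs : s ^ 2 = q) (e : ℂ) {n : ℕ} (hn : n ≠ 0) :
    (fieldCoeff q (-e) s⁻¹ + fieldCoeff q e (q * s)) n = s ^ n * (e * (q - q⁻¹)) := by
  have hs0 : s ≠ 0 := by rintro rfl; exact hq.1 (by rw [← hs]; norm_num)
  have h := hq.qInt_ne_zero hn
  have h' : (q - q⁻¹) * qInt q n = q ^ n - (q ^ n)⁻¹ := by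
    rw [qInt, mul_div_cancel₀ _ hq.sub_inv_ne_zero]; simp
  simp only [Pi.add_apply, fieldCoeff]
  rw [← add_div, div_eq_iff h, mul_assoc, mul_assoc, h', ← hs]
  have := mul_inv_cancel₀ (pow_ne_zero n hs0)
  rw [mul_pow, inv_pow, ← pow_mul, pow_mul', sq, mul_inv]
  linear_combination e * (s ^ n)⁻¹ * this

/-- The value of the Cartan series at the point `s z`. -/
lemma zcoeff_modeExp_cartan {o : Boson → ℕ → Op} (ho : ModesCommute o) {x : ℕ → ℂ} {y : ℕ → ℂ}
    {c : ℤ} (hx : ∀ n, n ≠ 0 → x n = s ^ n * ((c : ℂ) * (q - q⁻¹))) (hy : y = 0) (n : ℤ) :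
    zcoeff (modeExp o x y) n = s ^ n • zcoeff (cartanExp o q c) n := by
  refine zcoeff_of_coeff_eq_smul (fun k => ?_) n
  rw [modeExp_congr o hx (fun n _ => congrFun hy n), cartanExp,
    ← coeff_modeExp_rescale _ _ ho]
  refine congrArg _ (modeExp_congr o (fun n _ => rfl) fun n _ => ?_)
  simp

/-- The modes of the exponential of the oscillators in which the poles at `z = -w` of the two
mixed products coincide. -/
def poleMode (q s : ℂ) (T : ℤ) : Op :=
  normalMode
    (modeExp (creator q) (fieldCoeff q 1 s⁻¹ + fieldCoeff q (-1) (-s))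
      (fieldCoeff q 1 s + fieldCoeff q (-1) (-s⁻¹)))
    (modeExp (annihilator q) (fieldCoeff q (-1) s⁻¹ + fieldCoeff q 1 (-s))
      (fieldCoeff q (-1) s⁻¹ + fieldCoeff q 1 (-s)))
    (locNil_modeExp q _ _) T

lemma anticommutator_PP_MM (hq : Admissible q) (hs : s ^ 2 = q) (N M : ℤ) (μ : ℤ × ℤ)
    (p : MvPolynomial (Boson × ℕ+) ℂ) :
    ((vertexPP s).mode q N * (vertexMM s).mode q M + (vertexMM s).mode q M * (vertexPP s).mode q N)
        (Finsupp.single μ p)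
      = (s + s⁻¹)⁻¹ • (((-1 : ℂ) ^ (M + μ.1 + μ.2) * q ^ μ.2) •
          poleMode q s (N + M + 2) (Finsupp.single μ p)
        + (q ^ (-1 - M - μ.1) * s ^ (N + M + 2)) •
          zcoeff (cartanExp (creator q) q (-1)) (N + M + 2) (Finsupp.single μ p)) := by
  have hs0 : s ≠ 0 := by rintro rfl; exact hq.1 (by rw [← hs]; norm_num)
  have hq0 := hq.1
  have h1q := hq.one_add_ne_zero
  have hr : s⁻¹ * s⁻¹ = q⁻¹ := by rw [← hs, sq, mul_inv]
  have hr1 : 1 + q⁻¹ ≠ 0 := by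
    rw [show 1 + q⁻¹ = (1 + q) * q⁻¹ by field_simp; ring]
    exact mul_ne_zero h1q (inv_ne_zero hq0)
  have h1 : ∑ᶠ l : ℤ, (-1 : ℂ) ^ l •
      VertexData.normalProduct q (vertexPP s) (vertexMM s) μ p (N + M + 2 - M + l) (M - l)
      = ((-1 : ℂ) ^ (M + μ.1 + μ.2) * q ^ μ.2) •
        poleMode q s (N + M + 2) (Finsupp.single μ p) := by
    rw [VertexData.finsum_normalProduct rfl rfl (neg_ne_zero.mpr one_ne_zero)]
    simp only [vertexPP, vertexMM, VertexData.dot, Int.cast_one, one_mul, inv_inv, hr, inv_neg,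
      inv_one, neg_mul]
    rw [inv_zpow', neg_neg, ← add_assoc]
    rfl
  have h2 : ∑ᶠ l : ℤ, (q⁻¹ : ℂ) ^ l •
      VertexData.normalProduct q (vertexPP s) (vertexMM s) μ p (N + M + 2 - M + l) (M - l)
      = (q ^ (-M - μ.1) * s ^ (N + M + 2)) •
          zcoeff (cartanExp (creator q) q (-1)) (N + M + 2) (Finsupp.single μ p) := by
    rw [VertexData.finsum_normalProduct rfl rfl (inv_ne_zero hq0)]
    simp only [vertexPP, vertexMM, VertexData.dot, Int.cast_one, one_mul, inv_inv, hr]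
    rw [show q * s⁻¹ = s by rw [← hs]; field_simp, fieldCoeff_add_neg,
      normalMode_congr (A' := 1) rfl ?_ _ locNil_one, normalMode_one_right,
      zcoeff_modeExp_cartan (modesCommute_creator q) (c := -1) (s := s) (q := q) ?_ rfl,
      LinearMap.smul_apply, smul_smul]
    · congr 2
      rw [inv_zpow', inv_zpow', neg_neg, ← zpow_add₀ hq0]
      congr 1
      ring
    · intro n hn
      have := fieldCoeff_sub_eq hq hs (-1) hn
      rw [neg_neg] at this
      rw [this, Int.cast_neg, Int.cast_one]
    · rw [show q⁻¹ * s = s⁻¹ by rw [← hs]; field_simp, fieldCoeff_neg_add,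
        modeExp_zero (modesCommute_annihilator q)]
  have e1 : s⁻¹ / (1 + q⁻¹) = (s + s⁻¹)⁻¹ := by
    rw [← hs]; field_simp
  have e2 : q⁻¹ * q ^ (-M - μ.1) = q ^ (-1 - M - μ.1) := by
    rw [← zpow_neg_one, ← zpow_add₀ hq0]
    congr 1
    ring
  rw [VertexData.mode_anticommutator (V₁ := vertexPP s) (V₂ := vertexMM s) hq hs0
    (inv_ne_zero hs0) (by norm_num [vertexPP, vertexMM]) (by norm_num [vertexPP, vertexMM])
    (inv_mul_cancel₀ hs0) hr hr1, h1, h2, smul_smul q⁻¹, ← mul_assoc, e2,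
    show (vertexPP s).ζ⁻¹ = s⁻¹ from rfl, e1]

lemma anticommutator_PM_MP (hq : Admissible q) (hs : s ^ 2 = q) (N M : ℤ) (μ : ℤ × ℤ)
    (p : MvPolynomial (Boson × ℕ+) ℂ) :
    ((vertexPM s).mode q N * (vertexMP s).mode q M + (vertexMP s).mode q M * (vertexPM s).mode q N)
        (Finsupp.single μ p)
      = -(s + s⁻¹)⁻¹ • (((-1 : ℂ) ^ (M + μ.1 + μ.2) * q ^ μ.2) •
          poleMode q s (N + M + 2) (Finsupp.single μ p)
        + (q ^ (1 + M + μ.1) * s ^ (-(N + M + 2))) •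
          zcoeff (cartanExp (annihilator q) q 1) (-(N + M + 2)) (Finsupp.single μ p)) := by
  have hs0 : s ≠ 0 := by rintro rfl; exact hq.1 (by rw [← hs]; norm_num)
  have hq0 := hq.1
  have h1q := hq.one_add_ne_zero
  have hr : (-s⁻¹)⁻¹ * (-s) = q := by rw [← hs]; field_simp
  have h1 : ∑ᶠ l : ℤ, (-1 : ℂ) ^ l •
      VertexData.normalProduct q (vertexPM s) (vertexMP s) μ p (N + M + 2 - M + l) (M - l)
      = ((-1 : ℂ) ^ (M + μ.1 + μ.2) * q ^ μ.2) •
        poleMode q s (N + M + 2) (Finsupp.single μ p) := by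
    rw [VertexData.finsum_normalProduct rfl rfl (neg_ne_zero.mpr one_ne_zero)]
    have e : (-1 : ℂ) ^ (M + (μ.1 + -μ.2)) = (-1) ^ (M + μ.1 + μ.2) := by
      rw [show M + μ.1 + μ.2 = M + (μ.1 + -μ.2) + 2 * μ.2 by ring,
        zpow_add₀ (neg_ne_zero.mpr one_ne_zero) (M + _), zpow_mul]
      norm_num
    simp only [vertexPM, vertexMP, VertexData.dot, Int.cast_one, Int.cast_neg, one_mul, hr, e,
      neg_mul, neg_neg]
    simp only [inv_neg, inv_inv, inv_one, mul_neg, neg_mul, neg_neg, one_mul,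
      add_comm (fieldCoeff q (-1) (-s⁻¹)), add_comm (fieldCoeff q 1 (-s))]
    rfl
  have h2 : ∑ᶠ l : ℤ, q ^ l •
      VertexData.normalProduct q (vertexPM s) (vertexMP s) μ p (N + M + 2 - M + l) (M - l)
      = (q ^ (M + μ.1) * s ^ (-(N + M + 2))) •
          zcoeff (cartanExp (annihilator q) q 1) (-(N + M + 2)) (Finsupp.single μ p) := by
    rw [VertexData.finsum_normalProduct rfl rfl hq0]
    have e1 : q⁻¹ * s = s⁻¹ := by rw [← hs]; field_simp
    have e2 : q⁻¹ * -s = -s⁻¹ := by rw [mul_neg, e1]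
    have e3 : q * (-s)⁻¹ = (-s⁻¹)⁻¹ := by rw [← hs]; field_simp
    simp only [vertexPM, vertexMP, VertexData.dot, Int.cast_one, Int.cast_neg, one_mul, hr, e1, e2,
      e3, neg_neg, fieldCoeff_add_neg, fieldCoeff_neg_add]
    rw [normalMode_congr (B' := 1) (modeExp_zero (modesCommute_creator q)) rfl _
        (locNil_modeExp q _ _), normalMode_one_left,
      zcoeff_modeExp_cartan (modesCommute_annihilator q) (c := 1) (s := s) (q := q) ?_ rfl,
      LinearMap.smul_apply, smul_smul]
    · congr 2
      rw [← zpow_add₀ hq0]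
      congr 1
      ring
    · intro n hn
      rw [fieldCoeff_sub_eq hq hs 1 hn, Int.cast_one]
  have e1 : (-s⁻¹)⁻¹ / (1 + q) = -(s + s⁻¹)⁻¹ := by
    rw [← hs]; field_simp; rw [add_comm]
  rw [VertexData.mode_anticommutator (V₁ := vertexPM s) (V₂ := vertexMP s) hq
    (neg_ne_zero.mpr (inv_ne_zero hs0)) (neg_ne_zero.mpr hs0)
    (by norm_num [vertexPM, vertexMP]) (by norm_num [vertexPM, vertexMP])
    (inv_mul_cancel₀ hs0) hr h1q, h1, h2, smul_smul q, ← mul_assoc,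
    ← zpow_one_add₀ hq0, show (vertexPM s).ζ⁻¹ = (-s⁻¹)⁻¹ from rfl, e1, ← add_assoc]

/-- The anticommutator of `X⁺_n` and `X⁻_m`. The poles at `z = -w` of the two mixed products
cancel. -/
lemma xPlus_xMinus (hq : Admissible q) (hs : s ^ 2 = q) (n m : ℤ) :
    xPlus q s n * xMinus q s m + xMinus q s m * xPlus q s n
      = (q - q⁻¹)⁻¹ • (s ^ (n - m) •
          ((diag fun μ => q ^ μ.1) * zcoeff (cartanExp (annihilator q) q 1) (n + m))
        - s ^ (m - n) •
          ((diag fun μ => (q ^ (-1 : ℤ)) ^ μ.1) *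
            zcoeff (cartanExp (creator q) q (-1)) (-(n + m)))) := by
  have hs0 : s ≠ 0 := by rintro rfl; exact hq.1 (by rw [← hs]; norm_num)
  have hq0 := hq.1
  have h1q := hq.one_add_ne_zero
  have hF : s + s⁻¹ ≠ 0 := by
    rw [show s + s⁻¹ = (1 + q) * s⁻¹ by rw [← hs]; field_simp; ring]
    exact mul_ne_zero h1q (inv_ne_zero hs0)
  refine op_ext fun μ p => ?_
  have hPP : (vertexPP s).mode q (-n - 1) * (vertexMP s).mode q (-m - 1)
      + (vertexMP s).mode q (-m - 1) * (vertexPP s).mode q (-n - 1) = 0 :=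
    VertexData.mode_anticomm hq hs0 (by norm_num [vertexPP, vertexMP])
      (by norm_num [vertexPP, vertexMP]) (inv_mul_cancel₀ hs0) rfl _ _
  have hMM : (vertexPM s).mode q (-n - 1) * (vertexMM s).mode q (-m - 1)
      + (vertexMM s).mode q (-m - 1) * (vertexPM s).mode q (-n - 1) = 0 :=
    VertexData.mode_anticomm hq (neg_ne_zero.mpr (inv_ne_zero hs0))
      (by norm_num [vertexPM, vertexMM]) (by norm_num [vertexPM, vertexMM])
      (inv_mul_cancel₀ hs0) (neg_neg _).symm _ _
  have h1 := anticommutator_PP_MM hq hs (-n - 1) (-m - 1) μ p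
  have h2 := anticommutator_PM_MP hq hs (-n - 1) (-m - 1) μ p
  have hexp : xPlus q s n * xMinus q s m + xMinus q s m * xPlus q s n
      = ((s + s⁻¹) * -(q - q⁻¹)⁻¹) •
        (((vertexPP s).mode q (-n - 1) * (vertexMP s).mode q (-m - 1)
          + (vertexMP s).mode q (-m - 1) * (vertexPP s).mode q (-n - 1))
        + ((vertexPM s).mode q (-n - 1) * (vertexMM s).mode q (-m - 1)
          + (vertexMM s).mode q (-m - 1) * (vertexPM s).mode q (-n - 1))
        + (((vertexPP s).mode q (-n - 1) * (vertexMM s).mode q (-m - 1)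
          + (vertexMM s).mode q (-m - 1) * (vertexPP s).mode q (-n - 1))
        + ((vertexPM s).mode q (-n - 1) * (vertexMP s).mode q (-m - 1)
          + (vertexMP s).mode q (-m - 1) * (vertexPM s).mode q (-n - 1)))) := by
    simp only [xPlus, xMinus, smul_mul_smul_comm, mul_comm (-(q - q⁻¹)⁻¹) (s + s⁻¹), ← smul_add]
    congr 1
    simp only [mul_add, add_mul]
    abel
  have hd : ∀ (x : ℂ) (Z : Op), (∀ f, Commute (diag f) Z) →
      ((diag fun μ => x ^ μ.1) * Z) (Finsupp.single μ p) = x ^ μ.1 • Z (Finsupp.single μ p) := by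
    intro x Z hZ
    rw [(hZ _).eq, Module.End.mul_apply, diag_single, map_smul]
  rw [hexp, hPP, hMM, add_zero, zero_add, LinearMap.smul_apply, LinearMap.add_apply, h1, h2,
    LinearMap.smul_apply, LinearMap.sub_apply, LinearMap.smul_apply, LinearMap.smul_apply,
    hd _ _ fun f => (zcoeff_commute fun i =>
      diag_commute_cartanExp (diag_commute_annihilator q) 1 f i) _,
    hd _ _ fun f => (zcoeff_commute fun i =>
      diag_commute_cartanExp (diag_commute_creator q) (-1) f i) _]
  have eT : (-n - 1 + (-m - 1) + 2 : ℤ) = -(n + m) := by ring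
  rw [eT, neg_neg]
  have e1 : q ^ (-1 - (-m - 1) - μ.1) * s ^ (-(n + m)) = s ^ (m - n) * (q ^ (-1 : ℤ)) ^ μ.1 := by
    rw [← zpow_mul, ← hs, ← zpow_natCast s 2, ← zpow_mul, ← zpow_mul, ← zpow_add₀ hs0,
      ← zpow_add₀ hs0]
    congr 1
    push_cast
    ring
  have e2 : q ^ (1 + (-m - 1) + μ.1) * s ^ (n + m) = s ^ (n - m) * q ^ μ.1 := by
    rw [← hs, ← zpow_natCast s 2, ← zpow_mul, ← zpow_mul, ← zpow_add₀ hs0,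
      ← zpow_add₀ hs0]
    congr 1
    push_cast
    ring
  rw [e1, e2]
  clear hexp hPP hMM h1 h2 e1 e2
  generalize s + s⁻¹ = F at hF ⊢
  generalize (q - q⁻¹)⁻¹ = Q
  match_scalars <;> field_simp
  ring

end Relations

/-! ### The representation -/

section Expansions

variable {R S : Type*} [Ring R] [Ring S]

lemma map_lin (f : R →+* S) (a b : R) : PowerSeries.map f (lin a b) = lin (f a) (f b) := by
  ext n
  rw [PowerSeries.coeff_map, lin, lin, PowerSeries.coeff_mk, PowerSeries.coeff_mk]
  split_ifs <;> simp

lemma map_linInv (f : R →+* S) (a b : R) :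
    PowerSeries.map f (linInv a b) = linInv (f a) (f b) := by
  ext n
  simp [linInv]

end Expansions

variable {q s : ℂ}

section Conj

lemma ne_zero_of_sq_eq (hq : Admissible q) (hs : s ^ 2 = q) : s ≠ 0 := by
  rintro rfl
  exact hq.1 (by rw [← hs, zero_pow two_ne_zero])

/-- A sum of two vertex operators that are conjugated in the same way. -/
lemma sum_conj_add {S T : ℕ → Op} {n : ℕ} {X Y X' Y' : Op} {x : ℂ} (t : ℂ)
    (hX : ∑ p ∈ antidiagonal n, S p.1 * X * T p.2 = x • X')
    (hY : ∑ p ∈ antidiagonal n, S p.1 * Y * T p.2 = x • Y') :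
    ∑ p ∈ antidiagonal n, S p.1 * (t • (X + Y)) * T p.2 = x • (t • (X' + Y')) := by
  simp only [mul_smul_comm, smul_mul_assoc, mul_add, add_mul, ← Finset.smul_sum,
    Finset.sum_add_distrib, hX, hY]
  rw [← smul_add, smul_comm]

lemma psiP_conj_xPlus (hq : Admissible q) (hs : s ^ 2 = q) (n : ℕ) (m : ℤ) :
    ∑ p ∈ antidiagonal n, cartanMode (annihilator q) q (-1) p.1 * xPlus q s m *
        cartanMode (annihilator q) q 1 p.2
      = PowerSeries.coeff n (lin s q * linInv (s⁻¹ * q⁻¹) 1) • xPlus q s (m + n) := by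
  have hs0 := ne_zero_of_sq_eq hq hs
  have hg : lin s q * linInv (s⁻¹ * q⁻¹) 1 = q⁻¹ • (lin 1 (q * s⁻¹) * linInv 1 (q⁻¹ * s⁻¹)) := by
    rw [lin_eq_smul hs0, linInv_eq_smul, smul_mul_smul_comm, mul_inv_cancel_left₀ hs0, mul_one,
      mul_comm s⁻¹ q, mul_comm s⁻¹ q⁻¹]
  rw [hg, xPlus, xPlus, show -(m + (n : ℤ)) - 1 = -m - 1 - n by ring]
  refine sum_conj_add _ ?_ ?_
  · convert (vertexPP s).conj_annihilator hq (-1) (g := lin 1 (q * s⁻¹) * linInv 1 (q⁻¹ * s⁻¹))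
      ?_ (-m - 1) n using 2
    · rw [neg_neg]
    · simp [vertexPP]
    · convert isExp_conj_neg q s⁻¹ using 2 <;> simp [vertexPP]
  · convert (vertexPM s).conj_annihilator hq (-1) (g := lin 1 (q * s⁻¹) * linInv 1 (q⁻¹ * s⁻¹))
      ?_ (-m - 1) n using 2
    · rw [neg_neg]
    · simp [vertexPM]
    · convert isExp_conj_neg q s⁻¹ using 2 <;> simp [vertexPM]

lemma psiP_conj_xMinus (hq : Admissible q) (hs : s ^ 2 = q) (n : ℕ) (m : ℤ) :
    ∑ p ∈ antidiagonal n, cartanMode (annihilator q) q 1 p.1 * xMinus q s m *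
        cartanMode (annihilator q) q (-1) p.2
      = PowerSeries.coeff n (lin s⁻¹ q * linInv (s * q⁻¹) 1) • xMinus q s (m + n) := by
  have hs0 := ne_zero_of_sq_eq hq hs
  have hg : lin s⁻¹ q * linInv (s * q⁻¹) 1 = q⁻¹ • (lin 1 (q * s) * linInv 1 (q⁻¹ * s)) := by
    rw [lin_eq_smul (inv_ne_zero hs0), linInv_eq_smul, smul_mul_smul_comm,
      inv_mul_cancel_left₀ hs0, mul_one, inv_inv, mul_comm s q, mul_comm s q⁻¹]
  rw [hg, xMinus, xMinus, show -(m + (n : ℤ)) - 1 = -m - 1 - n by ring]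
  refine sum_conj_add _ ?_ ?_
  · convert (vertexMP s).conj_annihilator hq 1 (g := lin 1 (q * s) * linInv 1 (q⁻¹ * s))
      ?_ (-m - 1) n using 2
    · simp [vertexMP]
    · convert isExp_conj_neg q s using 2 <;> simp [vertexMP]
  · convert (vertexMM s).conj_annihilator hq 1 (g := lin 1 (q * s) * linInv 1 (q⁻¹ * s))
      ?_ (-m - 1) n using 2
    · simp [vertexMM]
    · convert isExp_conj_neg q s using 2 <;> simp [vertexMM]

lemma psiM_conj_xPlus (hq : Admissible q) (hs : s ^ 2 = q) (n : ℕ) (m : ℤ) :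
    ∑ p ∈ antidiagonal n, cartanMode (creator q) q 1 p.1 * xPlus q s m *
        cartanMode (creator q) q (-1) p.2
      = PowerSeries.coeff n (lin q s⁻¹ * linInv 1 (s⁻¹ * q)) • xPlus q s (m - n) := by
  have hs0 := ne_zero_of_sq_eq hq hs
  have hg : lin q s⁻¹ * linInv 1 (s⁻¹ * q) = q • (lin 1 (q⁻¹ * s⁻¹) * linInv 1 (q * s⁻¹)) := by
    rw [lin_eq_smul hq.1, smul_mul_assoc, mul_comm s⁻¹ q]
  rw [hg, xPlus, xPlus, show -(m - (n : ℤ)) - 1 = -m - 1 + n by ring]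
  refine sum_conj_add _ ?_ ?_
  · convert (vertexPP s).conj_creator hq 1 (g := lin 1 (q⁻¹ * s⁻¹) * linInv 1 (q * s⁻¹))
      ?_ (-m - 1) n using 2
    · simp [vertexPP]
    · convert isExp_conj_pos q s⁻¹ using 2 <;> simp [vertexPP]
  · convert (vertexPM s).conj_creator hq 1 (g := lin 1 (q⁻¹ * s⁻¹) * linInv 1 (q * s⁻¹))
      ?_ (-m - 1) n using 2
    · simp [vertexPM]
    · convert isExp_conj_pos q s⁻¹ using 2 <;> simp [vertexPM]

lemma psiM_conj_xMinus (hq : Admissible q) (n : ℕ) (m : ℤ) :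
    ∑ p ∈ antidiagonal n, cartanMode (creator q) q (-1) p.1 * xMinus q s m *
        cartanMode (creator q) q 1 p.2
      = PowerSeries.coeff n (lin q s * linInv 1 (s * q)) • xMinus q s (m - n) := by
  have hg : lin q s * linInv 1 (s * q) = q • (lin 1 (q⁻¹ * s) * linInv 1 (q * s)) := by
    rw [lin_eq_smul hq.1, smul_mul_assoc, mul_comm s q]
  rw [hg, xMinus, xMinus, show -(m - (n : ℤ)) - 1 = -m - 1 + n by ring]
  refine sum_conj_add _ ?_ ?_
  · convert (vertexMP s).conj_creator hq (-1) (g := lin 1 (q⁻¹ * s) * linInv 1 (q * s))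
      ?_ (-m - 1) n using 2
    · rw [neg_neg]
    · simp [vertexMP]
    · convert isExp_conj_pos q s using 2 <;> simp [vertexMP]
  · convert (vertexMM s).conj_creator hq (-1) (g := lin 1 (q⁻¹ * s) * linInv 1 (q * s))
      ?_ (-m - 1) n using 2
    · rw [neg_neg]
    · simp [vertexMM]
    · convert isExp_conj_pos q s using 2 <;> simp [vertexMM]

end Conj

lemma cartanMode_zero {o : Boson → ℕ → Op} (ho : ModesCommute o) (q : ℂ) (c : ℤ) :
    cartanMode o q c 0 = diag fun μ => (q ^ c) ^ μ.1 := by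
  rw [cartanMode, cartanExp, (isExp_modeExp _ _ ho).coeff_zero, mul_one]

/-- The images of the generators. The modes of `ψ^±(z)⁻¹` are those of the Cartan currents with
the opposite sign in the exponent. -/
def repGen (q s : ℂ) : Gen → Op
  | .gam => algebraMap ℂ Op s
  | .gamInv => algebraMap ℂ Op s⁻¹
  | .xP n => xPlus q s n
  | .xM n => xMinus q s n
  | .psiP n => cartanMode (annihilator q) q 1 n
  | .psiM n => cartanMode (creator q) q (-1) n
  | .phiP n => cartanMode (annihilator q) q (-1) n
  | .phiM n => cartanMode (creator q) q 1 n

/-- The representation, on the free algebra. -/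
def freeRep (q s : ℂ) : FreeU →ₐ[ℂ] Op := FreeAlgebra.lift ℂ (repGen q s)

lemma freeRep_gen (g : Gen) : freeRep q s (gen g) = repGen q s g :=
  FreeAlgebra.lift_ι_apply _ _

lemma freeRep_sc (x : ℂ) : freeRep q s (sc x) = algebraMap ℂ Op x := (freeRep q s).commutes x

/-- The structure functions become scalar series, since `q^{c/2}` acts by the scalar `s`. -/
lemma freeRep_coeff {g : FreeU⟦X⟧} {g' : ℂ⟦X⟧}
    (h : PowerSeries.map (freeRep q s).toRingHom g = PowerSeries.map (algebraMap ℂ Op) g')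
    (n : ℕ) : freeRep q s (PowerSeries.coeff n g) = algebraMap ℂ Op (PowerSeries.coeff n g') := by
  have := congrArg (PowerSeries.coeff n) h
  rwa [PowerSeries.coeff_map, PowerSeries.coeff_map] at this

lemma map_freeRep_lin (a b : FreeU) : PowerSeries.map (freeRep q s).toRingHom (lin a b)
    = lin (freeRep q s a) (freeRep q s b) := map_lin (R := FreeU) (S := Op) _ a b

lemma map_freeRep_linInv (a b : FreeU) : PowerSeries.map (freeRep q s).toRingHom (linInv a b)
    = linInv (freeRep q s a) (freeRep q s b) := map_linInv (R := FreeU) (S := Op) _ a b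

lemma map_scalar_lin (a b : ℂ) : PowerSeries.map (algebraMap ℂ Op) (lin a b)
    = lin (algebraMap ℂ Op a) (algebraMap ℂ Op b) := map_lin (R := ℂ) (S := Op) _ a b

lemma map_scalar_linInv (a b : ℂ) : PowerSeries.map (algebraMap ℂ Op) (linInv a b)
    = linInv (algebraMap ℂ Op a) (algebraMap ℂ Op b) := map_linInv (R := ℂ) (S := Op) _ a b

lemma freeRep_coeff_genSeries_mul (g h : ℕ → Gen) (n : ℕ) :
    freeRep q s (PowerSeries.coeff n (genSeries g * genSeries h))
      = ∑ p ∈ antidiagonal n, repGen q s (g p.1) * repGen q s (h p.2) := by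
  simp only [PowerSeries.coeff_mul, genSeries, PowerSeries.coeff_mk, map_sum, map_mul, freeRep_gen]

lemma freeRep_coeff_one (n : ℕ) : freeRep q s (PowerSeries.coeff n (1 : FreeU⟦X⟧))
    = PowerSeries.coeff n (1 : Op⟦X⟧) := by
  rw [PowerSeries.coeff_one, PowerSeries.coeff_one]
  split_ifs <;> simp

lemma freeRep_gamPow (j : ℤ) : freeRep q s (gamPow j) = algebraMap ℂ Op (s ^ j) := by
  rw [gamPow]
  split_ifs with h
  · rw [map_pow, freeRep_gen, repGen, ← map_pow, ← zpow_natCast, Int.toNat_of_nonneg h]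
  · rw [map_pow, freeRep_gen, repGen, ← map_pow, ← zpow_natCast, Int.toNat_of_nonneg (by omega),
      inv_zpow', neg_neg]

lemma freeRep_psiPlusMode (k : ℤ) : freeRep q s (psiPlusMode k)
    = (diag fun μ => q ^ μ.1) * zcoeff (cartanExp (annihilator q) q 1) k := by
  rw [psiPlusMode]
  split_ifs with h
  · lift k to ℕ using h
    rw [freeRep_gen, repGen, zcoeff_natCast, cartanMode, zpow_one]; rfl
  · rw [zcoeff_of_neg _ (not_le.mp h), map_zero, mul_zero]

lemma freeRep_psiMinusMode (k : ℤ) : freeRep q s (psiMinusMode k)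
    = (diag fun μ => (q ^ (-1 : ℤ)) ^ μ.1) * zcoeff (cartanExp (creator q) q (-1)) (-k) := by
  rw [psiMinusMode]
  split_ifs with h
  · obtain ⟨l, hl⟩ := Int.eq_ofNat_of_zero_le (neg_nonneg.mpr h)
    rw [freeRep_gen, repGen, hl, zcoeff_natCast, cartanMode]; rfl
  · rw [zcoeff_of_neg _ (by omega), map_zero, mul_zero]

/-- The operators satisfy the defining relations of the algebra. -/
lemma freeRep_rel (hq : Admissible q) (hs : s ^ 2 = q) {x y : FreeU} (h : DrinfeldRel q x y) :
    freeRep q s x = freeRep q s y := by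
  have hs0 := ne_zero_of_sq_eq hq hs
  have hda := diag_commute_annihilator q
  have hdc := diag_commute_creator q
  have hma := modesCommute_annihilator q
  have hmc := modesCommute_creator q
  have hK : ∀ c : ℤ, (diag fun μ => (q ^ c) ^ μ.1) * (diag fun μ => (q ^ (-c)) ^ μ.1) = 1 := by
    intro c
    rw [diag_mul_diag, ← diag_one]
    congr 1
    funext μ
    rw [← mul_zpow, ← zpow_add₀ hq.1, add_neg_cancel, zpow_zero, one_zpow]
  have hgam : freeRep q s Γ = algebraMap ℂ Op s := freeRep_gen _
  have hgami : freeRep q s Γi = algebraMap ℂ Op s⁻¹ := freeRep_gen _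
  have hsc : ∀ x, freeRep q s (sc x) = algebraMap ℂ Op x := freeRep_sc
  cases h with
  | gam_central g =>
    rw [map_mul, map_mul, freeRep_gen, freeRep_gen]
    exact Algebra.commutes _ _
  | gam_mul_inv =>
    rw [map_mul, freeRep_gen, freeRep_gen, repGen, repGen, ← map_mul, mul_inv_cancel₀ hs0, map_one,
      map_one]
  | inv_mul_gam =>
    rw [map_mul, freeRep_gen, freeRep_gen, repGen, repGen, ← map_mul, inv_mul_cancel₀ hs0, map_one,
      map_one]
  | psiP_mul_phiP n =>
    rw [freeRep_coeff_genSeries_mul, freeRep_coeff_one]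
    exact sum_cartanMode_mul hq.1 hma hda rfl n
  | phiP_mul_psiP n =>
    rw [freeRep_coeff_genSeries_mul, freeRep_coeff_one]
    exact sum_cartanMode_mul hq.1 hma hda (neg_neg 1).symm n
  | psiM_mul_phiM n =>
    rw [freeRep_coeff_genSeries_mul, freeRep_coeff_one]
    exact sum_cartanMode_mul hq.1 hmc hdc (neg_neg 1).symm n
  | phiM_mul_psiM n =>
    rw [freeRep_coeff_genSeries_mul, freeRep_coeff_one]
    exact sum_cartanMode_mul hq.1 hmc hdc rfl n
  | K_mul_inv =>
    rw [map_mul, freeRep_gen, freeRep_gen, repGen, repGen, cartanMode_zero hma,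
      cartanMode_zero hmc, hK, map_one]
  | inv_mul_K =>
    rw [map_mul, freeRep_gen, freeRep_gen, repGen, repGen, cartanMode_zero hma,
      cartanMode_zero hmc, map_one, (diag_commute _ _).eq, hK]
  | psiP_comm n m =>
    rw [map_mul, map_mul, freeRep_gen, freeRep_gen]
    exact cartanMode_commute hma hda 1 1 n m
  | psiM_comm n m =>
    rw [map_mul, map_mul, freeRep_gen, freeRep_gen]
    exact cartanMode_commute hmc hdc (-1) (-1) n m
  | psiP_psiM n m =>
    have hg : lin (s * q) s⁻¹ * lin s⁻¹ (s * q) * linInv s⁻¹ (s⁻¹ * q) * linInv (s * q⁻¹) s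
        = lin 1 (q * q) * lin 1 (q⁻¹ * q⁻¹) * linInv 1 1 * linInv 1 1 := by
      rw [lin_eq_smul (mul_ne_zero hs0 hq.1), lin_eq_smul (inv_ne_zero hs0), linInv_eq_smul s⁻¹,
        linInv_eq_smul (s * q⁻¹), show (s * q)⁻¹ * s⁻¹ = q⁻¹ * q⁻¹ by rw [← hs]; field_simp,
        show s⁻¹⁻¹ * (s * q) = q * q by rw [← hs]; field_simp,
        show s⁻¹ * (s⁻¹ * q) = 1 by rw [← hs]; field_simp,
        show s * q⁻¹ * s = 1 by rw [← hs]; field_simp, smul_mul_smul_comm, smul_mul_smul_comm,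
        smul_mul_smul_comm, show s * q * s⁻¹ * s⁻¹ * (s * q⁻¹) = 1 by rw [← hs]; field_simp,
        one_smul, mul_comm (lin 1 (q⁻¹ * q⁻¹))]
    have hc : ∀ k, freeRep q s (PowerSeries.coeff k (gPsiPsi q)) = algebraMap ℂ Op
        (PowerSeries.coeff k (lin 1 (q * q) * lin 1 (q⁻¹ * q⁻¹) * linInv 1 1 * linInv 1 1)) := by
      refine freeRep_coeff ?_
      rw [← hg, gPsiPsi]
      simp only [map_mul, map_freeRep_lin, map_freeRep_linInv, map_scalar_lin,
        map_scalar_linInv, hgam, hgami, hsc]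
    simp only [map_mul, map_sum, freeRep_gen, hc, ← Algebra.smul_def]
    exact cartanMode_exchange hq n m
  | psiP_xP n m =>
    have hc := freeRep_coeff (q := q) (s := s) (g := gXpPsiP q)
      (g' := lin s q * linInv (s⁻¹ * q⁻¹) 1)
      (by simp only [gXpPsiP, map_mul, map_freeRep_lin, map_freeRep_linInv, map_scalar_lin,
        map_scalar_linInv, hgam, hgami, hsc, map_one]) n
    simp only [map_mul, map_sum, freeRep_gen, hc, ← Algebra.smul_def]
    exact psiP_conj_xPlus hq hs n m
  | psiM_xP n m =>
    have hc := freeRep_coeff (q := q) (s := s) (g := gXpPsiM q)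
      (g' := lin q s⁻¹ * linInv 1 (s⁻¹ * q))
      (by simp only [gXpPsiM, map_mul, map_freeRep_lin, map_freeRep_linInv, map_scalar_lin,
        map_scalar_linInv, hgami, hsc, map_one]) n
    simp only [map_mul, map_sum, freeRep_gen, hc, ← Algebra.smul_def]
    exact psiM_conj_xPlus hq hs n m
  | psiP_xM n m =>
    have hc := freeRep_coeff (q := q) (s := s) (g := gXmPsiP q)
      (g' := lin s⁻¹ q * linInv (s * q⁻¹) 1)
      (by simp only [gXmPsiP, map_mul, map_freeRep_lin, map_freeRep_linInv, map_scalar_lin,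
        map_scalar_linInv, hgam, hgami, hsc, map_one]) n
    simp only [map_mul, map_sum, freeRep_gen, hc, ← Algebra.smul_def]
    exact psiP_conj_xMinus hq hs n m
  | psiM_xM n m =>
    have hc := freeRep_coeff (q := q) (s := s) (g := gXmPsiM q)
      (g' := lin q s * linInv 1 (s * q))
      (by simp only [gXmPsiM, map_mul, map_freeRep_lin, map_freeRep_linInv, map_scalar_lin,
        map_scalar_linInv, hgam, hsc, map_one]) n
    simp only [map_mul, map_sum, freeRep_gen, hc, ← Algebra.smul_def]
    exact psiM_conj_xMinus hq n m
  | xP_xP n m =>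
    simp only [map_add, map_mul, map_smul, map_zero, freeRep_gen]
    exact xPlus_quadratic hq hs n m
  | xM_xM n m =>
    simp only [map_add, map_mul, map_smul, map_zero, freeRep_gen]
    exact xMinus_quadratic hq hs n m
  | xP_xM n m =>
    simp only [map_add, map_sub, map_mul, map_smul, freeRep_gen, freeRep_gamPow,
      freeRep_psiPlusMode, freeRep_psiMinusMode, ← Algebra.smul_def]
    exact xPlus_xMinus hq hs n m

/-- The level one representation of `U_q[osp(2|2)^{(2)}]`. -/
def rep (hq : Admissible q) (hs : s ^ 2 = q) : Uq q →ₐ[ℂ] Op :=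
  RingQuot.liftAlgHom ℂ ⟨freeRep q s, fun _ _ h => freeRep_rel hq hs h⟩

lemma rep_gen (hq : Admissible q) (hs : s ^ 2 = q) (g : Gen) :
    rep hq hs (Uq.gen q g) = repGen q s g := by
  rw [rep, Uq.gen, RingQuot.liftAlgHom_mkAlgHom_apply]
  exact freeRep_gen g

lemma parity_mul_mode (V : VertexData) (hε : V.ε = 1 ∨ V.ε = -1) (N : ℤ) :
    parity * V.mode q N = (-1 : ℂ) • (V.mode q N * parity) := by
  rw [parity, V.diag_mul_mode (neg_ne_zero.mpr one_ne_zero)]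
  have h : (-1 : ℂ) ^ V.ε = -1 := by rcases hε with h | h <;> rw [h] <;> norm_num
  rw [h]

lemma parity_mul_repGen (g : Gen) :
    parity * repGen q s g = g.sign • (repGen q s g * parity) := by
  cases g with
  | gam => exact (Algebra.commutes _ _).symm.trans (one_smul ℂ _).symm
  | gamInv => exact (Algebra.commutes _ _).symm.trans (one_smul ℂ _).symm
  | xP n =>
    rw [Gen.sign, repGen, xPlus, mul_smul_comm, mul_add, parity_mul_mode _ (Or.inl rfl),
      parity_mul_mode _ (Or.inl rfl), smul_mul_assoc, add_mul, ← smul_add, smul_comm]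
  | xM n =>
    rw [Gen.sign, repGen, xMinus, mul_smul_comm, mul_add, parity_mul_mode _ (Or.inr rfl),
      parity_mul_mode _ (Or.inr rfl), smul_mul_assoc, add_mul, ← smul_add, smul_comm]
  | psiP n =>
    exact (diag_commute_cartanMode (diag_commute_annihilator q) _ _ _).eq.trans (one_smul ℂ _).symm
  | psiM n =>
    exact (diag_commute_cartanMode (diag_commute_creator q) _ _ _).eq.trans (one_smul ℂ _).symm
  | phiP n =>
    exact (diag_commute_cartanMode (diag_commute_annihilator q) _ _ _).eq.trans (one_smul ℂ _).symm
  | phiM n =>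
    exact (diag_commute_cartanMode (diag_commute_creator q) _ _ _).eq.trans (one_smul ℂ _).symm

/-! ### The limit `q → 1` -/

/-- The leading term of a vertex operator on the vacuum. -/
lemma VertexData.mode_vac (V : VertexData) : V.mode q 0 (vac 0) = vac V.charge := by
  have h0 : V.dot 0 = 0 := by simp [VertexData.dot]
  rw [vac, V.mode_single, h0, sub_zero, Prod.snd_zero, mul_zero, zpow_zero, one_smul, add_zero,
    VertexData.oscMode, normalMode_apply (K := 1)]
  · rw [Finset.sum_range_one, Nat.cast_zero, add_zero, ← Nat.cast_zero, zcoeff_natCast,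
      VertexData.creation, VertexData.annihilation,
      (isExp_modeExp _ _ (modesCommute_creator q)).coeff_zero,
      (isExp_modeExp _ _ (modesCommute_annihilator q)).coeff_zero]
    rfl
  · intro k hk
    exact coeff_modeExp_eq_zero _ _ (fun b n hn => annihilator_vac q _ b n hn) (by omega)

lemma coeff_bosonXm_vac (q s : ℂ) :
    MvPolynomial.coeff 0 (bosonXm q s (-1) (vac 0) (-1, 1)) = -(q - q⁻¹)⁻¹ := by
  rw [← xMinus_apply, xMinus, neg_neg, sub_self, LinearMap.smul_apply, LinearMap.add_apply,
    VertexData.mode_vac, VertexData.mode_vac, Finsupp.smul_apply, Finsupp.add_apply, vac, vac,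
    show (vertexMP s).charge = (-1, 1) from rfl, show (vertexMM s).charge = (-1, -1) from rfl,
    Finsupp.single_eq_same, Finsupp.single_eq_of_ne (by decide), add_zero, MvPolynomial.coeff_smul,
    MvPolynomial.coeff_zero_one, smul_eq_mul, mul_one]

lemma admissible_of_one_lt {x : ℝ} (hx : 1 < x) : Admissible (x : ℂ) := by
  refine ⟨by exact_mod_cast (by positivity : x ≠ 0), fun n hn h => ?_⟩
  have h' : x ^ n = 1 := by exact_mod_cast h
  exact (one_lt_pow₀ hx hn.ne').ne' h'

instance neBot_admissible : (nhdsWithin (1 : ℂ) {q | Admissible q}).NeBot := by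
  rw [← mem_closure_iff_nhdsWithin_neBot]
  have h : Filter.Tendsto (fun n : ℕ => ((1 + 1 / ((n : ℝ) + 1) : ℝ) : ℂ)) Filter.atTop
      (nhds ((1 + 0 : ℝ) : ℂ)) :=
    (Complex.continuous_ofReal.tendsto _).comp
      (tendsto_one_div_add_atTop_nhds_zero_nat.const_add 1)
  rw [add_zero, Complex.ofReal_one] at h
  refine mem_closure_of_tendsto h (Filter.Eventually.of_forall fun n => ?_)
  have : 0 < 1 / ((n : ℝ) + 1) := by positivity
  exact admissible_of_one_lt (by linarith)

lemma not_tendsto_inv : ¬ ∃ L : ℂ, Filter.Tendsto (fun q : ℂ => -(q - q⁻¹)⁻¹)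
    (nhdsWithin 1 {q | Admissible q}) (nhds L) := by
  rintro ⟨L, hL⟩
  have h1 : Filter.Tendsto (fun q : ℂ => q - q⁻¹) (nhdsWithin 1 {q | Admissible q})
      (nhds (1 - 1⁻¹)) :=
    ((continuousAt_id.sub (continuousAt_inv₀ one_ne_zero)).tendsto).mono_left nhdsWithin_le_nhds
  rw [inv_one, sub_self] at h1
  have h2 := hL.mul h1
  rw [mul_zero] at h2
  have h3 : Filter.Tendsto (fun q : ℂ => -(q - q⁻¹)⁻¹ * (q - q⁻¹))
      (nhdsWithin 1 {q | Admissible q}) (nhds (-1)) := by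
    refine tendsto_const_nhds.congr' ?_
    filter_upwards [self_mem_nhdsWithin] with q hq
    rw [neg_mul, inv_mul_cancel₀ (Admissible.sub_inv_ne_zero hq)]
  exact neg_ne_zero.mpr one_ne_zero (tendsto_nhds_unique h3 h2)

end TwistedOsp

end

open TwistedOsp in
theorem theorem1 :
    (∀ q s : ℂ, Admissible q → s ^ 2 = q →
      ∃ π : Uq q →ₐ[ℂ] Module.End ℂ Fock,
        π (Uq.gen q .gam) = algebraMap ℂ (Module.End ℂ Fock) s ∧
        (∀ n : ℕ, π (Uq.gen q (.psiP n)) = bosonPsiP q n) ∧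
        (∀ n : ℕ, π (Uq.gen q (.psiM n)) = bosonPsiM q n) ∧
        (∀ (n : ℤ) (v : Fock), π (Uq.gen q (.xP n)) v = bosonXp q s n v) ∧
        (∀ (n : ℤ) (v : Fock), π (Uq.gen q (.xM n)) v = bosonXm q s n v) ∧
        (∀ g : Gen, parity * π (Uq.gen q g) = g.sign • (π (Uq.gen q g) * parity))) ∧
    (∀ r : ℂ → ℂ, (∀ q : ℂ, r q ^ 2 = q) →
      ∃ (n : ℤ) (μ ν : ℤ × ℤ),
        ¬ ∃ L : ℂ, Filter.Tendsto
          (fun q : ℂ => MvPolynomial.coeff 0 (bosonXm q (r q) n (vac μ) ν))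
          (nhdsWithin 1 {q : ℂ | Admissible q}) (nhds L)) := by
  refine ⟨fun q s hq hs => ⟨rep hq hs, ?_, fun n => ?_, fun n => ?_, fun n v => ?_, fun n v => ?_,
    fun g => ?_⟩, fun r _ => ⟨-1, 0, (-1, 1), ?_⟩⟩
  · rw [rep_gen]; rfl
  · rw [rep_gen, bosonPsiP_eq]; rfl
  · rw [rep_gen, bosonPsiM_eq]; rfl
  · rw [rep_gen]; exact xPlus_apply q s n v
  · rw [rep_gen]; exact xMinus_apply q s n v
  · rw [rep_gen]; exact parity_mul_repGen g
  · simp only [coeff_bosonXm_vac]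
    exact not_tendsto_inv
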